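/- Let $N\geq 1$ be an integer and $\omega=e^{2\pi i/N}$; all indices $k,l,\dots$ run over $\mathbb Z/N$. C*-algebras need not be unital, and $M_N(A)$ denotes the $N\times N$-matrices over a C*-algebra $A$. **The algebras.** * A finite quantum space is a finite dimensional C*-algebra $B$ with a faithful state $\psi$ such that $m m^*=\delta^2\,\mathrm{id}$ for some $\delta>0$, where $m:B\otimes B\to B$ is the multiplication and $m^*$ its adjoint with respect to $\langle x,y\rangle=\psi(x^*y)$. A directed quantum graph $\mathcal G=(B,\psi,A)$ is a finite quantum space with a linear map $A:B\to B$ such that $m(A\otimes A)m^*=\delta^2A$. A quantum Cuntz–Krieger $\mathcal G$-family in a C*-algebra $D$ is a linear map $s:B\to D$ with $\mu(\mathrm{id}\otimes\mu)(s\otimes s^*\otimes s)(\mathrm{id}\otimes m^*)m^*=s$ and $\mu(s^*\otimes s)m^*=\mu(s\otimes s^*)m^*A$, where $\mu$ is the multiplication of $D$ and $s^*(b)=s(b^*)^*$. The quantum Cuntz–Krieger algebra $\mathbb F\mathcal O(\mathcal G)$ is the universal C*-algebra generated by a quantum Cuntz–Krieger $\mathcal G$-family $S$. * $K(M_N(\mathbb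 C),\mathrm{tr})$ is the complete quantum graph on $M_N(\mathbb C)$ with normalized trace $\mathrm{tr}$ ($\delta=N$), given by $A(b)=\delta^2\,\mathrm{tr}(b)1$; $TM_N$ is the trivial quantum graph on $(M_N(\mathbb C),\mathrm{tr})$, given by $A=\mathrm{id}$. In both cases write $S_{kl}=S(N e_{kl})$ for the standard generators of $\mathbb F\mathcal O$. * $\mathcal O_{N^2}$ is the Cuntz algebra, the universal unital C*-algebra generated by isometries $S_{kl}$ with $\sum_{k,l}S_{kl}S_{kl}^*=1$ (for $N=1$ this is $C(S^1)$). $*_{N^2}C(S^1)$ is the non-unital free product of $N^2$ copies of $C(S^1)$, indexed by pairs $(k,l)$, with $S_{kl}$ the canonical unitary generator of the copy with index $(k,l)$. **The actions.** On $\mathbb F\mathcal O(K(M_N(\mathbb C),\mathrm{tr}))$ and on $\mathbb F\mathcal O(TM_N)$ let $\alpha_1,\alpha_2$ be the commuting actions of $\mathbb Z_N=\mathbb Z/N$ whose generators act by $$\alpha_1(S_{kl})=\omega^{k-l}S_{kl},\qquad \alpha_2(S_{kl})=S_{k-1,l-1}$$ (these are induced by conjugation of $M_N(\mathbb C)$ by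 the generalized Pauli matrices $X$ and $Z^*$, where $X|j\rangle=\omega^j|j\rangle$, $Z|j\rangle=|j+1\rangle$). On $\mathcal O_{N^2}$ and on $*_{N^2}C(S^1)$ let $\beta_1,\beta_2$ be the commuting actions of $\mathbb Z_N$ whose generators act by $$\beta_1(S_{kl})=S_{k-1,l},\qquad \beta_2(S_{kl})=S_{k,l-1}.$$ If $\gamma_1,\gamma_2$ is one of these pairs of actions on a C*-algebra $A$, let $\gamma_2$ act on the (full) crossed product $A\rtimes_{\gamma_1}\mathbb Z_N$, with canonical unitaries $u_g$, by letting the generator send $a u_g$ to $\gamma_2(a)\,\omega^{g}u_g$ for $a\in A$, $g\in\mathbb Z_N$; $A\rtimes_{\gamma_1}\mathbb Z_N\rtimes_{\gamma_2}\mathbb Z_N$ is the resulting iterated crossed product. **Theorem.** For every integer $N\ge1$ there exist $*$-isomorphisms $$M_N(\mathbb F\mathcal O(K(M_N(\mathbb C),\mathrm{tr})))\cong \mathcal O_{N^2}\rtimes_{\beta_1}\mathbb Z_N\rtimes_{\beta_2}\mathbb Z_N,$$ $$M_N(\mathcal O_{N^2})\cong \mathbb F\mathcal O(K(M_N(\mathbb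 C),\mathrm{tr}))\rtimes_{\alpha_1}\mathbb Z_N\rtimes_{\alpha_2}\mathbb Z_N,$$ $$M_N(\mathbb F\mathcal O(TM_N))\cong \big(*_{N^2}C(S^1)\big)\rtimes_{\beta_1}\mathbb Z_N\rtimes_{\beta_2}\mathbb Z_N,$$ $$M_N\big(*_{N^2}C(S^1)\big)\cong \mathbb F\mathcal O(TM_N)\rtimes_{\alpha_1}\mathbb Z_N\rtimes_{\alpha_2}\mathbb Z_N.$$ -/

import Mathlib

open scoped TensorProduct ComplexOrder

noncomputable section

/-! ## Universal C*-algebras given by generators and relations -/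

/-- Noncommutative `*`-polynomials without constant term in the variables `X`. -/
inductive StarPoly (X : Type) : Type
  | gen : X → StarPoly X
  | zero : StarPoly X
  | add : StarPoly X → StarPoly X → StarPoly X
  | neg : StarPoly X → StarPoly X
  | smul : ℂ → StarPoly X → StarPoly X
  | mul : StarPoly X → StarPoly X → StarPoly X
  | adj : StarPoly X → StarPoly X

namespace StarPoly

/-- Evaluation of a `*`-polynomial at a family of elements of a C*-algebra. -/
def eval {X D : Type} [NonUnitalCStarAlgebra D] (s : X → D) : StarPoly X → D
  | gen x => s x
  | zero => 0
  | add p q => eval s p + eval s q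
  | neg p => - eval s p
  | smul c p => c • eval s p
  | mul p q => eval s p * eval s q
  | adj p => star (eval s p)

/-- Renaming of variables. -/
def rename {X Y : Type} (f : X → Y) : StarPoly X → StarPoly Y
  | gen x => gen (f x)
  | zero => zero
  | add p q => add (rename f p) (rename f q)
  | neg p => neg (rename f p)
  | smul c p => smul c (rename f p)
  | mul p q => mul (rename f p) (rename f q)
  | adj p => adj (rename f p)

theorem eval_rename {X Y D : Type} [NonUnitalCStarAlgebra D] (f : X → Y) (s : Y → D)
    (p : StarPoly X) : eval s (rename f p) = eval (s ∘ f) p := by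
  induction p <;> simp_all [eval, rename]

end StarPoly

/-- A relation for families `X → D` of elements of C*-algebras `D` (unital or not). -/
structure CStarRelation (X : Type) where
  Holds : ∀ {D : Type} [NonUnitalCStarAlgebra D], (X → D) → Prop

namespace CStarRelation

variable {X Y : Type}

/-- The relation bounds the norm of each generator, uniformly over all C*-algebras. This is what
makes the universal C*-algebra of the relation exist. -/
class IsBounded (R : CStarRelation X) : Prop where
  bound : ∀ x : X, ∃ C : ℝ, ∀ (D : Type) [NonUnitalCStarAlgebra D] (s : X → D),
    R.Holds s → ‖s x‖ ≤ C

/-- The norms of a `*`-polynomial in all families satisfying the relation. -/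
def normSet (R : CStarRelation X) (p : StarPoly X) : Set ℝ :=
  {r | ∃ (D : Type) (_ : NonUnitalCStarAlgebra D) (s : X → D), R.Holds s ∧ r = ‖p.eval s‖}

theorem bddAbove_normSet (R : CStarRelation X) [hR : R.IsBounded] (p : StarPoly X) :
    BddAbove (R.normSet p) := by
  suffices h : ∃ C : ℝ, ∀ (D : Type) [NonUnitalCStarAlgebra D] (s : X → D),
      R.Holds s → ‖p.eval s‖ ≤ C by
    obtain ⟨C, hC⟩ := h
    exact ⟨C, by rintro r ⟨D, _, s, hs, rfl⟩; exact hC D s hs⟩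
  induction p with
  | gen x => exact hR.bound x
  | zero => exact ⟨0, fun D _ s _ => by simp [StarPoly.eval]⟩
  | add p q hp hq =>
    obtain ⟨C, hC⟩ := hp
    obtain ⟨C', hC'⟩ := hq
    exact ⟨C + C', fun D _ s hs => (norm_add_le _ _).trans (add_le_add (hC D s hs) (hC' D s hs))⟩
  | neg p hp =>
    obtain ⟨C, hC⟩ := hp
    exact ⟨C, fun D _ s hs => by simpa [StarPoly.eval] using hC D s hs⟩
  | smul c p hp =>
    obtain ⟨C, hC⟩ := hp
    refine ⟨‖c‖ * C, fun D _ s hs => ?_⟩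
    simpa [StarPoly.eval, norm_smul] using mul_le_mul_of_nonneg_left (hC D s hs) (norm_nonneg c)
  | mul p q hp hq =>
    obtain ⟨C, hC⟩ := hp
    obtain ⟨C', hC'⟩ := hq
    exact ⟨C * C', fun D _ s hs => (norm_mul_le _ _).trans
      (mul_le_mul (hC D s hs) (hC' D s hs) (norm_nonneg _)
        ((norm_nonneg _).trans (hC D s hs)))⟩
  | adj p hp =>
    obtain ⟨C, hC⟩ := hp
    exact ⟨C, fun D _ s hs => by simpa [StarPoly.eval] using hC D s hs⟩

/-- Two `*`-polynomials are identified when they agree in all families satisfying the relation. -/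
def setoid (R : CStarRelation X) : Setoid (StarPoly X) where
  r p q := ∀ (D : Type) [NonUnitalCStarAlgebra D] (s : X → D), R.Holds s → p.eval s = q.eval s
  iseqv := ⟨fun _ _ _ _ _ => rfl, fun h D _ s hs => (h D s hs).symm,
    fun h h' D _ s hs => (h D s hs).trans (h' D s hs)⟩

/-- The `*`-algebra generated by a universal family satisfying the relation. -/
def Pre (R : CStarRelation X) : Type := Quotient R.setoid

namespace Pre

variable (R : CStarRelation X)

/-- The class of a `*`-polynomial. -/
def mk (p : StarPoly X) : R.Pre := Quotient.mk R.setoid p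

variable {R}

theorem mk_eq {p q : StarPoly X} (h : ∀ (D : Type) [NonUnitalCStarAlgebra D] (s : X → D),
    R.Holds s → p.eval s = q.eval s) : mk R p = mk R q := Quotient.sound h

theorem eval_eq {p q : StarPoly X} (h : mk R p = mk R q) {D : Type} [NonUnitalCStarAlgebra D]
    (s : X → D) (hs : R.Holds s) : p.eval s = q.eval s := Quotient.exact h D s hs

theorem ind {P : R.Pre → Prop} (h : ∀ p, P (mk R p)) (a : R.Pre) : P a := Quotient.ind h a

instance : Zero R.Pre := ⟨mk R .zero⟩

instance : Add R.Pre := ⟨Quotient.map₂ .add (fun _ _ h _ _ h' D _ s hs => by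
  simp [StarPoly.eval, h D s hs, h' D s hs])⟩

instance : Mul R.Pre := ⟨Quotient.map₂ .mul (fun _ _ h _ _ h' D _ s hs => by
  simp [StarPoly.eval, h D s hs, h' D s hs])⟩

instance : Neg R.Pre := ⟨Quotient.map .neg (fun _ _ h D _ s hs => by
  simp [StarPoly.eval, h D s hs])⟩

instance : Star R.Pre := ⟨Quotient.map .adj (fun _ _ h D _ s hs => by
  simp [StarPoly.eval, h D s hs])⟩

instance : SMul ℂ R.Pre := ⟨fun c => Quotient.map (.smul c) (fun _ _ h D _ s hs => by
  simp [StarPoly.eval, h D s hs])⟩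

theorem mk_zero : (0 : R.Pre) = mk R .zero := rfl
theorem mk_add (p q : StarPoly X) : mk R p + mk R q = mk R (.add p q) := rfl
theorem mk_mul (p q : StarPoly X) : mk R p * mk R q = mk R (.mul p q) := rfl
theorem mk_neg (p : StarPoly X) : - mk R p = mk R (.neg p) := rfl
theorem mk_star (p : StarPoly X) : star (mk R p) = mk R (.adj p) := rfl
theorem mk_smul (c : ℂ) (p : StarPoly X) : c • mk R p = mk R (.smul c p) := rfl

instance : NonUnitalRing R.Pre where
  add_assoc := by
    refine ind fun p => ind fun q => ind fun r => mk_eq fun D _ s _ => add_assoc _ _ _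
  zero_add := by refine ind fun p => mk_eq fun D _ s _ => zero_add _
  add_zero := by refine ind fun p => mk_eq fun D _ s _ => add_zero _
  add_comm := by refine ind fun p => ind fun q => mk_eq fun D _ s _ => add_comm _ _
  neg_add_cancel := by refine ind fun p => mk_eq fun D _ s _ => neg_add_cancel _
  nsmul := nsmulRec
  zsmul := zsmulRec
  left_distrib := by
    refine ind fun p => ind fun q => ind fun r => mk_eq fun D _ s _ => mul_add _ _ _
  right_distrib := by
    refine ind fun p => ind fun q => ind fun r => mk_eq fun D _ s _ => add_mul _ _ _
  zero_mul := by refine ind fun p => mk_eq fun D _ s _ => zero_mul _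
  mul_zero := by refine ind fun p => mk_eq fun D _ s _ => mul_zero _
  mul_assoc := by
    refine ind fun p => ind fun q => ind fun r => mk_eq fun D _ s _ => mul_assoc _ _ _

instance : StarRing R.Pre where
  star_involutive := by refine ind fun p => mk_eq fun D _ s _ => star_star _
  star_mul := by refine ind fun p => ind fun q => mk_eq fun D _ s _ => star_mul _ _
  star_add := by refine ind fun p => ind fun q => mk_eq fun D _ s _ => star_add _ _

instance : Module ℂ R.Pre where
  one_smul := by refine ind fun p => mk_eq fun D _ s _ => one_smul _ _
  mul_smul c d := by refine ind fun p => mk_eq fun D _ s _ => mul_smul _ _ _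
  smul_zero c := mk_eq fun D _ s _ => smul_zero _
  smul_add c := by refine ind fun p => ind fun q => mk_eq fun D _ s _ => smul_add _ _ _
  add_smul c d := by refine ind fun p => mk_eq fun D _ s _ => add_smul _ _ _
  zero_smul := by refine ind fun p => mk_eq fun D _ s _ => zero_smul _ _

instance : IsScalarTower ℂ R.Pre R.Pre where
  smul_assoc c := by refine ind fun p => ind fun q => mk_eq fun D _ s _ => smul_mul_assoc _ _ _

instance : SMulCommClass ℂ R.Pre R.Pre where
  smul_comm c := by
    refine ind fun p => ind fun q => mk_eq fun D _ s _ => (mul_smul_comm _ _ _).symm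

instance : StarModule ℂ R.Pre where
  star_smul c := by refine ind fun p => mk_eq fun D _ s _ => star_smul _ _

/-- The universal norm: the supremum over all families satisfying the relation. -/
instance : Norm R.Pre := ⟨Quotient.lift (fun p => sSup (R.normSet p)) (fun p q h => by
  have : R.normSet p = R.normSet q := by
    ext r
    constructor
    · rintro ⟨D, _, s, hs, rfl⟩; exact ⟨D, _, s, hs, by rw [h D s hs]⟩
    · rintro ⟨D, _, s, hs, rfl⟩; exact ⟨D, _, s, hs, by rw [h D s hs]⟩
  simp only [this])⟩

theorem norm_mk (p : StarPoly X) : ‖mk R p‖ = sSup (R.normSet p) := rfl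

theorem norm_mk_le {p : StarPoly X} {C : ℝ} (hC : 0 ≤ C)
    (h : ∀ (D : Type) [NonUnitalCStarAlgebra D] (s : X → D), R.Holds s → ‖p.eval s‖ ≤ C) :
    ‖mk R p‖ ≤ C :=
  Real.sSup_le (by rintro r ⟨D, _, s, hs, rfl⟩; exact h D s hs) hC

theorem norm_mk_nonneg (p : StarPoly X) : 0 ≤ ‖mk R p‖ :=
  Real.sSup_nonneg (by rintro r ⟨D, _, s, hs, rfl⟩; exact norm_nonneg _)

variable [R.IsBounded]

theorem le_norm_mk (p : StarPoly X) {D : Type} [NonUnitalCStarAlgebra D] {s : X → D}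
    (hs : R.Holds s) : ‖p.eval s‖ ≤ ‖mk R p‖ :=
  le_csSup (R.bddAbove_normSet p) ⟨D, _, s, hs, rfl⟩

theorem normCore : NormedSpace.Core ℂ R.Pre where
  norm_nonneg := ind norm_mk_nonneg
  norm_smul c := by
    have key : ∀ (c : ℂ) (p : StarPoly X), ‖mk R (.smul c p)‖ ≤ ‖c‖ * ‖mk R p‖ := fun c p =>
      norm_mk_le (mul_nonneg (norm_nonneg _) (norm_mk_nonneg _)) fun D _ s hs => by
        rw [StarPoly.eval, norm_smul]
        exact mul_le_mul_of_nonneg_left (le_norm_mk p hs) (norm_nonneg _)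
    refine ind fun p => le_antisymm (key c p) ?_
    rcases eq_or_ne c 0 with rfl | hc
    · rw [norm_zero, zero_mul]
      exact norm_mk_nonneg (R := R) (.smul 0 p)
    · have h := key c⁻¹ (.smul c p)
      have h2 : mk R (.smul c⁻¹ (.smul c p)) = mk R p := by
        rw [← mk_smul, ← mk_smul, inv_smul_smul₀ hc]
      rw [h2, norm_inv, ← div_eq_inv_mul, le_div_iff₀ (norm_pos_iff.2 hc), mul_comm] at h
      exact h
  norm_triangle := by
    refine ind fun p => ind fun q =>
      norm_mk_le (add_nonneg (norm_mk_nonneg _) (norm_mk_nonneg _)) fun D _ s hs => ?_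
    exact (norm_add_le _ _).trans (add_le_add (le_norm_mk p hs) (le_norm_mk q hs))
  norm_eq_zero_iff := by
    refine ind fun p => ⟨fun h => mk_eq fun D _ s hs => ?_, fun h => ?_⟩
    · exact norm_le_zero_iff.1 ((le_norm_mk p hs).trans h.le)
    · rw [h]
      exact le_antisymm (norm_mk_le le_rfl fun D _ s hs => by simp [StarPoly.eval])
        (norm_mk_nonneg _)

instance : NormedAddCommGroup R.Pre := NormedAddCommGroup.ofCore normCore

instance : NormedSpace ℂ R.Pre := NormedSpace.ofCore normCore

instance : NonUnitalNormedRing R.Pre where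
  __ : NormedAddCommGroup R.Pre := inferInstance
  __ : NonUnitalRing R.Pre := inferInstance
  norm_mul_le := by
    refine ind fun p => ind fun q =>
      norm_mk_le (mul_nonneg (norm_mk_nonneg _) (norm_mk_nonneg _)) fun D _ s hs => ?_
    exact (norm_mul_le _ _).trans
      (mul_le_mul (le_norm_mk p hs) (le_norm_mk q hs) (norm_nonneg _) (norm_mk_nonneg _))

instance : CStarRing R.Pre where
  norm_mul_self_le := by
    refine ind fun p => ?_
    have h0 : 0 ≤ ‖star (mk R p) * mk R p‖ := norm_nonneg _
    have h : ‖mk R p‖ ≤ √‖star (mk R p) * mk R p‖ :=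
      norm_mk_le (Real.sqrt_nonneg _) fun D _ s hs => by
        refine Real.le_sqrt_of_sq_le ?_
        have h := le_norm_mk (R := R) (.mul (.adj p) p) hs
        rw [StarPoly.eval, StarPoly.eval, CStarRing.norm_star_mul_self] at h
        rw [sq]
        exact h
    calc ‖mk R p‖ * ‖mk R p‖ ≤ √‖star (mk R p) * mk R p‖ * √‖star (mk R p) * mk R p‖ :=
          mul_self_le_mul_self (norm_nonneg _) h
      _ = _ := Real.mul_self_sqrt h0

end Pre

end CStarRelation

open UniformSpace (Completion)

/-- The universal C*-algebra generated by a family satisfying the relation `R`: the completion of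
the `*`-algebra generated by a universal family, in the universal norm. -/
def UniversalCStarAlgebra {X : Type} (R : CStarRelation X) [R.IsBounded] : Type :=
  Completion R.Pre

namespace UniversalCStarAlgebra

open CStarRelation

variable {X Y : Type} {R : CStarRelation X} [R.IsBounded]

instance : NormedAddCommGroup (UniversalCStarAlgebra R) :=
  inferInstanceAs (NormedAddCommGroup (Completion R.Pre))

instance : NormedSpace ℂ (UniversalCStarAlgebra R) :=
  inferInstanceAs (NormedSpace ℂ (Completion R.Pre))

instance : CompleteSpace (UniversalCStarAlgebra R) :=
  inferInstanceAs (CompleteSpace (Completion R.Pre))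

/-- The canonical map from the dense `*`-algebra. -/
def ofPre (a : R.Pre) : UniversalCStarAlgebra R := (a : Completion R.Pre)

theorem isDenseInducing_ofPre : IsDenseInducing (ofPre (R := R)) :=
  Completion.isDenseInducing_coe

theorem continuous_ofPre : Continuous (ofPre (R := R)) := Completion.continuous_coe _

theorem denseRange_ofPre : DenseRange (ofPre (R := R)) := Completion.denseRange_coe

theorem norm_ofPre (a : R.Pre) : ‖ofPre a‖ = ‖a‖ := Completion.norm_coe a

theorem ofPre_add (a b : R.Pre) : ofPre (a + b) = ofPre a + ofPre b := Completion.coe_add a b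

theorem ofPre_neg (a : R.Pre) : ofPre (-a) = - ofPre a := Completion.coe_neg a

theorem ofPre_zero : ofPre (0 : R.Pre) = 0 := Completion.coe_zero

theorem ofPre_smul (c : ℂ) (a : R.Pre) : ofPre (c • a) = c • ofPre a := Completion.coe_smul c a

/-- `ofPre` as an additive map. -/
def ofPreHom : R.Pre →+ UniversalCStarAlgebra R := ⟨⟨ofPre, ofPre_zero⟩, ofPre_add⟩

/-- `ofPre` as a continuous linear map. -/
def ofPreCLM : R.Pre →L[ℂ] UniversalCStarAlgebra R where
  toFun := ofPre
  map_add' := ofPre_add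
  map_smul' := ofPre_smul
  cont := continuous_ofPre

theorem induction_on {P : UniversalCStarAlgebra R → Prop} (a : UniversalCStarAlgebra R)
    (hP : IsClosed {a | P a}) (h : ∀ a, P (ofPre a)) : P a :=
  Completion.induction_on a hP h

instance : Mul (UniversalCStarAlgebra R) :=
  ⟨Function.curry <| (isDenseInducing_ofPre.prodMap isDenseInducing_ofPre).extend
    (ofPre ∘ Function.uncurry (· * ·))⟩

theorem ofPre_mul (a b : R.Pre) : ofPre (a * b) = ofPre a * ofPre b :=
  ((isDenseInducing_ofPre.prodMap isDenseInducing_ofPre).extend_eq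
    (continuous_ofPre.comp continuous_mul) (a, b)).symm

instance : ContinuousMul (UniversalCStarAlgebra R) where
  continuous_mul := by
    let m := (AddMonoidHom.mul : R.Pre →+ R.Pre →+ R.Pre).compr₂ ofPreHom
    have : Continuous fun p : R.Pre × R.Pre => m p.1 p.2 :=
      continuous_ofPre.comp continuous_mul
    have di : IsDenseInducing (ofPreHom : R.Pre → UniversalCStarAlgebra R) :=
      isDenseInducing_ofPre
    exact (di.extend_Z_bilin di this :)

instance : Star (UniversalCStarAlgebra R) := ⟨Completion.map (star : R.Pre → R.Pre)⟩

theorem ofPre_star (a : R.Pre) : ofPre (star a) = star (ofPre a) :=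
  (Completion.map_coe (star_isometry (E := R.Pre)).uniformContinuous a).symm

instance : ContinuousStar (UniversalCStarAlgebra R) := ⟨Completion.continuous_map⟩

theorem induction_on₂ {P : UniversalCStarAlgebra R → UniversalCStarAlgebra R → Prop}
    (a b : UniversalCStarAlgebra R)
    (hP : IsClosed {x : UniversalCStarAlgebra R × UniversalCStarAlgebra R | P x.1 x.2})
    (h : ∀ a b, P (ofPre a) (ofPre b)) : P a b :=
  Completion.induction_on₂ a b hP h

theorem induction_on₃
    {P : UniversalCStarAlgebra R → UniversalCStarAlgebra R → UniversalCStarAlgebra R → Prop}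
    (a b c : UniversalCStarAlgebra R)
    (hP : IsClosed {x : UniversalCStarAlgebra R × UniversalCStarAlgebra R ×
      UniversalCStarAlgebra R | P x.1 x.2.1 x.2.2})
    (h : ∀ a b c, P (ofPre a) (ofPre b) (ofPre c)) : P a b c :=
  Completion.induction_on₃ a b c hP h

instance : NonUnitalRing (UniversalCStarAlgebra R) where
  __ : AddCommGroup (UniversalCStarAlgebra R) := inferInstance
  zero_mul a := by
    refine induction_on (P := fun a => 0 * a = 0) a
      (isClosed_eq (continuous_const.mul continuous_id) continuous_const) fun a => ?_
    rw [← ofPre_zero, ← ofPre_mul, zero_mul]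
  mul_zero a := by
    refine induction_on (P := fun a => a * 0 = 0) a
      (isClosed_eq (continuous_id.mul continuous_const) continuous_const) fun a => ?_
    rw [← ofPre_zero, ← ofPre_mul, mul_zero]
  mul_assoc a b c := by
    refine induction_on₃ (P := fun a b c => a * b * c = a * (b * c)) a b c
      (isClosed_eq (by fun_prop) (by fun_prop)) fun a b c => ?_
    simp only [← ofPre_mul, mul_assoc]
  left_distrib a b c := by
    refine induction_on₃ (P := fun a b c => a * (b + c) = a * b + a * c) a b c
      (isClosed_eq (by fun_prop) (by fun_prop)) fun a b c => ?_
    rw [← ofPre_mul, ← ofPre_mul, ← ofPre_add, ← ofPre_add, ← ofPre_mul, mul_add]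
  right_distrib a b c := by
    refine induction_on₃ (P := fun a b c => (a + b) * c = a * c + b * c) a b c
      (isClosed_eq (by fun_prop) (by fun_prop)) fun a b c => ?_
    rw [← ofPre_mul, ← ofPre_mul, ← ofPre_add, ← ofPre_add, ← ofPre_mul, add_mul]

instance : NonUnitalNormedRing (UniversalCStarAlgebra R) where
  __ : NormedAddCommGroup (UniversalCStarAlgebra R) := inferInstance
  __ : NonUnitalRing (UniversalCStarAlgebra R) := inferInstance
  norm_mul_le a b := by
    refine induction_on₂ (P := fun a b => ‖a * b‖ ≤ ‖a‖ * ‖b‖) a b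
      (isClosed_le (by fun_prop) (by fun_prop)) fun a b => ?_
    rw [← ofPre_mul, norm_ofPre, norm_ofPre, norm_ofPre]
    exact norm_mul_le a b

instance : StarRing (UniversalCStarAlgebra R) where
  star_involutive a := by
    refine induction_on (P := fun a => star (star a) = a) a
      (isClosed_eq (by fun_prop) (by fun_prop)) fun a => ?_
    rw [← ofPre_star, ← ofPre_star, star_star]
  star_mul a b := by
    refine induction_on₂ (P := fun a b => star (a * b) = star b * star a) a b
      (isClosed_eq (by fun_prop) (by fun_prop)) fun a b => ?_
    rw [← ofPre_mul, ← ofPre_star, ← ofPre_star, ← ofPre_star, ← ofPre_mul, star_mul]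
  star_add a b := by
    refine induction_on₂ (P := fun a b => star (a + b) = star a + star b) a b
      (isClosed_eq (by fun_prop) (by fun_prop)) fun a b => ?_
    rw [← ofPre_add, ← ofPre_star, ← ofPre_star, ← ofPre_star, ← ofPre_add, star_add]

instance : CStarRing (UniversalCStarAlgebra R) where
  norm_mul_self_le a := by
    refine induction_on (P := fun a => ‖a‖ * ‖a‖ ≤ ‖star a * a‖) a
      (isClosed_le (by fun_prop) (by fun_prop)) fun a => ?_
    rw [← ofPre_star, ← ofPre_mul, norm_ofPre, norm_ofPre]
    exact CStarRing.norm_mul_self_le a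

instance : IsScalarTower ℂ (UniversalCStarAlgebra R) (UniversalCStarAlgebra R) where
  smul_assoc c a b := by
    refine induction_on₂ (P := fun a b => (c • a) * b = c • (a * b)) a b
      (isClosed_eq ((continuous_fst.const_smul c).mul continuous_snd)
        ((continuous_fst.mul continuous_snd).const_smul c)) fun a b => ?_
    rw [← ofPre_mul, ← ofPre_smul, ← ofPre_smul, ← ofPre_mul, smul_mul_assoc]

instance : SMulCommClass ℂ (UniversalCStarAlgebra R) (UniversalCStarAlgebra R) where
  smul_comm c a b := by
    refine induction_on₂ (P := fun a b => c • (a * b) = a * (c • b)) a b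
      (isClosed_eq ((continuous_fst.mul continuous_snd).const_smul c)
        (continuous_fst.mul (continuous_snd.const_smul c))) fun a b => ?_
    rw [← ofPre_mul, ← ofPre_smul, ← ofPre_smul, ← ofPre_mul, mul_smul_comm]

instance : StarModule ℂ (UniversalCStarAlgebra R) where
  star_smul c a := by
    refine induction_on (P := fun a => star (c • a) = star c • star a) a
      (isClosed_eq (continuous_id.const_smul c).star (continuous_id.star.const_smul (star c)))
      fun a => ?_
    rw [← ofPre_smul, ← ofPre_star, ← ofPre_star, ← ofPre_smul, star_smul]

instance : NonUnitalCStarAlgebra (UniversalCStarAlgebra R) where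

/-- The universal family. -/
def gen (R : CStarRelation X) [R.IsBounded] (x : X) : UniversalCStarAlgebra R :=
  ofPre (Pre.mk R (.gen x))

theorem ofPre_mk (p : StarPoly X) : ofPre (Pre.mk R p) = p.eval (gen R) := by
  induction p with
  | gen x => rfl
  | zero => exact ofPre_zero
  | add p q hp hq => rw [← Pre.mk_add, ofPre_add, hp, hq, StarPoly.eval]
  | neg p hp => rw [← Pre.mk_neg, ofPre_neg, hp, StarPoly.eval]
  | smul c p hp => rw [← Pre.mk_smul, ofPre_smul, hp, StarPoly.eval]
  | mul p q hp hq => rw [← Pre.mk_mul, ofPre_mul, hp, hq, StarPoly.eval]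
  | adj p hp => rw [← Pre.mk_star, ofPre_star, hp, StarPoly.eval]

theorem norm_eval_gen (p : StarPoly X) : ‖p.eval (gen R)‖ = ‖Pre.mk R p‖ := by
  rw [← ofPre_mk, norm_ofPre]

section lift

variable {D : Type} [NonUnitalCStarAlgebra D] (s : X → D)
  (h : ∀ p : StarPoly X, ‖p.eval s‖ ≤ ‖p.eval (gen R)‖)

theorem eval_congr (h : ∀ p : StarPoly X, ‖p.eval s‖ ≤ ‖p.eval (gen R)‖) {p q : StarPoly X} (hpq : Pre.mk R p = Pre.mk R q) : p.eval s = q.eval s := by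
  have h1 := h (.add p (.neg q))
  have h2 : (StarPoly.add p (.neg q)).eval (gen R) = 0 := by
    simp only [StarPoly.eval, ← ofPre_mk, hpq]
    exact add_neg_cancel _
  rw [h2, norm_zero, norm_le_zero_iff, StarPoly.eval, StarPoly.eval, ← sub_eq_add_neg] at h1
  exact sub_eq_zero.1 h1

/-- Evaluation at `s` on the dense `*`-algebra, as a bounded linear map. -/
def preLift : R.Pre →L[ℂ] D :=
  LinearMap.mkContinuous
    { toFun := Quotient.lift (fun p => p.eval s) (fun _ _ hpq => eval_congr s h (Quotient.sound hpq))
      map_add' := by refine Pre.ind fun p => Pre.ind fun q => rfl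
      map_smul' := fun c => by refine Pre.ind fun p => rfl } 1
    (by refine Pre.ind fun p => ?_
        rw [one_mul, ← norm_eval_gen]
        exact h p)

/-- Evaluation at `s`, extended by continuity. -/
def liftCLM : UniversalCStarAlgebra R →L[ℂ] D :=
  (preLift s h).extend (ofPreCLM (R := R))

theorem liftCLM_ofPre_mk (p : StarPoly X) : liftCLM s h (ofPre (Pre.mk R p)) = p.eval s :=
  (preLift s h).extend_eq (e := ofPreCLM (R := R)) denseRange_ofPre (Completion.isUniformInducing_coe R.Pre) (Pre.mk R p)

/-- The `*`-homomorphism from the universal C*-algebra determined by a family `s` whose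
`*`-polynomials are dominated in norm by those of the universal family. -/
def liftOfLE : UniversalCStarAlgebra R →⋆ₙₐ[ℂ] D where
  toFun := liftCLM s h
  map_smul' c a := map_smul _ _ _
  map_zero' := map_zero _
  map_add' a b := map_add _ _ _
  map_mul' a b := by
    refine induction_on₂ (P := fun a b => liftCLM s h (a * b) = liftCLM s h a * liftCLM s h b) a b
      (isClosed_eq (by fun_prop) (by fun_prop)) (Pre.ind fun p => Pre.ind fun q => ?_)
    rw [← ofPre_mul, Pre.mk_mul, liftCLM_ofPre_mk, liftCLM_ofPre_mk, liftCLM_ofPre_mk]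
    rfl
  map_star' a := by
    refine induction_on (P := fun a => liftCLM s h (star a) = star (liftCLM s h a)) a
      (isClosed_eq (by fun_prop) (by fun_prop)) (Pre.ind fun p => ?_)
    rw [← ofPre_star, Pre.mk_star, liftCLM_ofPre_mk, liftCLM_ofPre_mk]
    rfl

theorem liftOfLE_gen (x : X) : liftOfLE s h (gen R x) = s x :=
  liftCLM_ofPre_mk s h (.gen x)

end lift

/-- The universal property: a family satisfying the relation extends to a `*`-homomorphism. -/
def lift {D : Type} [NonUnitalCStarAlgebra D] (s : X → D) (hs : R.Holds s) :
    UniversalCStarAlgebra R →⋆ₙₐ[ℂ] D :=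
  liftOfLE s fun p => by rw [norm_eval_gen]; exact Pre.le_norm_mk p hs

@[simp]
theorem lift_gen {D : Type} [NonUnitalCStarAlgebra D] (s : X → D) (hs : R.Holds s) (x : X) :
    lift s hs (gen R x) = s x := liftOfLE_gen _ _ x

/-- The `*`-homomorphism induced by a map between generators which turns families satisfying one
relation into families satisfying the other one. -/
def map {R' : CStarRelation Y} [R'.IsBounded] (f : X → Y)
    (hf : ∀ (D : Type) [NonUnitalCStarAlgebra D] (s : Y → D), R'.Holds s → R.Holds (s ∘ f)) :
    UniversalCStarAlgebra R →⋆ₙₐ[ℂ] UniversalCStarAlgebra R' :=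
  liftOfLE (gen R' ∘ f) fun p => by
    rw [← StarPoly.eval_rename, norm_eval_gen, norm_eval_gen]
    refine Pre.norm_mk_le (norm_nonneg _) fun D _ s hs => ?_
    rw [StarPoly.eval_rename]
    exact Pre.le_norm_mk p (hf D s hs)

@[simp]
theorem map_gen {R' : CStarRelation Y} [R'.IsBounded] (f : X → Y)
    (hf : ∀ (D : Type) [NonUnitalCStarAlgebra D] (s : Y → D), R'.Holds s → R.Holds (s ∘ f))
    (x : X) : map f hf (gen R x) = gen R' (f x) := liftOfLE_gen _ _ x

/-- `*`-homomorphisms agreeing on the generators are equal. -/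
theorem hom_ext {D : Type} [NonUnitalCStarAlgebra D] {φ ψ : UniversalCStarAlgebra R →⋆ₙₐ[ℂ] D}
    (h : ∀ x, φ (gen R x) = ψ (gen R x)) : φ = ψ := by
  have key : ∀ χ : UniversalCStarAlgebra R →⋆ₙₐ[ℂ] D, Continuous χ := fun χ =>
    AddMonoidHomClass.continuous_of_bound χ 1 fun a => by
      rw [one_mul]; exact NonUnitalStarAlgHom.norm_apply_le χ a
  ext a
  refine induction_on (P := fun a => φ a = ψ a) a (isClosed_eq (key φ) (key ψ)) (Pre.ind fun p => ?_)
  rw [ofPre_mk]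
  induction p with
  | gen x => exact h x
  | zero => simp [StarPoly.eval]
  | add p q hp hq => simp [StarPoly.eval, hp, hq]
  | neg p hp => simp [StarPoly.eval, hp]
  | smul c p hp => simp [StarPoly.eval, hp]
  | mul p q hp hq => simp [StarPoly.eval, hp, hq]
  | adj p hp => simp [StarPoly.eval, hp, map_star]

theorem _root_.NonUnitalStarAlgHom.mul_apply_apply {A : Type} [NonUnitalCStarAlgebra A]
    (φ ψ : A →⋆ₙₐ[ℂ] A) (a : A) : (φ * ψ) a = φ (ψ a) := rfl

section action

variable {G : Type} [Group G] (f : G → X → X)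
  (hf : ∀ g (D : Type) [NonUnitalCStarAlgebra D] (s : X → D), R.Holds s → R.Holds (s ∘ f g))
  (f_one : ∀ x, f 1 x = x) (f_mul : ∀ g h x, f (g * h) x = f g (f h x))

/-- The action of a group on a universal C*-algebra induced by an action on the generators which
preserves the defining relation: `g` sends the generator of index `x` to the one of index
`f g x`. -/
def action : G →* (UniversalCStarAlgebra R →⋆ₙₐ[ℂ] UniversalCStarAlgebra R) where
  toFun g := map (f g) (hf g)
  map_one' := hom_ext fun x => by
    rw [map_gen, f_one]; rfl
  map_mul' g h := hom_ext fun x => by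
    rw [NonUnitalStarAlgHom.mul_apply_apply, map_gen, map_gen, map_gen, f_mul]

theorem action_gen (g : G) (x : X) : action f hf f_one f_mul g (gen R x) = gen R (f g x) :=
  map_gen (f g) (hf g) x

end action

/-- `*`-endomorphisms commute if they commute on generators. -/
theorem commute_of_gen {φ ψ : UniversalCStarAlgebra R →⋆ₙₐ[ℂ] UniversalCStarAlgebra R}
    (h : ∀ x, φ (ψ (gen R x)) = ψ (φ (gen R x))) (a : UniversalCStarAlgebra R) :
    φ (ψ a) = ψ (φ a) := by
  rw [← NonUnitalStarAlgHom.mul_apply_apply, ← NonUnitalStarAlgHom.mul_apply_apply]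
  congr 1
  exact hom_ext h

end UniversalCStarAlgebra

/-! ## The Cuntz algebra -/

/-- The relation defining the Cuntz algebra with generators indexed by the finite set `ι`: there is
an element `e` acting as a unit on all the `s i`, for which the `s i` are isometries whose range
projections add up to `e`. Thus `e` is the unit of the C*-algebra generated by the `s i`. -/
def cuntzRelation (ι : Type) [Fintype ι] : CStarRelation ι where
  Holds s := ∃ e, (∀ i, e * s i = s i ∧ s i * e = s i ∧ star (s i) * s i = e) ∧
    ∑ i, s i * star (s i) = e

instance (ι : Type) [Fintype ι] : (cuntzRelation ι).IsBounded where
  bound i := by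
    refine ⟨1, fun D _ s hs => ?_⟩
    obtain ⟨e, he, -⟩ := hs
    obtain ⟨-, h1, h2⟩ := he i
    have h3 : e * e = e := by
      calc e * e = star (s i) * s i * e := by rw [h2]
        _ = star (s i) * (s i * e) := mul_assoc _ _ _
        _ = e := by rw [h1, h2]
    have h4 : star e = e := by rw [← h2, star_mul, star_star]
    have h5 : ‖e‖ * ‖e‖ = ‖e‖ := by
      conv_rhs => rw [← h3]
      nth_rewrite 3 [← h4]
      rw [CStarRing.norm_star_mul_self]
    have h6 : ‖e‖ ≤ 1 := by
      by_contra! h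
      nlinarith
    have h7 : ‖s i‖ * ‖s i‖ = ‖e‖ := by rw [← h2, CStarRing.norm_star_mul_self]
    nlinarith [norm_nonneg (s i)]

/-- The Cuntz algebra `O_n`, with `n` the cardinality of `ι`: the universal unital C*-algebra
generated by isometries `s i` with `∑ i, s i * star (s i) = 1`. -/
abbrev CuntzAlgebra (ι : Type) [Fintype ι] : Type := UniversalCStarAlgebra (cuntzRelation ι)

/-! ## Free products -/

/-- Families consisting of a `*`-homomorphism on each `A i`. -/
def freeProductRelation {ι : Type} (A : ι → Type) [∀ i, NonUnitalCStarAlgebra (A i)] :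
    CStarRelation (Σ i, A i) where
  Holds {D} _ s := ∃ φ : ∀ i, A i →⋆ₙₐ[ℂ] D, ∀ i a, s ⟨i, a⟩ = φ i a

instance {ι : Type} (A : ι → Type) [∀ i, NonUnitalCStarAlgebra (A i)] :
    (freeProductRelation A).IsBounded where
  bound x := by
    refine ⟨‖x.2‖, fun D _ s ⟨φ, hφ⟩ => ?_⟩
    rw [show s x = φ x.1 x.2 from hφ x.1 x.2]
    exact NonUnitalStarAlgHom.norm_apply_le (φ x.1) x.2

/-- The non-unital free product of a family of C*-algebras. -/
abbrev FreeProduct {ι : Type} (A : ι → Type) [∀ i, NonUnitalCStarAlgebra (A i)] : Type :=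
  UniversalCStarAlgebra (freeProductRelation A)

/-! ## Crossed products by discrete groups -/

section CrossedProduct

variable {G A : Type} [Group G] [NonUnitalCStarAlgebra A]

/-- Families `s (g, a)`, to be thought of as `a u_g`, which define a `*`-representation of the
convolution algebra of finitely supported functions `G → A`: they are linear in `a` and satisfy
`(a u_g) (b u_h) = a α_g(b) u_{gh}` and `(a u_g)^* = α_{g⁻¹}(a^*) u_{g⁻¹}`. -/
def crossedProductRelation (α : G →* (A →⋆ₙₐ[ℂ] A)) : CStarRelation (G × A) where
  Holds {D} _ s := ∃ φ : G → A →ₗ[ℂ] D, (∀ g a, s (g, a) = φ g a) ∧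
    (∀ g h a b, φ g a * φ h b = φ (g * h) (a * α g b)) ∧
    ∀ g a, star (φ g a) = φ g⁻¹ (α g⁻¹ (star a))

instance (α : G →* (A →⋆ₙₐ[ℂ] A)) : (crossedProductRelation α).IsBounded where
  bound x := by
    obtain ⟨g, a⟩ := x
    refine ⟨‖a‖, fun D _ s ⟨φ, hs, hmul, hstar⟩ => ?_⟩
    let π : A →⋆ₙₐ[ℂ] D :=
      { toFun := φ 1
        map_smul' := fun c a => map_smul _ _ _
        map_zero' := map_zero _
        map_add' := fun a b => map_add _ _ _
        map_mul' := fun a b => by rw [hmul, mul_one, map_one]; rfl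
        map_star' := fun a => by rw [hstar, inv_one, map_one]; rfl }
    have h1 : star (φ g a) * φ g a = π (α g⁻¹ (star a * a)) := by
      rw [hstar, hmul, inv_mul_cancel, ← map_mul]; rfl
    have h2 : ‖φ g a‖ * ‖φ g a‖ ≤ ‖a‖ * ‖a‖ := by
      rw [← CStarRing.norm_star_mul_self, ← CStarRing.norm_star_mul_self (x := a), h1]
      exact (NonUnitalStarAlgHom.norm_apply_le π _).trans
        (NonUnitalStarAlgHom.norm_apply_le (α g⁻¹) _)
    rw [hs]
    exact (mul_self_le_mul_self_iff (norm_nonneg _) (norm_nonneg _)).2 h2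

/-- The full crossed product of a C*-algebra by an action of a discrete group: the enveloping
C*-algebra of the convolution algebra. -/
abbrev CrossedProduct (α : G →* (A →⋆ₙₐ[ℂ] A)) : Type :=
  UniversalCStarAlgebra (crossedProductRelation α)

end CrossedProduct

/-! ## Double crossed products by `ℤ/N` -/

section DoubleCrossedProduct

variable {N : ℕ} [NeZero N] {A : Type} [NonUnitalCStarAlgebra A]

/-- Given commuting actions `α`, `β` of `ℤ/N` on `A`, the action of `ℤ/N` on the crossed product of
`A` by `α` which sends `a u_g` to `ω ^ (h g) β_h(a) u_g`, where `ω = exp (2 π i / N)`. -/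
def extendedAction (α β : Multiplicative (ZMod N) →* (A →⋆ₙₐ[ℂ] A))
    (hαβ : ∀ g h a, α g (β h a) = β h (α g a)) :
    Multiplicative (ZMod N) →* (CrossedProduct α →⋆ₙₐ[ℂ] CrossedProduct α) :=
  UniversalCStarAlgebra.action
    (fun h x => (x.1, ZMod.stdAddChar (h.toAdd * x.1.toAdd) • β h x.2))
    (by
      rintro h D _ s ⟨φ, hs, hmul, hstar⟩
      refine ⟨fun g => (ZMod.stdAddChar (h.toAdd * g.toAdd) : ℂ) • φ g ∘ₗ (β h : A →ₗ[ℂ] A),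
        fun g a => ?_, fun g g' a b => ?_, fun g a => ?_⟩
      · simp [hs]
      · change ((ZMod.stdAddChar (h.toAdd * g.toAdd) : ℂ) • φ g (β h a)) *
          ((ZMod.stdAddChar (h.toAdd * g'.toAdd) : ℂ) • φ g' (β h b)) =
          (ZMod.stdAddChar (h.toAdd * (g * g').toAdd) : ℂ) • φ (g * g') (β h (a * α g b))
        rw [smul_mul_smul_comm, hmul, hαβ, map_mul (β h), toAdd_mul, mul_add,
          AddChar.map_add_eq_mul]
      · change star ((ZMod.stdAddChar (h.toAdd * g.toAdd) : ℂ) • φ g (β h a)) =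
          (ZMod.stdAddChar (h.toAdd * (g⁻¹).toAdd) : ℂ) • φ g⁻¹ (β h (α g⁻¹ (star a)))
        rw [star_smul, hstar, ← hαβ, map_star (β h), toAdd_inv, mul_neg, AddChar.map_neg_eq_conj]
        rfl)
    (fun x => by simp)
    (fun h h' x => by
      rw [map_smul, smul_smul, map_mul β, toAdd_mul, add_mul, AddChar.map_add_eq_mul]
      rfl)

/-- The iterated crossed product `A ⋊_α ℤ/N ⋊_β ℤ/N`. -/
abbrev DoubleCrossedProduct (α β : Multiplicative (ZMod N) →* (A →⋆ₙₐ[ℂ] A))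
    (hαβ : ∀ g h a, α g (β h a) = β h (α g a)) : Type :=
  CrossedProduct (extendedAction α β hαβ)

end DoubleCrossedProduct

/-! ## Quantum graphs and their quantum Cuntz-Krieger algebras -/

/-- A finite quantum space: a finite dimensional C*-algebra `B` with a `δ`-form. The linear map
`comul` is the adjoint `m^*` of the multiplication `m : B ⊗ B → B` with respect to the inner product
`⟪x, y⟫ = state (star x * y)` on `B` and the corresponding inner product on `B ⊗ B`. -/
structure FiniteQuantumSpace (B : Type) [CStarAlgebra B] [FiniteDimensional ℂ B] where
  state : B →ₗ[ℂ] ℂ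
  state_nonneg : ∀ b, 0 ≤ state (star b * b)
  state_faithful : ∀ b, state (star b * b) = 0 → b = 0
  state_one : state 1 = 1
  comul : B →ₗ[ℂ] B ⊗[ℂ] B
  /-- `⟪x ⊗ y, m^* b⟫ = ⟪x * y, b⟫` -/
  comul_adjoint : ∀ x y b,
    LinearMap.mul' ℂ ℂ (TensorProduct.map (state ∘ₗ LinearMap.mulLeft ℂ (star x))
      (state ∘ₗ LinearMap.mulLeft ℂ (star y)) (comul b)) = state (star (x * y) * b)
  δ : ℝ
  δ_pos : 0 < δ
  /-- `m m^* = δ² id` -/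
  mul_comul : ∀ b, LinearMap.mul' ℂ B (comul b) = (δ : ℂ) ^ 2 • b

/-- A directed quantum graph on a finite quantum space, given by its quantum adjacency matrix. -/
structure QuantumGraph {B : Type} [CStarAlgebra B] [FiniteDimensional ℂ B]
    (Q : FiniteQuantumSpace B) where
  adj : B →ₗ[ℂ] B
  /-- `m (A ⊗ A) m^* = δ² A` -/
  adj_idem : LinearMap.mul' ℂ B ∘ₗ TensorProduct.map adj adj ∘ₗ Q.comul = (Q.δ : ℂ) ^ 2 • adj

/-- The linear map `s^*(b) = s(b^*)^*` -/
def LinearMap.starConj {B D : Type} [CStarAlgebra B] [NonUnitalCStarAlgebra D] (s : B →ₗ[ℂ] D) :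
    B →ₗ[ℂ] D where
  toFun b := star (s (star b))
  map_add' a b := by simp
  map_smul' c b := by simp

namespace QuantumGraph

variable {B : Type} [CStarAlgebra B] [FiniteDimensional ℂ B] {Q : FiniteQuantumSpace B}

/-- Quantum Cuntz-Krieger families of a directed quantum graph. -/
structure IsCuntzKriegerFamily (𝒢 : QuantumGraph Q) {D : Type} [NonUnitalCStarAlgebra D]
    (s : B →ₗ[ℂ] D) : Prop where
  /-- `μ (id ⊗ μ) (s ⊗ s^* ⊗ s) (id ⊗ m^*) m^* = s` -/
  isometry : LinearMap.mul' ℂ D ∘ₗ TensorProduct.map LinearMap.id (LinearMap.mul' ℂ D) ∘ₗ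
    TensorProduct.map s (TensorProduct.map s.starConj s) ∘ₗ
    TensorProduct.map LinearMap.id Q.comul ∘ₗ Q.comul = s
  /-- `μ (s^* ⊗ s) m^* = μ (s ⊗ s^*) m^* A` -/
  adjacency : LinearMap.mul' ℂ D ∘ₗ TensorProduct.map s.starConj s ∘ₗ Q.comul =
    LinearMap.mul' ℂ D ∘ₗ TensorProduct.map s s.starConj ∘ₗ Q.comul ∘ₗ 𝒢.adj

/-- The relation defining the quantum Cuntz-Krieger algebra. -/
def relation (𝒢 : QuantumGraph Q) : CStarRelation B where
  Holds {D} _ s := ∃ S : B →ₗ[ℂ] D, (∀ b, s b = S b) ∧ 𝒢.IsCuntzKriegerFamily S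

/-- The quantum Cuntz-Krieger algebra of a directed quantum graph: the universal C*-algebra
generated by a quantum Cuntz-Krieger family. -/
abbrev FO (𝒢 : QuantumGraph Q) [𝒢.relation.IsBounded] : Type := UniversalCStarAlgebra 𝒢.relation

/-- The complete quantum graph `K(B, ψ)`, with `A(b) = δ² ψ(b) 1`. -/
def complete (Q : FiniteQuantumSpace B) : QuantumGraph Q where
  adj := (Q.δ : ℂ) ^ 2 • (LinearMap.toSpanSingleton ℂ B 1 ∘ₗ Q.state)
  adj_idem := by
    have key : ∀ z : B ⊗[ℂ] B, LinearMap.mul' ℂ B (TensorProduct.map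
        ((Q.δ : ℂ) ^ 2 • (LinearMap.toSpanSingleton ℂ B 1 ∘ₗ Q.state))
        ((Q.δ : ℂ) ^ 2 • (LinearMap.toSpanSingleton ℂ B 1 ∘ₗ Q.state)) z) =
        ((Q.δ : ℂ) ^ 2 * (Q.δ : ℂ) ^ 2 * LinearMap.mul' ℂ ℂ (TensorProduct.map
          (Q.state ∘ₗ LinearMap.mulLeft ℂ (star 1))
          (Q.state ∘ₗ LinearMap.mulLeft ℂ (star 1)) z)) • (1 : B) := by
      intro z
      induction z with
      | zero => simp
      | tmul x y => simp [smul_smul]; ring_nf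
      | add x y hx hy => simp only [map_add, hx, hy, mul_add, add_smul]
    ext b
    simp only [LinearMap.comp_apply, key, Q.comul_adjoint]
    simp [smul_smul, mul_assoc]

/-- The trivial quantum graph `T(B, ψ)`, with `A = id`. -/
def trivial (Q : FiniteQuantumSpace B) : QuantumGraph Q where
  adj := LinearMap.id
  adj_idem := by
    ext b
    simp [Q.mul_comul]

/-- A linear map `θ : B → B` compatible with the involution, with `m^*` and with the quantum
adjacency matrix. Composition with `θ` preserves quantum Cuntz-Krieger families. -/
structure IsSymmetry (𝒢 : QuantumGraph Q) (θ : B →ₗ[ℂ] B) : Prop where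
  map_star : ∀ b, θ (star b) = star (θ b)
  comul_map : ∀ b, Q.comul (θ b) = TensorProduct.map θ θ (Q.comul b)
  adj_map : ∀ b, 𝒢.adj (θ b) = θ (𝒢.adj b)

theorem IsCuntzKriegerFamily.comp {𝒢 : QuantumGraph Q} {θ : B →ₗ[ℂ] B} (hθ : 𝒢.IsSymmetry θ)
    {D : Type} [NonUnitalCStarAlgebra D] {s : B →ₗ[ℂ] D} (hs : 𝒢.IsCuntzKriegerFamily s) :
    𝒢.IsCuntzKriegerFamily (s ∘ₗ θ) := by
  have h1 : (s ∘ₗ θ).starConj = s.starConj ∘ₗ θ := by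
    ext b
    simp [LinearMap.starConj, hθ.map_star]
  have h2 : ∀ (f g : B →ₗ[ℂ] D) (b : B), TensorProduct.map (f ∘ₗ θ) (g ∘ₗ θ) (Q.comul b) =
      TensorProduct.map f g (Q.comul (θ b)) := fun f g b => by
    rw [hθ.comul_map, TensorProduct.map_comp, LinearMap.comp_apply]
  constructor
  · have h3 : ∀ z : B ⊗[ℂ] B, TensorProduct.map (s ∘ₗ θ)
        (TensorProduct.map (s.starConj ∘ₗ θ) (s ∘ₗ θ))
          (TensorProduct.map LinearMap.id Q.comul z) =
        TensorProduct.map s (TensorProduct.map s.starConj s)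
          (TensorProduct.map LinearMap.id Q.comul (TensorProduct.map θ θ z)) := by
      intro z
      induction z with
      | zero => simp
      | tmul x y => simp [h2]
      | add x y hx hy => simp only [map_add, hx, hy]
    ext b
    have h4 := LinearMap.congr_fun hs.isometry (θ b)
    simp only [LinearMap.comp_apply] at h4 ⊢
    rw [h1, h3, ← hθ.comul_map, h4]
  · ext b
    have h4 := LinearMap.congr_fun hs.adjacency (θ b)
    simp only [LinearMap.comp_apply] at h4 ⊢
    rw [h1, h2, h2, h4, hθ.adj_map]

/-- The action on the quantum Cuntz-Krieger algebra induced by an action of a group by symmetries,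
that is, `S(b) ↦ S(θ_g(b))`. -/
def action (𝒢 : QuantumGraph Q) [𝒢.relation.IsBounded] {G : Type} [Group G]
    (θ : G → B →ₗ[ℂ] B) (hθ : ∀ g, 𝒢.IsSymmetry (θ g)) (θ_one : ∀ b, θ 1 b = b)
    (θ_mul : ∀ g h b, θ (g * h) b = θ g (θ h b)) : G →* (𝒢.FO →⋆ₙₐ[ℂ] 𝒢.FO) :=
  UniversalCStarAlgebra.action (fun g => θ g) (by
    rintro g D _ s ⟨S, hs, hS⟩
    exact ⟨S ∘ₗ θ g, fun b => hs (θ g b), hS.comp (hθ g)⟩) θ_one θ_mul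

end QuantumGraph

/-! ## The quantum graphs on a full matrix algebra -/

section MatrixGraphs

variable (N : ℕ) [NeZero N]

/-- The matrix algebra `M_N(ℂ)`, with rows and columns indexed by `ℤ/N`. -/
abbrev MatN : Type := CStarMatrix (ZMod N) (ZMod N) ℂ

instance : FiniteDimensional ℂ (MatN N) :=
  inferInstanceAs (FiniteDimensional ℂ (Matrix (ZMod N) (ZMod N) ℂ))

/-- The matrix units of `M_N(ℂ)`. -/
def matUnit (i j : ZMod N) : MatN N := CStarMatrix.ofMatrix (Matrix.single i j 1)

variable {N} in
theorem matUnit_apply (i j k l : ZMod N) :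
    matUnit N i j k l = if i = k ∧ j = l then 1 else 0 := by
  simp [matUnit, Matrix.single_apply]

variable {N} in
theorem sum_matUnit (b : MatN N) : ∑ i, ∑ j, b i j • matUnit N i j = b := by
  refine Eq.trans ?_ (Matrix.matrix_eq_sum_single (CStarMatrix.ofMatrix.symm b)).symm
  refine Finset.sum_congr rfl fun i _ => Finset.sum_congr rfl fun j _ => ?_
  ext k l
  rw [CStarMatrix.smul_apply, matUnit_apply]
  change _ = Matrix.single i j (b i j) k l
  simp [Matrix.single_apply]

/-- The normalized trace on `M_N(ℂ)`. -/
def normTrace : MatN N →ₗ[ℂ] ℂ where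
  toFun b := (N : ℂ)⁻¹ * ∑ i, b i i
  map_add' a b := by simp [Finset.sum_add_distrib, mul_add]
  map_smul' c a := by simp [← Finset.mul_sum, mul_left_comm]

/-- The adjoint of the multiplication map of `M_N(ℂ)` for the normalized trace:
`m^*(e_ij) = N ∑ k, e_ik ⊗ e_kj`. -/
def matComul : MatN N →ₗ[ℂ] MatN N ⊗[ℂ] MatN N where
  toFun b := (N : ℂ) • ∑ i, ∑ j, b i j • ∑ k, matUnit N i k ⊗ₜ[ℂ] matUnit N k j
  map_add' a b := by simp [Finset.sum_add_distrib, add_smul]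
  map_smul' c a := by
    simp only [CStarMatrix.smul_apply, smul_eq_mul, mul_smul, ← Finset.smul_sum, RingHom.id_apply]
    rw [smul_comm]

variable {N} in
theorem matComul_matUnit (i j : ZMod N) :
    matComul N (matUnit N i j) = (N : ℂ) • ∑ k, matUnit N i k ⊗ₜ[ℂ] matUnit N k j := by
  simp only [matComul, LinearMap.coe_mk, AddHom.coe_mk]
  congr 1
  rw [Finset.sum_eq_single i, Finset.sum_eq_single j]
  · simp [matUnit_apply]
  · intro b _ hb; simp [matUnit_apply, hb.symm]
  · simp
  · intro b _ hb; simp [matUnit_apply, hb.symm]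
  · simp

variable {N} in
theorem matN_hom_ext {M : Type*} [AddCommMonoid M] [Module ℂ M] {f g : MatN N →ₗ[ℂ] M}
    (h : ∀ i j, f (matUnit N i j) = g (matUnit N i j)) : f = g := by
  ext b
  rw [← sum_matUnit b]
  simp only [map_sum, map_smul, h]

variable {N} in
theorem normTrace_star_mul_self (b : MatN N) :
    normTrace N (star b * b) = ((N : ℝ)⁻¹ * ∑ i, ∑ j, ‖b j i‖ ^ 2 : ℝ) := by
  simp only [normTrace, LinearMap.coe_mk, AddHom.coe_mk, CStarMatrix.mul_apply,
    CStarMatrix.star_apply, Complex.star_def, Complex.conj_mul']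
  push_cast
  rfl

variable {N} in
theorem matUnit_mul (i j k l : ZMod N) :
    matUnit N i j * matUnit N k l = if j = k then matUnit N i l else 0 := by
  split_ifs with h
  · subst h
    exact (Matrix.single_mul_single_same (1 : ℂ) i j l 1).trans (by rw [one_mul]; rfl)
  · exact Matrix.single_mul_single_of_ne (1 : ℂ) i j k h 1

variable {N} in
theorem star_matUnit (i j : ZMod N) : star (matUnit N i j) = matUnit N j i := by
  ext k l
  rw [CStarMatrix.star_apply, matUnit_apply, matUnit_apply]
  simp [and_comm, apply_ite]

/-- The finite quantum space `(M_N(ℂ), tr)`, where `tr` is the normalized trace, which is a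
`δ`-form with `δ = N`. -/
def matSpace : FiniteQuantumSpace (MatN N) where
  state := normTrace N
  state_nonneg b := by
    rw [normTrace_star_mul_self]
    exact_mod_cast mul_nonneg (by positivity) (by positivity)
  state_faithful b hb := by
    rw [normTrace_star_mul_self] at hb
    have h1 : (N : ℝ)⁻¹ ≠ 0 := inv_ne_zero (by exact_mod_cast NeZero.ne N)
    have h2 : ∑ i, ∑ j, ‖b j i‖ ^ 2 = 0 := by
      have h3 : (N : ℝ)⁻¹ * ∑ i, ∑ j, ‖b j i‖ ^ 2 = 0 := by exact_mod_cast hb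
      exact (mul_eq_zero.1 h3).resolve_left h1
    ext j i
    rw [Finset.sum_eq_zero_iff_of_nonneg (fun _ _ => by positivity)] at h2
    have h3 := h2 i (Finset.mem_univ _)
    rw [Finset.sum_eq_zero_iff_of_nonneg (fun _ _ => by positivity)] at h3
    simpa using h3 j (Finset.mem_univ _)
  state_one := by
    have : (N : ℂ) ≠ 0 := by exact_mod_cast NeZero.ne N
    simp [normTrace, ZMod.card, this]
  comul := matComul N
  comul_adjoint x y b := by
    suffices h : LinearMap.mul' ℂ ℂ ∘ₗ TensorProduct.map (normTrace N ∘ₗ LinearMap.mulLeft ℂ (star x))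
        (normTrace N ∘ₗ LinearMap.mulLeft ℂ (star y)) ∘ₗ matComul N =
        normTrace N ∘ₗ LinearMap.mulLeft ℂ (star (x * y)) from LinearMap.congr_fun h b
    refine matN_hom_ext fun i j => ?_
    have hN : (N : ℂ) ≠ 0 := by exact_mod_cast NeZero.ne N
    have h1 : ∀ (z : MatN N) (i j : ZMod N),
        normTrace N (star z * matUnit N i j) = (N : ℂ)⁻¹ * star (z i j) := by
      intro z i j
      simp only [normTrace, LinearMap.coe_mk, AddHom.coe_mk, CStarMatrix.mul_apply,
        CStarMatrix.star_apply, matUnit_apply]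
      congr 1
      rw [Finset.sum_eq_single j, Finset.sum_eq_single i]
      · simp
      · intro b _ hb; simp [hb.symm]
      · simp
      · intro b _ hb; simp [hb.symm]
      · simp
    simp only [LinearMap.comp_apply, matComul_matUnit, map_smul, map_sum, TensorProduct.map_tmul,
      LinearMap.mulLeft_apply, LinearMap.mul'_apply, h1, CStarMatrix.mul_apply]
    simp only [star_sum, star_mul, Finset.mul_sum, smul_eq_mul]
    refine Finset.sum_congr rfl fun k _ => ?_
    field_simp
  δ := N
  δ_pos := by exact_mod_cast Nat.pos_of_ne_zero (NeZero.ne N)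
  mul_comul b := by
    suffices h : LinearMap.mul' ℂ (MatN N) ∘ₗ matComul N = ((N : ℝ) : ℂ) ^ 2 • LinearMap.id from
      LinearMap.congr_fun h b
    refine matN_hom_ext fun i j => ?_
    simp only [LinearMap.comp_apply, matComul_matUnit, map_smul, map_sum, LinearMap.mul'_apply,
      matUnit_mul]
    simp [ZMod.card, ← Nat.cast_smul_eq_nsmul ℂ, smul_smul, sq]

variable {N} in
theorem norm_le_one_of_partialIsometry {D : Type} [NonUnitalCStarAlgebra D] {v : D}
    (hv : v * star v * v = v) : ‖v‖ ≤ 1 := by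
  have h1 : ‖star v * v‖ * ‖star v * v‖ = ‖star v * v‖ := by
    rw [← CStarRing.norm_star_mul_self (x := star v * v)]
    congr 1
    rw [star_mul, star_star, mul_assoc, ← mul_assoc v, hv]
  rw [CStarRing.norm_star_mul_self] at h1
  by_contra! h
  have : 1 < ‖v‖ * ‖v‖ := by nlinarith
  nlinarith

/-- The quantum Cuntz-Krieger relation bounds the generators: the matrix with entries
`S(N e_ij)` is a partial isometry. -/
instance (𝒢 : QuantumGraph (matSpace N)) : 𝒢.relation.IsBounded where
  bound b := by
    refine ⟨∑ i, ∑ j, ‖b i j‖ * ‖(N : ℂ)⁻¹‖, fun D _ s ⟨S, hs, hS⟩ => ?_⟩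
    have hN : (N : ℂ) ≠ 0 := by exact_mod_cast NeZero.ne N
    let _ := CStarAlgebra.spectralOrder D
    have _ := CStarAlgebra.spectralOrderedRing D
    let V : CStarMatrix (ZMod N) (ZMod N) D :=
      CStarMatrix.ofMatrix fun i j => S ((N : ℂ) • matUnit N i j)
    have hV : V * star V * V = V := by
      ext i j
      have h := LinearMap.congr_fun hS.isometry ((N : ℂ) • matUnit N i j)
      simp only [LinearMap.comp_apply, map_smul, matComul_matUnit, map_sum, matSpace,
        TensorProduct.map_tmul, LinearMap.id_apply, LinearMap.mul'_apply, TensorProduct.tmul_smul,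
        TensorProduct.tmul_sum] at h
      have h1 : ∀ i j, V i j = (N : ℂ) • S (matUnit N i j) := fun i j => map_smul S _ _
      have h2 : ∀ i j, star (V j i) = (N : ℂ) • S.starConj (matUnit N i j) := fun i j => by
        rw [h1, star_smul, ← star_matUnit i j, Complex.star_def, Complex.conj_natCast]
        rfl
      rw [h1, ← h, CStarMatrix.mul_apply]
      simp only [CStarMatrix.mul_apply, CStarMatrix.star_apply, h2]
      simp only [h1, Finset.sum_mul, Finset.smul_sum, smul_mul_assoc, mul_smul_comm, mul_assoc]
      rw [Finset.sum_comm]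
    have hV1 : ∀ i j, ‖S ((N : ℂ) • matUnit N i j)‖ ≤ 1 := fun i j =>
      (CStarMatrix.norm_entry_le_norm (M := V) (i := i) (j := j)).trans
        (norm_le_one_of_partialIsometry hV)
    rw [hs]
    conv_lhs => rw [← sum_matUnit b]
    simp only [map_sum]
    refine (norm_sum_le _ _).trans (Finset.sum_le_sum fun i _ => (norm_sum_le _ _).trans
      (Finset.sum_le_sum fun j _ => ?_))
    rw [map_smul, norm_smul]
    refine mul_le_mul_of_nonneg_left ?_ (norm_nonneg _)
    have h := hV1 i j
    rw [map_smul, norm_smul] at h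
    rw [norm_inv]
    exact (le_inv_mul_iff₀ (norm_pos_iff.2 hN)).2 (by simpa using h) |>.trans_eq (by simp)

/-- The `ℤ/N`-action `e_kl ↦ ω ^ (g (k - l)) e_kl` on `M_N(ℂ)`, where `ω = exp (2 π i / N)`. This is
conjugation by the `g`-th power of the generalized Pauli matrix `X`, `X |j⟩ = ω ^ j |j⟩`. -/
def phase (g : Multiplicative (ZMod N)) : MatN N →ₗ[ℂ] MatN N where
  toFun b := CStarMatrix.ofMatrix fun k l => ZMod.stdAddChar (g.toAdd * (k - l)) * b k l
  map_add' a b := by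
    ext k l
    exact mul_add _ (a k l) (b k l)
  map_smul' c a := by
    ext k l
    exact mul_left_comm _ c (a k l)

/-- The `ℤ/N`-action `e_kl ↦ e_{k - g, l - g}` on `M_N(ℂ)`. This is conjugation by the `g`-th power
of the adjoint of the generalized Pauli matrix `Z`, `Z |j⟩ = |j + 1⟩`. -/
def shift (g : Multiplicative (ZMod N)) : MatN N →ₗ[ℂ] MatN N where
  toFun b := CStarMatrix.ofMatrix fun k l => b (k + g.toAdd) (l + g.toAdd)
  map_add' _ _ := rfl
  map_smul' _ _ := rfl

variable {N} in
theorem phase_apply (g : Multiplicative (ZMod N)) (b : MatN N) (k l : ZMod N) :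
    phase N g b k l = ZMod.stdAddChar (g.toAdd * (k - l)) * b k l := rfl

variable {N} in
theorem shift_apply (g : Multiplicative (ZMod N)) (b : MatN N) (k l : ZMod N) :
    shift N g b k l = b (k + g.toAdd) (l + g.toAdd) := rfl

variable {N} in
theorem phase_matUnit (g : Multiplicative (ZMod N)) (i j : ZMod N) :
    phase N g (matUnit N i j) = (ZMod.stdAddChar (g.toAdd * (i - j)) : ℂ) • matUnit N i j := by
  ext k l
  rw [phase_apply, CStarMatrix.smul_apply, matUnit_apply]
  split_ifs with h
  · rw [h.1, h.2]; rfl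
  · simp

variable {N} in
theorem shift_matUnit (g : Multiplicative (ZMod N)) (i j : ZMod N) :
    shift N g (matUnit N i j) = matUnit N (i - g.toAdd) (j - g.toAdd) := by
  ext k l
  rw [shift_apply, matUnit_apply, matUnit_apply]
  simp only [sub_eq_iff_eq_add]

variable {N} in
theorem phase_star (g : Multiplicative (ZMod N)) (b : MatN N) :
    phase N g (star b) = star (phase N g b) := by
  ext k l
  rw [phase_apply, CStarMatrix.star_apply, CStarMatrix.star_apply, phase_apply, star_mul',
    Complex.star_def, ← AddChar.map_neg_eq_conj, ← mul_neg, neg_sub]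

variable {N} in
theorem shift_star (g : Multiplicative (ZMod N)) (b : MatN N) :
    shift N g (star b) = star (shift N g b) := by
  ext k l
  rfl

variable {N} in
theorem phase_comul (g : Multiplicative (ZMod N)) (b : MatN N) :
    matComul N (phase N g b) = TensorProduct.map (phase N g) (phase N g) (matComul N b) := by
  suffices h : matComul N ∘ₗ phase N g =
      TensorProduct.map (phase N g) (phase N g) ∘ₗ matComul N from LinearMap.congr_fun h b
  refine matN_hom_ext fun i j => ?_
  simp only [LinearMap.comp_apply, phase_matUnit, map_smul, map_sum, matComul_matUnit,
    TensorProduct.map_tmul, TensorProduct.smul_tmul_smul, ← AddChar.map_add_eq_mul, ← mul_add,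
    sub_add_sub_cancel]
  rw [← Finset.smul_sum, smul_comm]

variable {N} in
theorem shift_comul (g : Multiplicative (ZMod N)) (b : MatN N) :
    matComul N (shift N g b) = TensorProduct.map (shift N g) (shift N g) (matComul N b) := by
  suffices h : matComul N ∘ₗ shift N g =
      TensorProduct.map (shift N g) (shift N g) ∘ₗ matComul N from LinearMap.congr_fun h b
  refine matN_hom_ext fun i j => ?_
  simp only [LinearMap.comp_apply, shift_matUnit, map_smul, map_sum, matComul_matUnit,
    TensorProduct.map_tmul]
  congr 1
  exact (Equiv.sum_comp (Equiv.subRight g.toAdd)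
    (fun k => matUnit N (i - g.toAdd) k ⊗ₜ[ℂ] matUnit N k (j - g.toAdd))).symm

variable {N} in
theorem phase_complete (g : Multiplicative (ZMod N)) :
    (QuantumGraph.complete (matSpace N)).IsSymmetry (phase N g) where
  map_star := phase_star g
  comul_map := phase_comul g
  adj_map b := by
    have h1 : phase N g 1 = 1 := by
      ext k l
      rw [phase_apply, CStarMatrix.one_apply]
      split_ifs with h <;> simp [h]
    have h2 : normTrace N (phase N g b) = normTrace N b := by
      simp [normTrace, phase_apply]
    simp [QuantumGraph.complete, matSpace, h1, h2]

variable {N} in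
theorem shift_complete (g : Multiplicative (ZMod N)) :
    (QuantumGraph.complete (matSpace N)).IsSymmetry (shift N g) where
  map_star := shift_star g
  comul_map := shift_comul g
  adj_map b := by
    have h1 : shift N g 1 = 1 := by
      ext k l
      rw [shift_apply, CStarMatrix.one_apply, CStarMatrix.one_apply]
      simp
    have h2 : normTrace N (shift N g b) = normTrace N b := by
      simp only [normTrace, LinearMap.coe_mk, AddHom.coe_mk, shift_apply]
      congr 1
      exact Equiv.sum_comp (Equiv.addRight g.toAdd) fun i => b i i
    simp [QuantumGraph.complete, matSpace, h1, h2]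

variable {N} in
theorem phase_trivial (g : Multiplicative (ZMod N)) :
    (QuantumGraph.trivial (matSpace N)).IsSymmetry (phase N g) :=
  ⟨phase_star g, phase_comul g, fun _ => rfl⟩

variable {N} in
theorem shift_trivial (g : Multiplicative (ZMod N)) :
    (QuantumGraph.trivial (matSpace N)).IsSymmetry (shift N g) :=
  ⟨shift_star g, shift_comul g, fun _ => rfl⟩

variable {N} in
theorem phase_one (b : MatN N) : phase N 1 b = b := by
  ext k l
  simp [phase_apply]

variable {N} in
theorem shift_one (b : MatN N) : shift N 1 b = b := by
  ext k l
  simp [shift_apply]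

variable {N} in
theorem phase_mul (g h : Multiplicative (ZMod N)) (b : MatN N) :
    phase N (g * h) b = phase N g (phase N h b) := by
  ext k l
  simp only [phase_apply, toAdd_mul, add_mul, AddChar.map_add_eq_mul, mul_assoc]

variable {N} in
theorem shift_mul (g h : Multiplicative (ZMod N)) (b : MatN N) :
    shift N (g * h) b = shift N g (shift N h b) := by
  ext k l
  simp only [shift_apply, toAdd_mul, add_assoc]

variable {N} in
theorem phase_shift (g h : Multiplicative (ZMod N)) (b : MatN N) :
    phase N g (shift N h b) = shift N h (phase N g b) := by
  ext k l
  simp only [phase_apply, shift_apply, add_sub_add_right_eq_sub]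

/-- `FO(K(M_N(ℂ), tr))` -/
abbrev FOComplete : Type := (QuantumGraph.complete (matSpace N)).FO

/-- `FO(TM_N)` -/
abbrev FOTrivial : Type := (QuantumGraph.trivial (matSpace N)).FO

/-- The action of `ℤ/N` on `FO(K(M_N(ℂ), tr))` generated by `α₁(S_kl) = ω ^ (k - l) S_kl`. -/
def alphaOneComplete : Multiplicative (ZMod N) →* (FOComplete N →⋆ₙₐ[ℂ] FOComplete N) :=
  (QuantumGraph.complete (matSpace N)).action (phase N) phase_complete phase_one phase_mul

/-- The action of `ℤ/N` on `FO(K(M_N(ℂ), tr))` generated by `α₂(S_kl) = S_{k-1, l-1}`. -/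
def alphaTwoComplete : Multiplicative (ZMod N) →* (FOComplete N →⋆ₙₐ[ℂ] FOComplete N) :=
  (QuantumGraph.complete (matSpace N)).action (shift N) shift_complete shift_one shift_mul

theorem alphaComplete_comm (g h : Multiplicative (ZMod N)) (a : FOComplete N) :
    alphaOneComplete N g (alphaTwoComplete N h a) = alphaTwoComplete N h (alphaOneComplete N g a) :=
  UniversalCStarAlgebra.commute_of_gen (fun x => by
    simp only [alphaOneComplete, alphaTwoComplete, QuantumGraph.action,
      UniversalCStarAlgebra.action_gen, phase_shift]) a

/-- The action of `ℤ/N` on `FO(TM_N)` generated by `α₁(S_kl) = ω ^ (k - l) S_kl`. -/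
def alphaOneTrivial : Multiplicative (ZMod N) →* (FOTrivial N →⋆ₙₐ[ℂ] FOTrivial N) :=
  (QuantumGraph.trivial (matSpace N)).action (phase N) phase_trivial phase_one phase_mul

/-- The action of `ℤ/N` on `FO(TM_N)` generated by `α₂(S_kl) = S_{k-1, l-1}`. -/
def alphaTwoTrivial : Multiplicative (ZMod N) →* (FOTrivial N →⋆ₙₐ[ℂ] FOTrivial N) :=
  (QuantumGraph.trivial (matSpace N)).action (shift N) shift_trivial shift_one shift_mul

theorem alphaTrivial_comm (g h : Multiplicative (ZMod N)) (a : FOTrivial N) :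
    alphaOneTrivial N g (alphaTwoTrivial N h a) = alphaTwoTrivial N h (alphaOneTrivial N g a) :=
  UniversalCStarAlgebra.commute_of_gen (fun x => by
    simp only [alphaOneTrivial, alphaTwoTrivial, QuantumGraph.action,
      UniversalCStarAlgebra.action_gen, phase_shift]) a

end MatrixGraphs

/-! ## The Cuntz algebra `O_{N²}` and the free product of `N²` copies of `C(S¹)` -/

section Classical

variable (N : ℕ) [NeZero N]

/-- The Cuntz algebra `O_{N²}`, with generators `S_kl` indexed by `k, l ∈ ℤ/N`. -/
abbrev CuntzSq : Type := CuntzAlgebra (ZMod N × ZMod N)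

/-- The non-unital free product of `N²` copies of `C(S¹)`, indexed by `k, l ∈ ℤ/N`. -/
abbrev FreeCircleSq : Type := FreeProduct fun _ : ZMod N × ZMod N => C(Circle, ℂ)

/-- The action of a group on the Cuntz algebra by permutations of the generators. -/
def cuntzAction {ι G : Type} [Fintype ι] [Group G] (σ : G →* Equiv.Perm ι) :
    G →* (CuntzAlgebra ι →⋆ₙₐ[ℂ] CuntzAlgebra ι) :=
  UniversalCStarAlgebra.action (fun g => σ g) (by
    rintro g D _ s ⟨e, h, hsum⟩
    exact ⟨e, fun i => h (σ g i), (Equiv.sum_comp (σ g) fun i => s i * star (s i)).trans hsum⟩)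
    (fun x => by simp) (fun g h x => by simp)

/-- The action of a group on a free product of copies of one C*-algebra by permutations of the
copies. -/
def freeProductAction {ι G A : Type} [Group G] [NonUnitalCStarAlgebra A]
    (σ : G →* Equiv.Perm ι) :
    G →* (FreeProduct (fun _ : ι => A) →⋆ₙₐ[ℂ] FreeProduct (fun _ : ι => A)) :=
  UniversalCStarAlgebra.action (fun g x => ⟨σ g x.1, x.2⟩) (by
    rintro g D _ s ⟨φ, h⟩
    exact ⟨fun i => φ (σ g i), fun i a => h (σ g i) a⟩)
    (fun x => by simp) (fun g h x => by simp)

/-- The permutations `(k, l) ↦ (k - g, l)`. -/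
def permOne : Multiplicative (ZMod N) →* Equiv.Perm (ZMod N × ZMod N) where
  toFun g := (Equiv.subRight g.toAdd).prodCongr (Equiv.refl _)
  map_one' := by ext x <;> simp
  map_mul' g h := by ext x <;> simp [sub_sub, add_comm]

/-- The permutations `(k, l) ↦ (k, l - g)`. -/
def permTwo : Multiplicative (ZMod N) →* Equiv.Perm (ZMod N × ZMod N) where
  toFun g := (Equiv.refl _).prodCongr (Equiv.subRight g.toAdd)
  map_one' := by ext x <;> simp
  map_mul' g h := by ext x <;> simp [sub_sub, add_comm]

theorem permOne_permTwo (g h : Multiplicative (ZMod N)) (x : ZMod N × ZMod N) :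
    permOne N g (permTwo N h x) = permTwo N h (permOne N g x) := rfl

/-- The action of `ℤ/N` on `O_{N²}` generated by `β₁(S_kl) = S_{k-1, l}`. -/
def betaOneCuntz : Multiplicative (ZMod N) →* (CuntzSq N →⋆ₙₐ[ℂ] CuntzSq N) :=
  cuntzAction (permOne N)

/-- The action of `ℤ/N` on `O_{N²}` generated by `β₂(S_kl) = S_{k, l-1}`. -/
def betaTwoCuntz : Multiplicative (ZMod N) →* (CuntzSq N →⋆ₙₐ[ℂ] CuntzSq N) :=
  cuntzAction (permTwo N)

theorem betaCuntz_comm (g h : Multiplicative (ZMod N)) (a : CuntzSq N) :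
    betaOneCuntz N g (betaTwoCuntz N h a) = betaTwoCuntz N h (betaOneCuntz N g a) :=
  UniversalCStarAlgebra.commute_of_gen (fun x => by
    simp only [betaOneCuntz, betaTwoCuntz, cuntzAction, UniversalCStarAlgebra.action_gen,
      permOne_permTwo]) a

/-- The action of `ℤ/N` on the free product of `N²` copies of `C(S¹)` generated by
`β₁(S_kl) = S_{k-1, l}`, where `S_kl` is the canonical unitary of the copy with index `(k, l)`. -/
def betaOneFree : Multiplicative (ZMod N) →* (FreeCircleSq N →⋆ₙₐ[ℂ] FreeCircleSq N) :=
  freeProductAction (permOne N)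

/-- The action of `ℤ/N` on the free product of `N²` copies of `C(S¹)` generated by
`β₂(S_kl) = S_{k, l-1}`. -/
def betaTwoFree : Multiplicative (ZMod N) →* (FreeCircleSq N →⋆ₙₐ[ℂ] FreeCircleSq N) :=
  freeProductAction (permTwo N)

theorem betaFree_comm (g h : Multiplicative (ZMod N)) (a : FreeCircleSq N) :
    betaOneFree N g (betaTwoFree N h a) = betaTwoFree N h (betaOneFree N g a) :=
  UniversalCStarAlgebra.commute_of_gen (fun x => by
    simp only [betaOneFree, betaTwoFree, freeProductAction, UniversalCStarAlgebra.action_gen,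
      permOne_permTwo]) a

end Classical

end

noncomputable section

/-! ## Universal C*-algebras -/

/-! Let `A` be the Cuntz algebra or the free product of circles, with generators `T a b`, and let
`B` be the corresponding quantum Cuntz-Krieger algebra, with `V = (S_kl)` in `M_N(B)`. Since `m^*(N
e_ij) = ∑ k, N e_ik ⊗ N e_kj`, the quantum Cuntz-Krieger relations are relations for the single
matrix `V`: always `V V^* V = V`, and moreover `V^* V = V V^*` for the trivial graph, `V^* V = 1 ⊗
e` with `e = N ∑ S_kl S_kl^*` for the complete one (`isCuntzKriegerFamily_trivial_iff`,
`isCuntzKriegerFamily_complete_iff`).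

The Pauli matrices give homomorphisms in both directions. `ρ : A → M_N(B)` sends `T a b` to a Pauli
conjugate of `V`; it respects the relations because conjugation does, and because summing all Pauli
conjugates of a matrix gives `N` times its trace on the diagonal (`sum_pauliConj`). `ρ' : B →
M_N(A)` sends `V` to `∑ P_ab ⊗ T a b`, where the `P_ab` are the projections onto the Bell basis of
`ℂ^N ⊗ ℂ^N`; it respects the relations because the `P_ab` are orthogonal projections with sum `1`
and partial trace `1/N` (`bellMatrix_mul`, `bellMatrix_const`, `sum_bellMatrix_diag`).

Conjugation by `X` and `Z^*` implements the two actions under `ρ`, so `a u_g v_h ↦ ρ(a) X^g (Z^*)^h`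
is a representation `Φ` of the iterated crossed product on `M_N(B)` (`pauliLift`). It is bijective
by `nonempty_matrix_equiv_doubleCrossedProduct`. For injectivity, the vector `Ω = ∑ i, e_i ⊗ e_i` is
an eigenvector of `(id ⊗ ρ')(ρ(a))` with eigenvalue `a`, that is, `∑ i, ρ'(ρ(a)_ij)_iq = δ_jq a`
(`sum_entry_of_generates`); together with Fourier inversion this recovers every coefficient and
gives a bounded linear left inverse, so the range is also closed. For surjectivity, the range is
stable under Pauli multiplication from both sides, and the Pauli matrices span `M_N(ℂ)`; hence it
contains all `e_ij ⊗ ρ(a)_kl`, and the entries `ρ(a)_kl` generate `B` (`singleMatrix_mem_span`).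

The same argument with `ρ` and `ρ'` exchanged yields the two isomorphisms for the crossed products
of `B`. -/

theorem NonUnitalStarAlgHom.continuous_of_cstar {A B : Type} [NonUnitalCStarAlgebra A]
    [NonUnitalCStarAlgebra B] (φ : A →⋆ₙₐ[ℂ] B) : Continuous φ :=
  AddMonoidHomClass.continuous_of_bound φ 1 fun a => by
    rw [one_mul]; exact NonUnitalStarAlgHom.norm_apply_le φ a

/-- A `*`-homomorphism of C*-algebras as a continuous linear map. -/
def NonUnitalStarAlgHom.toCLM {A B : Type} [NonUnitalCStarAlgebra A]
    [NonUnitalCStarAlgebra B] (φ : A →⋆ₙₐ[ℂ] B) : A →L[ℂ] B where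
  toFun := φ
  map_add' := map_add φ
  map_smul' := map_smul φ
  cont := φ.continuous_of_cstar

theorem NonUnitalStarAlgHom.toCLM_apply {A B : Type} [NonUnitalCStarAlgebra A]
    [NonUnitalCStarAlgebra B] (φ : A →⋆ₙₐ[ℂ] B) (a : A) : φ.toCLM a = φ a := rfl

namespace UniversalCStarAlgebra

open CStarRelation

variable {X : Type} {R : CStarRelation X} [R.IsBounded]

/-- Identities between `*`-polynomials which hold in all families satisfying the relation hold in
the universal family. -/
theorem eval_gen_eq {p q : StarPoly X} (h : ∀ (D : Type) [NonUnitalCStarAlgebra D] (s : X → D),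
    R.Holds s → p.eval s = q.eval s) : p.eval (gen R) = q.eval (gen R) := by
  rw [← ofPre_mk, ← ofPre_mk, Pre.mk_eq h]

theorem norm_gen_le {x : X} {C : ℝ} (hC : 0 ≤ C)
    (h : ∀ (D : Type) [NonUnitalCStarAlgebra D] (s : X → D), R.Holds s → ‖s x‖ ≤ C) :
    ‖gen R x‖ ≤ C := by
  rw [gen, norm_ofPre]
  exact Pre.norm_mk_le hC h

/-- A closed property stable under the `*`-algebra operations holds everywhere if it holds for
the generators. -/
theorem induction_gen {P : UniversalCStarAlgebra R → Prop} (hP : IsClosed {a | P a})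
    (h_gen : ∀ x, P (gen R x)) (h_add : ∀ a b, P a → P b → P (a + b))
    (h_smul : ∀ (c : ℂ) a, P a → P (c • a)) (h_mul : ∀ a b, P a → P b → P (a * b))
    (h_star : ∀ a, P a → P (star a)) (h_zero : P 0) (a : UniversalCStarAlgebra R) : P a := by
  refine induction_on (P := P) a hP (Pre.ind fun p => ?_)
  rw [ofPre_mk]
  induction p with
  | gen x => exact h_gen x
  | zero => exact h_zero
  | add p q hp hq => exact h_add _ _ hp hq
  | neg p hp =>
    have h := h_smul (-1) _ hp
    rwa [neg_one_smul] at h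
  | smul c p hp => exact h_smul c _ hp
  | mul p q hp hq => exact h_mul _ _ hp hq
  | adj p hp => exact h_star _ hp

end UniversalCStarAlgebra

/-! ## Crossed products -/

/-- A group homomorphism from `G` to the unitary multipliers of `E`, given by the left and right
multiplications. -/
structure UnitaryMultipliers (G E : Type) [Group G] [NonUnitalCStarAlgebra E] where
  L : G → E →ₗ[ℂ] E
  R : G → E →ₗ[ℂ] E
  L_mul : ∀ g x y, L g (x * y) = L g x * y
  R_mul : ∀ g x y, R g (x * y) = x * R g y
  R_mul_eq : ∀ g x y, R g x * y = x * L g y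
  L_R : ∀ g h x, L g (R h x) = R h (L g x)
  R_R : ∀ g h x, R h (R g x) = R (g * h) x
  R_one : ∀ x, R 1 x = x
  star_R : ∀ g x, star (R g x) = L g⁻¹ (star x)

namespace UnitaryMultipliers

variable {G E : Type} [Group G] [NonUnitalCStarAlgebra E] (u : UnitaryMultipliers G E)

theorem star_L (g : G) (x : E) : star (u.L g x) = u.R g⁻¹ (star x) := by
  have h := u.star_R g⁻¹ (star x)
  rw [star_star, inv_inv] at h
  rw [← h, star_star]

/-- Conjugation by a unitary multiplier. -/
def ad (g : G) : E →⋆ₙₐ[ℂ] E where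
  toFun x := u.R g⁻¹ (u.L g x)
  map_smul' c x := by simp
  map_zero' := by simp
  map_add' x y := by simp
  map_mul' x y := by
    rw [u.L_mul, u.R_mul, u.R_mul_eq, u.L_R]
    -- Only right multiplications are assumed to compose; the left-handed cancellation follows by
    -- taking adjoints.
    have h : ∀ z, u.L g⁻¹ (u.L g z) = z := fun z => by
      refine star_injective ?_
      rw [u.star_L, u.star_L, u.R_R, inv_inv, inv_mul_cancel, u.R_one]
    rw [h]
  map_star' x := by
    rw [u.star_R, u.star_L, inv_inv, u.L_R]

theorem ad_apply (g : G) (x : E) : u.ad g x = u.R g⁻¹ (u.L g x) := rfl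

/-- This is `(u_g x u_g⁻¹) u_g = u_g x`. For a covariant representation it trades left
multiplication by `u_g` for right multiplication. -/
theorem R_ad (g : G) (x : E) : u.R g (u.ad g x) = u.L g x := by
  rw [ad_apply, u.R_R, inv_mul_cancel, u.R_one]

end UnitaryMultipliers

namespace CrossedProduct

open UniversalCStarAlgebra

variable {G A : Type} [Group G] [NonUnitalCStarAlgebra A] (α : G →* (A →⋆ₙₐ[ℂ] A))

/-- The map `a ↦ a u_g`. -/
def incl (g : G) : A →L[ℂ] CrossedProduct α :=
  LinearMap.mkContinuous
    { toFun := fun a => gen (crossedProductRelation α) (g, a)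
      map_add' := fun a b => eval_gen_eq (p := .gen (g, a + b))
        (q := .add (.gen (g, a)) (.gen (g, b))) (by
          rintro D _ s ⟨φ, hs, -, -⟩
          simp [StarPoly.eval, hs])
      map_smul' := fun c a => eval_gen_eq (p := .gen (g, c • a)) (q := .smul c (.gen (g, a))) (by
          rintro D _ s ⟨φ, hs, -, -⟩
          simp [StarPoly.eval, hs]) } 1
    (fun a => norm_gen_le (by positivity) (by
      rintro D _ s ⟨φ, hs, hmul, hstar⟩
      -- The fibre over the unit is a `*`-representation, hence contractive; the C*-identity reduces
      -- the other fibres to it.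
      let π : A →⋆ₙₐ[ℂ] D :=
        { toFun := φ 1
          map_smul' := fun c a => map_smul _ _ _
          map_zero' := map_zero _
          map_add' := fun a b => map_add _ _ _
          map_mul' := fun a b => by rw [hmul, mul_one, map_one]; rfl
          map_star' := fun a => by rw [hstar, inv_one, map_one]; rfl }
      have h1 : φ g a * star (φ g a) = π (a * star a) := by
        rw [hstar, hmul, mul_inv_cancel, ← NonUnitalStarAlgHom.mul_apply_apply, ← map_mul,
          mul_inv_cancel, map_one]
        rfl
      have h2 : ‖φ g a‖ * ‖φ g a‖ ≤ ‖a‖ * ‖a‖ := by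
        rw [← CStarRing.norm_self_mul_star, ← CStarRing.norm_self_mul_star (x := a), h1]
        exact NonUnitalStarAlgHom.norm_apply_le π _
      rw [hs, one_mul]
      exact (mul_self_le_mul_self_iff (norm_nonneg _) (norm_nonneg _)).2 h2))

theorem gen_eq_incl (g : G) (a : A) : gen (crossedProductRelation α) (g, a) = incl α g a := rfl

theorem incl_mul_incl (g h : G) (a b : A) :
    incl α g a * incl α h b = incl α (g * h) (a * α g b) :=
  eval_gen_eq (p := .mul (.gen (g, a)) (.gen (h, b))) (q := .gen (g * h, a * α g b)) (by
    rintro D _ s ⟨φ, hs, hmul, -⟩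
    simp [StarPoly.eval, hs, hmul])

theorem star_incl (g : G) (a : A) : star (incl α g a) = incl α g⁻¹ (α g⁻¹ (star a)) :=
  eval_gen_eq (p := .adj (.gen (g, a))) (q := .gen (g⁻¹, α g⁻¹ (star a))) (by
    rintro D _ s ⟨φ, hs, -, hstar⟩
    simp [StarPoly.eval, hs, hstar])

/-- Products and adjoints of elements `a u_g` are again of this form, so their linear span contains
all `*`-polynomials in the generators, and these are dense. -/
theorem mem_closure_span (x : CrossedProduct α) :
    x ∈ closure (Submodule.span ℂ {y | ∃ g a, y = incl α g a} : Set (CrossedProduct α)) := by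
  set S := Submodule.span ℂ {y | ∃ g a, y = incl α g a}
  refine induction_on (P := fun x => x ∈ closure (S : Set (CrossedProduct α))) x isClosed_closure
    (CStarRelation.Pre.ind fun p => subset_closure ?_)
  rw [ofPre_mk]
  have hmem : ∀ g a, incl α g a ∈ S := fun g a => Submodule.subset_span ⟨g, a, rfl⟩
  induction p with
  | gen x => exact hmem x.1 x.2
  | zero => exact S.zero_mem
  | add p q hp hq => exact S.add_mem hp hq
  | neg p hp => exact S.neg_mem hp
  | smul c p hp => exact S.smul_mem c hp
  | mul p q hp hq =>
    rw [StarPoly.eval]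
    simp only [SetLike.mem_coe] at hp hq ⊢
    generalize StarPoly.eval (gen (crossedProductRelation α)) p = y at hp
    generalize StarPoly.eval (gen (crossedProductRelation α)) q = z at hq
    induction hp using Submodule.span_induction with
    | mem y hy =>
      obtain ⟨g, a, rfl⟩ := hy
      induction hq using Submodule.span_induction with
      | mem z hz =>
        obtain ⟨h, b, rfl⟩ := hz
        rw [incl_mul_incl]
        exact hmem _ _
      | zero => rw [mul_zero]; exact S.zero_mem
      | add x y _ _ hx hy => rw [mul_add]; exact S.add_mem hx hy
      | smul c x _ hx => rw [mul_smul_comm]; exact S.smul_mem c hx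
    | zero => rw [zero_mul]; exact S.zero_mem
    | add x y _ _ hx hy => rw [add_mul]; exact S.add_mem hx hy
    | smul c x _ hx => rw [smul_mul_assoc]; exact S.smul_mem c hx
  | adj p hp =>
    rw [StarPoly.eval]
    simp only [SetLike.mem_coe] at hp ⊢
    generalize StarPoly.eval (gen (crossedProductRelation α)) p = y at hp
    induction hp using Submodule.span_induction with
    | mem y hy =>
      obtain ⟨g, a, rfl⟩ := hy
      rw [star_incl]
      exact hmem _ _
    | zero => rw [star_zero]; exact S.zero_mem
    | add x y _ _ hx hy => rw [star_add]; exact S.add_mem hx hy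
    | smul c x _ hx => rw [star_smul]; exact S.smul_mem _ hx

/-- Continuous linear maps on a crossed product are determined by their values at the `a u_g`. -/
theorem clm_ext {F : Type} [AddCommGroup F] [Module ℂ F] [TopologicalSpace F] [T2Space F]
    {f f' : CrossedProduct α →L[ℂ] F} (h : ∀ g a, f (incl α g a) = f' (incl α g a)) : f = f' :=
  ContinuousLinearMap.ext_on (fun x => mem_closure_span α x)
    (by rintro _ ⟨g, a, rfl⟩; exact h g a)

variable {α} {E : Type} [NonUnitalCStarAlgebra E]

/-- The `*`-homomorphism `a u_g ↦ ρ(a) u_g` given by a covariant representation. -/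
def covLift (u : UnitaryMultipliers G E) (ρ : A →⋆ₙₐ[ℂ] E)
    (h : ∀ g a, u.ad g (ρ a) = ρ (α g a)) : CrossedProduct α →⋆ₙₐ[ℂ] E :=
  lift (fun x => u.R x.1 (ρ x.2)) ⟨fun g => u.R g ∘ₗ (ρ : A →ₗ[ℂ] E), fun g a => rfl,
    fun g k a b => by
      change u.R g (ρ a) * u.R k (ρ b) = u.R (g * k) (ρ (a * α g b))
      -- Covariance in the form `ρ(a) u_g ρ(b) u_k = ρ(a) (u_g ρ(b) u_g⁻¹) u_g u_k`.
      rw [u.R_mul_eq, u.L_R, map_mul, u.R_mul, ← u.R_R, ← h, u.R_ad],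
    fun g a => by
      change star (u.R g (ρ a)) = u.R g⁻¹ (ρ (α g⁻¹ (star a)))
      rw [u.star_R, ← h, u.R_ad, map_star ρ]⟩

theorem covLift_incl (u : UnitaryMultipliers G E) (ρ : A →⋆ₙₐ[ℂ] E)
    (h : ∀ g a, u.ad g (ρ a) = ρ (α g a)) (g : G) (a : A) :
    covLift u ρ h (incl α g a) = u.R g (ρ a) := lift_gen _ _ _

end CrossedProduct

end

noncomputable section

/-! ## Matrix algebras and the duality between twisted algebras -/

/-- The matrices over a C*-algebra form a C*-algebra. -/
instance (priority := low) CStarMatrix.nonUnitalCStarAlgebraOfSpectralOrder {n B : Type} [Fintype n]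
    [NonUnitalCStarAlgebra B] : NonUnitalCStarAlgebra (CStarMatrix n n B) :=
  @CStarMatrix.instNonUnitalCStarAlgebra B _ (CStarAlgebra.spectralOrder B)
    (CStarAlgebra.spectralOrderedRing B) n _

theorem CStarMatrix.norm_entry_le {n B : Type} [Fintype n] [NonUnitalCStarAlgebra B]
    (m : CStarMatrix n n B) (i j : n) : ‖m i j‖ ≤ ‖m‖ :=
  let _ := CStarAlgebra.spectralOrder B
  have _ := CStarAlgebra.spectralOrderedRing B
  CStarMatrix.norm_entry_le_norm (M := m) (i := i) (j := j)

/-- The entries of a matrix as continuous linear maps. -/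
def CStarMatrix.entryCLM {n B : Type} [Fintype n] [NonUnitalCStarAlgebra B] (i j : n) :
    CStarMatrix n n B →L[ℂ] B :=
  LinearMap.mkContinuous
    { toFun := fun m => m i j, map_add' := fun _ _ => rfl, map_smul' := fun _ _ => rfl } 1
    (fun m => by rw [one_mul]; exact CStarMatrix.norm_entry_le m i j)

theorem CStarMatrix.entryCLM_apply {n B : Type} [Fintype n] [NonUnitalCStarAlgebra B] (i j : n)
    (m : CStarMatrix n n B) : CStarMatrix.entryCLM i j m = m i j := rfl

theorem CStarMatrix.sum_apply {n B ι : Type} [AddCommMonoid B] (s : Finset ι)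
    (f : ι → CStarMatrix n n B) (i j : n) : (∑ x ∈ s, f x) i j = ∑ x ∈ s, f x i j :=
  map_sum ({ toFun := fun m => m i j, map_zero' := rfl, map_add' := fun _ _ => rfl } :
    CStarMatrix n n B →+ B) f s

theorem CStarMatrix.ofMatrix_apply_apply {n B : Type} (f : n → n → B) (i j : n) :
    CStarMatrix.ofMatrix f i j = f i j := rfl

variable {N : ℕ} [NeZero N] {A B : Type} [NonUnitalCStarAlgebra A] [NonUnitalCStarAlgebra B]

/-! ### Characters of `ℤ/N`, single-entry matrices, and the Pauli matrices as multipliers -/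

theorem sum_stdAddChar_mul (t : ZMod N) :
    ∑ i, (ZMod.stdAddChar (i * t) : ℂ) = if t = 0 then (N : ℂ) else 0 := by
  rw [AddChar.sum_mulShift t (ZMod.isPrimitive_stdAddChar N), ZMod.card]
  split_ifs <;> simp

theorem star_stdAddChar (t : ZMod N) :
    star (ZMod.stdAddChar t : ℂ) = ZMod.stdAddChar (-t) := by
  rw [AddChar.map_neg_eq_conj]; rfl

/-- The matrix with the single entry `b` at the position `(k, l)`. -/
def singleMatrix (k l : ZMod N) (b : B) : CStarMatrix (ZMod N) (ZMod N) B :=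
  CStarMatrix.ofMatrix fun i j => if i = k ∧ j = l then b else 0

theorem singleMatrix_apply (k l i j : ZMod N) (b : B) :
    singleMatrix k l b i j = if i = k ∧ j = l then b else 0 := rfl

theorem singleMatrix_mul (i k l : ZMod N) (a b : B) :
    singleMatrix i k a * singleMatrix k l b = singleMatrix i l (a * b) := by
  ext p q
  simp only [CStarMatrix.mul_apply, singleMatrix_apply]
  by_cases hp : p = i <;> by_cases hq : q = l <;> simp [hp, hq]

theorem star_singleMatrix (k l : ZMod N) (b : B) :
    star (singleMatrix k l b) = singleMatrix l k (star b) := by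
  ext p q
  simp only [CStarMatrix.star_apply, singleMatrix_apply, and_comm, apply_ite star, star_zero]

theorem sum_singleMatrix (m : CStarMatrix (ZMod N) (ZMod N) B) :
    ∑ k, ∑ l, singleMatrix k l (m k l) = m := by
  ext i j
  simp only [CStarMatrix.sum_apply]
  rw [Finset.sum_eq_single i, Finset.sum_eq_single j]
  · simp [singleMatrix_apply]
  · intro l _ hl; simp [singleMatrix_apply, hl.symm]
  · simp
  · intro k _ hk; simp [singleMatrix_apply, hk.symm]
  · simp

/-- Left multiplication by a diagonal matrix of phases. -/
def phaseL (g : ZMod N) :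
    CStarMatrix (ZMod N) (ZMod N) B →ₗ[ℂ] CStarMatrix (ZMod N) (ZMod N) B where
  toFun m := CStarMatrix.ofMatrix fun i j => (ZMod.stdAddChar (g * i) : ℂ) • m i j
  map_add' a b := by ext i j; exact smul_add _ (a i j) (b i j)
  map_smul' c a := by ext i j; exact smul_comm _ c (a i j)

/-- Right multiplication by a diagonal matrix of phases. -/
def phaseR (g : ZMod N) :
    CStarMatrix (ZMod N) (ZMod N) B →ₗ[ℂ] CStarMatrix (ZMod N) (ZMod N) B where
  toFun m := CStarMatrix.ofMatrix fun i j => (ZMod.stdAddChar (g * j) : ℂ) • m i j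
  map_add' a b := by ext i j; exact smul_add _ (a i j) (b i j)
  map_smul' c a := by ext i j; exact smul_comm _ c (a i j)

/-- Left multiplication by a power of the shift matrix. -/
def shiftL (g : ZMod N) :
    CStarMatrix (ZMod N) (ZMod N) B →ₗ[ℂ] CStarMatrix (ZMod N) (ZMod N) B where
  toFun m := CStarMatrix.ofMatrix fun i j => m (i + g) j
  map_add' _ _ := rfl
  map_smul' _ _ := rfl

/-- Right multiplication by a power of the shift matrix. -/
def shiftR (g : ZMod N) :
    CStarMatrix (ZMod N) (ZMod N) B →ₗ[ℂ] CStarMatrix (ZMod N) (ZMod N) B where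
  toFun m := CStarMatrix.ofMatrix fun i j => m i (j - g)
  map_add' _ _ := rfl
  map_smul' _ _ := rfl

theorem phaseL_apply (g : ZMod N) (m : CStarMatrix (ZMod N) (ZMod N) B) (i j : ZMod N) :
    phaseL g m i j = (ZMod.stdAddChar (g * i) : ℂ) • m i j := rfl

theorem phaseR_apply (g : ZMod N) (m : CStarMatrix (ZMod N) (ZMod N) B) (i j : ZMod N) :
    phaseR g m i j = (ZMod.stdAddChar (g * j) : ℂ) • m i j := rfl

theorem shiftL_apply (g : ZMod N) (m : CStarMatrix (ZMod N) (ZMod N) B) (i j : ZMod N) :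
    shiftL g m i j = m (i + g) j := rfl

theorem shiftR_apply (g : ZMod N) (m : CStarMatrix (ZMod N) (ZMod N) B) (i j : ZMod N) :
    shiftR g m i j = m i (j - g) := rfl

/-- The powers of the generalized Pauli matrix `X` as multipliers of a matrix algebra. -/
def phaseMultipliers (N : ℕ) [NeZero N] (B : Type) [NonUnitalCStarAlgebra B] :
    UnitaryMultipliers (Multiplicative (ZMod N)) (CStarMatrix (ZMod N) (ZMod N) B) where
  L g := phaseL g.toAdd
  R g := phaseR g.toAdd
  L_mul g x y := by
    ext i j
    simp only [CStarMatrix.mul_apply, phaseL_apply, Finset.smul_sum, smul_mul_assoc]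
  R_mul g x y := by
    ext i j
    simp only [CStarMatrix.mul_apply, phaseR_apply, Finset.smul_sum, mul_smul_comm]
  R_mul_eq g x y := by
    ext i j
    simp only [CStarMatrix.mul_apply, phaseR_apply, phaseL_apply, mul_smul_comm, smul_mul_assoc]
  L_R g h x := by
    ext i j
    exact smul_comm _ _ (x i j)
  R_R g h x := by
    ext i j
    simp only [phaseR_apply]
    rw [smul_smul, ← AddChar.map_add_eq_mul, toAdd_mul, add_mul, add_comm]
  R_one x := by
    ext i j
    simp [phaseR_apply]
  star_R g x := by
    ext i j
    simp only [CStarMatrix.star_apply, phaseR_apply, phaseL_apply]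
    rw [star_smul, star_stdAddChar, toAdd_inv, neg_mul]

/-- The powers of the adjoint of the generalized Pauli matrix `Z` as multipliers of a matrix
algebra. -/
def shiftMultipliers (N : ℕ) [NeZero N] (B : Type) [NonUnitalCStarAlgebra B] :
    UnitaryMultipliers (Multiplicative (ZMod N)) (CStarMatrix (ZMod N) (ZMod N) B) where
  L g := shiftL g.toAdd
  R g := shiftR g.toAdd
  L_mul g x y := by
    ext i j
    simp only [CStarMatrix.mul_apply, shiftL_apply]
  R_mul g x y := by
    ext i j
    simp only [CStarMatrix.mul_apply, shiftR_apply]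
  R_mul_eq g x y := by
    ext i j
    rw [CStarMatrix.mul_apply, CStarMatrix.mul_apply]
    refine (Equiv.sum_comp (Equiv.addRight g.toAdd) _).symm.trans (Finset.sum_congr rfl ?_)
    intro k _
    simp only [shiftR_apply, shiftL_apply, Equiv.coe_addRight, add_sub_cancel_right]
  L_R g h x := rfl
  R_R g h x := by
    ext i j
    simp only [shiftR_apply]
    rw [toAdd_mul, sub_sub, add_comm]
  R_one x := by
    ext i j
    simp [shiftR_apply]
  star_R g x := by
    ext i j
    simp only [CStarMatrix.star_apply, shiftR_apply, shiftL_apply]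
    rw [toAdd_inv, sub_eq_add_neg]

theorem phaseMultipliers_L (g : Multiplicative (ZMod N)) (m : CStarMatrix (ZMod N) (ZMod N) B)
    (i j : ZMod N) : (phaseMultipliers N B).L g m i j =
      (ZMod.stdAddChar (g.toAdd * i) : ℂ) • m i j := rfl

theorem phaseMultipliers_R (g : Multiplicative (ZMod N)) (m : CStarMatrix (ZMod N) (ZMod N) B)
    (i j : ZMod N) : (phaseMultipliers N B).R g m i j =
      (ZMod.stdAddChar (g.toAdd * j) : ℂ) • m i j := rfl

theorem phaseMultipliers_ad (g : Multiplicative (ZMod N)) (m : CStarMatrix (ZMod N) (ZMod N) B)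
    (i j : ZMod N) : (phaseMultipliers N B).ad g m i j =
      (ZMod.stdAddChar (g.toAdd * (i - j)) : ℂ) • m i j := by
  rw [UnitaryMultipliers.ad_apply, phaseMultipliers_R, phaseMultipliers_L, smul_smul,
    ← AddChar.map_add_eq_mul, toAdd_inv]
  ring_nf

theorem shiftMultipliers_L (g : Multiplicative (ZMod N)) (m : CStarMatrix (ZMod N) (ZMod N) B)
    (i j : ZMod N) : (shiftMultipliers N B).L g m i j = m (i + g.toAdd) j := rfl

theorem shiftMultipliers_R (g : Multiplicative (ZMod N)) (m : CStarMatrix (ZMod N) (ZMod N) B)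
    (i j : ZMod N) : (shiftMultipliers N B).R g m i j = m i (j - g.toAdd) := rfl

theorem shiftMultipliers_ad (g : Multiplicative (ZMod N)) (m : CStarMatrix (ZMod N) (ZMod N) B)
    (i j : ZMod N) : (shiftMultipliers N B).ad g m i j = m (i + g.toAdd) (j + g.toAdd) := by
  rw [UnitaryMultipliers.ad_apply, shiftMultipliers_R, shiftMultipliers_L, toAdd_inv, sub_neg_eq_add]

/-- The Weyl commutation relation `(Z^*)^h X^g = ω^(gh) X^g (Z^*)^h`, read as an identity of right
multiplications. -/
theorem phase_R_shift_R (g h : Multiplicative (ZMod N)) (m : CStarMatrix (ZMod N) (ZMod N) B) :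
    (phaseMultipliers N B).R g ((shiftMultipliers N B).R h m) =
      (ZMod.stdAddChar (g.toAdd * h.toAdd) : ℂ) •
        (shiftMultipliers N B).R h ((phaseMultipliers N B).R g m) := by
  ext i j
  rw [CStarMatrix.smul_apply, shiftMultipliers_R, phaseMultipliers_R, phaseMultipliers_R,
    shiftMultipliers_R, smul_smul, ← AddChar.map_add_eq_mul]
  ring_nf

/-! ### The Pauli representation of an iterated crossed product and its bijectivity -/

section duality

variable {γ₁ γ₂ : Multiplicative (ZMod N) →* (A →⋆ₙₐ[ℂ] A)}
  (hγ : ∀ g h a, γ₁ g (γ₂ h a) = γ₂ h (γ₁ g a))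
  (ρ : A →⋆ₙₐ[ℂ] CStarMatrix (ZMod N) (ZMod N) B)
  (h₁ : ∀ g a, (phaseMultipliers N B).ad g (ρ a) = ρ (γ₁ g a))
  (h₂ : ∀ h a, (shiftMultipliers N B).ad h (ρ a) = ρ (γ₂ h a))

-- Conjugation by `(Z^*)^h` turns `X^g` into `ω^(gh) X^g`, which is exactly the phase built into
-- `extendedAction`. The representation of the first crossed product is therefore covariant for the
-- second action.
include h₂ in
theorem shift_ad_covLift (h : Multiplicative (ZMod N)) (x : CrossedProduct γ₁) :
    (shiftMultipliers N B).ad h (CrossedProduct.covLift (phaseMultipliers N B) ρ h₁ x) =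
      CrossedProduct.covLift (phaseMultipliers N B) ρ h₁ (extendedAction γ₁ γ₂ hγ h x) := by
  suffices H : ((shiftMultipliers N B).ad h).comp
      (CrossedProduct.covLift (phaseMultipliers N B) ρ h₁) =
      (CrossedProduct.covLift (phaseMultipliers N B) ρ h₁).comp (extendedAction γ₁ γ₂ hγ h) from
    DFunLike.congr_fun H x
  refine UniversalCStarAlgebra.hom_ext fun ⟨g, a⟩ => ?_
  rw [NonUnitalStarAlgHom.comp_apply, NonUnitalStarAlgHom.comp_apply, extendedAction,
    UniversalCStarAlgebra.action_gen, CrossedProduct.gen_eq_incl, CrossedProduct.gen_eq_incl,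
    CrossedProduct.covLift_incl, CrossedProduct.covLift_incl, map_smul ρ, ← h₂]
  ext i j
  rw [shiftMultipliers_ad, phaseMultipliers_R, phaseMultipliers_R, CStarMatrix.smul_apply,
    shiftMultipliers_ad, smul_smul, ← AddChar.map_add_eq_mul]
  ring_nf

/-- The representation of an iterated crossed product on matrices given by a representation which
is covariant for the generalized Pauli matrices. -/
def pauliLift : DoubleCrossedProduct γ₁ γ₂ hγ →⋆ₙₐ[ℂ] CStarMatrix (ZMod N) (ZMod N) B :=
  CrossedProduct.covLift (shiftMultipliers N B)
    (CrossedProduct.covLift (phaseMultipliers N B) ρ h₁) (shift_ad_covLift hγ ρ h₁ h₂)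

/-- The element `a u_g v_h` of the iterated crossed product. -/
def inclDouble (g h : Multiplicative (ZMod N)) : A →L[ℂ] DoubleCrossedProduct γ₁ γ₂ hγ :=
  (CrossedProduct.incl (extendedAction γ₁ γ₂ hγ) h).comp (CrossedProduct.incl γ₁ g)

theorem pauliLift_inclDouble (g h : Multiplicative (ZMod N)) (a : A) :
    pauliLift hγ ρ h₁ h₂ (inclDouble hγ g h a) =
      (shiftMultipliers N B).R h ((phaseMultipliers N B).R g (ρ a)) := by
  rw [inclDouble, ContinuousLinearMap.comp_apply, pauliLift, CrossedProduct.covLift_incl,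
    CrossedProduct.covLift_incl]

theorem double_clm_ext {F : Type} [AddCommGroup F] [Module ℂ F] [TopologicalSpace F] [T2Space F]
    {f f' : DoubleCrossedProduct γ₁ γ₂ hγ →L[ℂ] F}
    (h : ∀ g h a, f (inclDouble hγ g h a) = f' (inclDouble hγ g h a)) : f = f' := by
  refine CrossedProduct.clm_ext _ fun k x => ?_
  have : f.comp (CrossedProduct.incl (extendedAction γ₁ γ₂ hγ) k) =
      f'.comp (CrossedProduct.incl (extendedAction γ₁ γ₂ hγ) k) :=
    CrossedProduct.clm_ext _ fun g a => h g k a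
  exact DFunLike.congr_fun this x

variable (ρ' : B →⋆ₙₐ[ℂ] CStarMatrix (ZMod N) (ZMod N) A)

/-- The coefficient of `u_g v_h` of a matrix in the image of the iterated crossed product. -/
def pauliCoeff (g h : Multiplicative (ZMod N)) : CStarMatrix (ZMod N) (ZMod N) B →L[ℂ] A :=
  (N : ℂ)⁻¹ • ∑ j, (ZMod.stdAddChar (-(g.toAdd * j)) : ℂ) • ∑ i,
    (CStarMatrix.entryCLM i j).comp (ρ'.toCLM.comp (CStarMatrix.entryCLM i (j + h.toAdd)))

theorem pauliCoeff_apply (g h : Multiplicative (ZMod N)) (m : CStarMatrix (ZMod N) (ZMod N) B) :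
    pauliCoeff ρ' g h m = (N : ℂ)⁻¹ • ∑ j, (ZMod.stdAddChar (-(g.toAdd * j)) : ℂ) •
      ∑ i, ρ' (m i (j + h.toAdd)) i j := by
  simp only [pauliCoeff, smul_apply, sum_apply,
    ContinuousLinearMap.comp_apply, CStarMatrix.entryCLM_apply, NonUnitalStarAlgHom.toCLM_apply]

variable (hρ : ∀ a j q, ∑ i, ρ' (ρ a i j) i q = if j = q then a else 0)

-- In `ρ(a) X^g' (Z^*)^h'` the column `j + h` comes from the column `j + h - h'` of `ρ(a)`. By `hρ`
-- the inner sum vanishes unless `h = h'` and otherwise equals `a` times a phase; averaging over `j`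
-- against the character of `g` then selects `g = g'`.
include hρ in
theorem pauliCoeff_R_R (g h g' h' : Multiplicative (ZMod N)) (a : A) :
    pauliCoeff ρ' g h ((shiftMultipliers N B).R h' ((phaseMultipliers N B).R g' (ρ a))) =
      if g = g' ∧ h = h' then a else 0 := by
  have hN : (N : ℂ) ≠ 0 := by exact_mod_cast NeZero.ne N
  have h3 : ∀ (c : ℂ) (b : B) (i j : ZMod N), ρ' (c • b) i j = c • ρ' b i j := fun c b i j => by
    rw [map_smul, CStarMatrix.smul_apply]
  simp only [pauliCoeff_apply, shiftMultipliers_R, phaseMultipliers_R, h3, ← Finset.smul_sum, hρ]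
  by_cases hh : h = h'
  · subst hh
    simp only [add_sub_cancel_right, if_true, smul_smul, ← AddChar.map_add_eq_mul, and_true]
    rw [← Finset.sum_smul]
    have h4 : ∀ j, -(g.toAdd * j) + g'.toAdd * j = j * (g'.toAdd - g.toAdd) := fun j => by ring
    simp only [h4, sum_stdAddChar_mul, sub_eq_zero]
    by_cases hg : g = g'
    · subst hg; simp [hN, smul_smul]
    · rw [if_neg (fun h => hg (Multiplicative.toAdd.injective h).symm), if_neg hg]
      simp
  · have h5 : ∀ j, j + h.toAdd - h'.toAdd ≠ j := fun j hj => hh (by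
      rw [add_sub_assoc, add_eq_left, sub_eq_zero] at hj
      exact Multiplicative.toAdd.injective hj)
    simp [hh, h5]

/-- The continuous linear inverse of `pauliLift`. -/
def pauliInv : CStarMatrix (ZMod N) (ZMod N) B →L[ℂ] DoubleCrossedProduct γ₁ γ₂ hγ :=
  ∑ g, ∑ h, (inclDouble hγ g h).comp (pauliCoeff ρ' g h)

-- It suffices to compare the two continuous maps on the elements `a u_g v_h`, whose span is dense.
-- The continuity of this left inverse is what later makes the range of `pauliLift` closed.
include hρ in
theorem pauliInv_pauliLift (x : DoubleCrossedProduct γ₁ γ₂ hγ) :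
    pauliInv hγ ρ' (pauliLift hγ ρ h₁ h₂ x) = x := by
  suffices H : (pauliInv hγ ρ').comp (pauliLift hγ ρ h₁ h₂).toCLM = ContinuousLinearMap.id ℂ _ from
    DFunLike.congr_fun H x
  refine double_clm_ext hγ fun g h a => ?_
  rw [ContinuousLinearMap.comp_apply, NonUnitalStarAlgHom.toCLM_apply, pauliLift_inclDouble,
    ContinuousLinearMap.id_apply, pauliInv]
  simp only [sum_apply, ContinuousLinearMap.comp_apply,
    pauliCoeff_R_R ρ ρ' hρ]
  rw [Finset.sum_eq_single g, Finset.sum_eq_single h]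
  · simp
  · intro k _ hk; simp [hk]
  · simp
  · intro k _ hk; simp [hk]
  · simp

-- The span of all `ρ(a) X^g (Z^*)^h` is a bimodule over the Pauli matrices. As these span `M_N(ℂ)`,
-- any entry of `ρ(a)` can be cut out and moved to any position without leaving it.
include h₁ h₂ in
theorem singleMatrix_mem_span (a : A) (i j k l : ZMod N) :
    singleMatrix i j (ρ a k l) ∈ Submodule.span ℂ {m | ∃ g h a,
      m = (shiftMultipliers N B).R h ((phaseMultipliers N B).R g (ρ a))} := by
  set S := Submodule.span ℂ {m | ∃ g h a,
      m = (shiftMultipliers N B).R h ((phaseMultipliers N B).R g (ρ a))}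
  have hmem : ∀ g h a, (shiftMultipliers N B).R h ((phaseMultipliers N B).R g (ρ a)) ∈ S :=
    fun g h a => Submodule.subset_span ⟨g, h, a, rfl⟩
  have key : ∀ T : CStarMatrix (ZMod N) (ZMod N) B →ₗ[ℂ] CStarMatrix (ZMod N) (ZMod N) B,
      (∀ g h a, T ((shiftMultipliers N B).R h ((phaseMultipliers N B).R g (ρ a))) ∈ S) →
      ∀ m ∈ S, T m ∈ S := fun T hT m hm => by
    have : S ≤ S.comap T := Submodule.span_le.2 (by rintro _ ⟨g, h, a, rfl⟩; exact hT g h a)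
    exact this hm
  have hR2 : ∀ h, ∀ m ∈ S, (shiftMultipliers N B).R h m ∈ S := fun h => key _ fun g' h' a => by
    rw [UnitaryMultipliers.R_R]
    exact hmem _ _ _
  have hR1 : ∀ g, ∀ m ∈ S, (phaseMultipliers N B).R g m ∈ S := fun g => key _ fun g' h' a => by
    rw [phase_R_shift_R, UnitaryMultipliers.R_R]
    exact S.smul_mem _ (hmem _ _ _)
  have hR : ∀ g a, (phaseMultipliers N B).R g (ρ a) ∈ S := fun g a => by
    have h := hmem g 1 a
    rwa [UnitaryMultipliers.R_one] at h
  -- Stability on the left comes from covariance: `(Z^*)^h ρ(a) = ρ(γ₂ h a) (Z^*)^h`.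
  have hL2 : ∀ h, ∀ m ∈ S, (shiftMultipliers N B).L h m ∈ S := fun h => key _ fun g' h' a => by
    rw [UnitaryMultipliers.L_R]
    refine hR2 _ _ ?_
    change (phaseMultipliers N B).R g' ((shiftMultipliers N B).L h (ρ a)) ∈ S
    refine hR1 _ _ ?_
    rw [← UnitaryMultipliers.R_ad, h₂]
    refine hR2 _ _ ?_
    have h := hR 1 (γ₂ h a)
    rwa [UnitaryMultipliers.R_one] at h
  have hL1 : ∀ g, ∀ m ∈ S, (phaseMultipliers N B).L g m ∈ S := fun g => key _ fun g' h' a => by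
    change (shiftMultipliers N B).R h' ((phaseMultipliers N B).L g
      ((phaseMultipliers N B).R g' (ρ a))) ∈ S
    refine hR2 _ _ ?_
    rw [UnitaryMultipliers.L_R, ← UnitaryMultipliers.R_ad, h₁]
    exact hR1 _ _ (hR _ _)
  have hN : (N : ℂ) ≠ 0 := by exact_mod_cast NeZero.ne N
  -- The projection `e_kk` is the average of the powers `X^g` weighted by `ω^(-gk)`.
  have hrow : ∀ m ∈ S, (CStarMatrix.ofMatrix fun p q => if p = k then m p q else 0) ∈ S := by
    intro m hm
    have : (CStarMatrix.ofMatrix fun p q => if p = k then m p q else 0) =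
        ∑ g : ZMod N, ((N : ℂ)⁻¹ * ZMod.stdAddChar (g * (-k)) : ℂ) •
          (phaseMultipliers N B).L (Multiplicative.ofAdd g) m := by
      ext p q
      simp only [CStarMatrix.sum_apply, CStarMatrix.smul_apply, phaseMultipliers_L,
        toAdd_ofAdd, mul_smul, ← Finset.smul_sum]
      simp only [smul_smul _ _ (m p q), ← AddChar.map_add_eq_mul, ← mul_add]
      rw [← Finset.sum_smul, sum_stdAddChar_mul, smul_smul, CStarMatrix.ofMatrix_apply_apply]
      by_cases h : p = k
      · simp [h, hN]
      · rw [if_neg h, if_neg (by rwa [neg_add_eq_sub, sub_eq_zero]), mul_zero, zero_smul]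
    rw [this]
    exact S.sum_mem fun g _ => S.smul_mem _ (hL1 _ _ hm)
  have hcol : ∀ m ∈ S, (CStarMatrix.ofMatrix fun p q => if q = l then m p q else 0) ∈ S := by
    intro m hm
    have : (CStarMatrix.ofMatrix fun p q => if q = l then m p q else 0) =
        ∑ g : ZMod N, ((N : ℂ)⁻¹ * ZMod.stdAddChar (g * (-l)) : ℂ) •
          (phaseMultipliers N B).R (Multiplicative.ofAdd g) m := by
      ext p q
      simp only [CStarMatrix.sum_apply, CStarMatrix.smul_apply, phaseMultipliers_R,
        toAdd_ofAdd, mul_smul, ← Finset.smul_sum]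
      simp only [smul_smul _ _ (m p q), ← AddChar.map_add_eq_mul, ← mul_add]
      rw [← Finset.sum_smul, sum_stdAddChar_mul, smul_smul, CStarMatrix.ofMatrix_apply_apply]
      by_cases h : q = l
      · simp [h, hN]
      · rw [if_neg h, if_neg (by rwa [neg_add_eq_sub, sub_eq_zero]), mul_zero, zero_smul]
    rw [this]
    exact S.sum_mem fun g _ => S.smul_mem _ (hR1 _ _ hm)
  have h0 : ρ a ∈ S := by
    have h := hR 1 a
    rwa [UnitaryMultipliers.R_one] at h
  -- The left shift by `k - i` moves row `k` to row `i`; the right shift by `j - l` moves column `l`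
  -- to column `j`.
  have h5 := hL2 (Multiplicative.ofAdd (k - i)) _
    (hR2 (Multiplicative.ofAdd (j - l)) _ (hcol _ (hrow _ h0)))
  convert h5 using 1
  ext p q
  rw [shiftMultipliers_L, shiftMultipliers_R, singleMatrix_apply]
  change _ = if q - (j - l) = l then (if p + (k - i) = k then ρ a _ _ else 0) else 0
  have e1 : p + (k - i) = k ↔ p = i := by
    rw [← sub_eq_zero, show p + (k - i) - k = p - i by ring, sub_eq_zero]
  have e2 : q - (j - l) = l ↔ q = j := by
    rw [← sub_eq_zero, show q - (j - l) - l = q - j by ring, sub_eq_zero]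
  simp only [toAdd_ofAdd, e1, e2]
  by_cases hp : p = i <;> by_cases hq : q = j <;> simp [hp, hq]

include h₁ h₂ hρ in
/-- If `B` is generated by the matrix entries of a covariant representation of `A` on matrices over
`B`, which is inverted by a representation of `B` on matrices over `A`, then the iterated crossed
product of `A` is the matrix algebra over `B`. -/
theorem nonempty_matrix_equiv_doubleCrossedProduct
    (hgen : ∀ S : NonUnitalStarSubalgebra ℂ B, IsClosed (S : Set B) →
      (∀ a k l, ρ a k l ∈ S) → ∀ b, b ∈ S) :
    Nonempty (CStarMatrix (ZMod N) (ZMod N) B ≃⋆ₐ[ℂ] DoubleCrossedProduct γ₁ γ₂ hγ) := by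
  set Φ := pauliLift hγ ρ h₁ h₂
  set Q := pauliInv (γ₁ := γ₁) (γ₂ := γ₂) hγ ρ'
  have hQΦ : ∀ x, Q (Φ x) = x := pauliInv_pauliLift hγ ρ h₁ h₂ ρ' hρ
  -- The left inverse describes the range of `Φ` by an equation between continuous maps, so the
  -- range is closed.
  have hrange : ∀ m, (∃ x, Φ x = m) ↔ Φ (Q m) = m := fun m =>
    ⟨by rintro ⟨x, rfl⟩; rw [hQΦ], fun h => ⟨_, h⟩⟩
  have hspan : ∀ m ∈ Submodule.span ℂ {m | ∃ g h a,
      m = (shiftMultipliers N B).R h ((phaseMultipliers N B).R g (ρ a))}, ∃ x, Φ x = m := by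
    intro m hm
    induction hm using Submodule.span_induction with
    | mem m hm =>
      obtain ⟨g, h, a, rfl⟩ := hm
      exact ⟨_, pauliLift_inclDouble hγ ρ h₁ h₂ g h a⟩
    | zero => exact ⟨0, map_zero _⟩
    | add x y _ _ hx hy =>
      obtain ⟨x, rfl⟩ := hx
      obtain ⟨y, rfl⟩ := hy
      exact ⟨x + y, map_add _ _ _⟩
    | smul c x _ hx =>
      obtain ⟨x, rfl⟩ := hx
      exact ⟨c • x, map_smul _ _ _⟩
  have hsingle : ∀ b, ∀ i j, ∃ x, Φ x = singleMatrix i j b := by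
    let singleLM : ZMod N → ZMod N → B →ₗ[ℂ] CStarMatrix (ZMod N) (ZMod N) B := fun i j =>
      { toFun := singleMatrix i j
        map_add' := fun a b => by
          ext p q
          simp only [CStarMatrix.add_apply, singleMatrix_apply]
          split_ifs <;> simp
        map_smul' := fun c b => by
          ext p q
          simp only [CStarMatrix.smul_apply, singleMatrix_apply]
          split_ifs <;> simp }
    -- All positions `(i, j)` are required at once: products use `(e_ii ⊗ a)(e_ij ⊗ b)`, and
    -- adjoints exchange `i` and `j`.
    let S : NonUnitalStarSubalgebra ℂ B :=
      { carrier := {b | ∀ i j, ∃ x, Φ x = singleMatrix i j b}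
        add_mem' := fun {a b} ha hb i j => by
          obtain ⟨x, hx⟩ := ha i j
          obtain ⟨y, hy⟩ := hb i j
          exact ⟨x + y, by rw [map_add, hx, hy]; exact (map_add (singleLM i j) a b).symm⟩
        zero_mem' := fun i j => ⟨0, by rw [map_zero]; exact (map_zero (singleLM i j)).symm⟩
        mul_mem' := fun {a b} ha hb i j => by
          obtain ⟨x, hx⟩ := ha i i
          obtain ⟨y, hy⟩ := hb i j
          exact ⟨x * y, by rw [map_mul, hx, hy, singleMatrix_mul]⟩
        smul_mem' := fun c b hb i j => by
          obtain ⟨x, hx⟩ := hb i j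
          exact ⟨c • x, by rw [map_smul, hx]; exact (map_smul (singleLM i j) c b).symm⟩
        star_mem' := fun {b} hb i j => by
          obtain ⟨x, hx⟩ := hb j i
          exact ⟨star x, by rw [map_star, hx, star_singleMatrix]⟩ }
    refine hgen S ?_ fun a k l i j => hspan _ (singleMatrix_mem_span ρ h₁ h₂ a i j k l)
    have hcont : ∀ i j, Continuous (singleMatrix i j : B → CStarMatrix (ZMod N) (ZMod N) B) :=
      fun i j => by
        refine continuous_pi fun p => continuous_pi fun q => ?_
        change Continuous fun b : B => if p = i ∧ q = j then b else 0
        split_ifs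
        · exact continuous_id
        · exact continuous_const
    have hS : (S : Set B) = ⋂ i, ⋂ j, {b | Φ (Q (singleMatrix i j b)) = singleMatrix i j b} := by
      ext b
      simp only [Set.mem_iInter, Set.mem_ofPred_eq, ← hrange]
      rfl
    rw [hS]
    exact isClosed_iInter fun i => isClosed_iInter fun j => isClosed_eq
      (Φ.continuous_of_cstar.comp (Q.continuous.comp (hcont i j))) (hcont i j)
  have hbij : Function.Bijective Φ := by
    refine ⟨Function.LeftInverse.injective hQΦ, fun m => ?_⟩
    choose x hx using hsingle
    refine ⟨∑ k, ∑ l, x (m k l) k l, ?_⟩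
    simp only [map_sum, hx]
    exact sum_singleMatrix m
  exact ⟨(StarAlgEquiv.ofBijective Φ hbij).symm⟩

end duality

end

noncomputable section

/-! ## Topological generators -/

/-- The family `s` generates `A` as a C*-algebra. -/
def CStarGenerates {ι A : Type} [NonUnitalCStarAlgebra A] (s : ι → A) : Prop :=
  ∀ S : NonUnitalStarSubalgebra ℂ A, IsClosed (S : Set A) → (∀ i, s i ∈ S) → ∀ a, a ∈ S

theorem CStarGenerates.hom_eq {ι A B : Type} [NonUnitalCStarAlgebra A] [NonUnitalCStarAlgebra B]
    {s : ι → A} (hs : CStarGenerates s) {φ ψ : A →⋆ₙₐ[ℂ] B} (h : ∀ i, φ (s i) = ψ (s i)) (a : A) :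
    φ a = ψ a :=
  hs
    { carrier := {a | φ a = ψ a}
      add_mem' := fun {a b} (ha : φ a = ψ a) (hb : φ b = ψ b) => by
        change φ _ = ψ _; rw [map_add, map_add, ha, hb]
      zero_mem' := by change φ _ = ψ _; rw [map_zero, map_zero]
      mul_mem' := fun {a b} (ha : φ a = ψ a) (hb : φ b = ψ b) => by
        change φ _ = ψ _; rw [map_mul, map_mul, ha, hb]
      smul_mem' := fun c a (ha : φ a = ψ a) => by change φ _ = ψ _; rw [map_smul, map_smul, ha]
      star_mem' := fun {a} (ha : φ a = ψ a) => by change φ _ = ψ _; rw [map_star, map_star, ha] }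
    (isClosed_eq φ.continuous_of_cstar ψ.continuous_of_cstar) h a

theorem UniversalCStarAlgebra.generates_gen {X : Type} (R : CStarRelation X) [R.IsBounded] :
    CStarGenerates (gen R) := fun S hS h a =>
  induction_gen (P := fun a => a ∈ S) hS h (fun _ _ => S.add_mem) (fun c _ => S.smul_mem c)
    (fun _ _ => S.mul_mem) (fun _ => star_mem) S.zero_mem a

variable {N : ℕ} [NeZero N] {A B : Type} [NonUnitalCStarAlgebra A] [NonUnitalCStarAlgebra B]

/-- With `M(a) = (id ⊗ ρ')(ρ(a))` and `Ω = ∑ i, e_i ⊗ e_i`, the conclusion reads `Ω^* M(a) = a Ω^*`,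
and `h'` reads `M(s x) Ω = Ω (s x)`. The first identity passes to sums, products and limits but not
to adjoints; having both on the generators makes it hold for their adjoints as well. -/
theorem sum_entry_of_generates {ι : Type} {s : ι → A} (hs : CStarGenerates s)
    (ρ : A →⋆ₙₐ[ℂ] CStarMatrix (ZMod N) (ZMod N) B) (ρ' : B →⋆ₙₐ[ℂ] CStarMatrix (ZMod N) (ZMod N) A)
    (h : ∀ x j q, ∑ i, ρ' (ρ (s x) i j) i q = if j = q then s x else 0)
    (h' : ∀ x j q, ∑ i, ρ' (ρ (s x) j i) q i = if j = q then s x else 0)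
    (a : A) (j q : ZMod N) : ∑ i, ρ' (ρ a i j) i q = if j = q then a else 0 := by
  let P : A → Prop := fun a => ∀ j q, ∑ i, ρ' (ρ a i j) i q = if j = q then a else 0
  have hadd : ∀ a b, P a → P b → P (a + b) := fun a b ha hb j q => by
    simp only [map_add, CStarMatrix.add_apply, Finset.sum_add_distrib]
    rw [ha, hb]
    split_ifs <;> simp
  have hsmul : ∀ (c : ℂ) a, P a → P (c • a) := fun c a ha j q => by
    simp only [map_smul, CStarMatrix.smul_apply, ← Finset.smul_sum]
    rw [ha]
    split_ifs <;> simp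
  have hzero : P 0 := fun j q => by
    simp
  have hmul : ∀ a b, P a → P b → P (a * b) := fun a b ha hb j q => by
    have h1 : ∀ i, ρ' (ρ (a * b) i j) i q = ∑ k, ∑ r, ρ' (ρ a i k) i r * ρ' (ρ b k j) r q := by
      intro i
      rw [map_mul, CStarMatrix.mul_apply, map_sum, CStarMatrix.sum_apply]
      simp only [map_mul, CStarMatrix.mul_apply]
    simp only [h1]
    rw [Finset.sum_comm]
    -- The identity for `a` collapses the inner index `r` to `k`, leaving exactly the sum in the
    -- identity for `b`.
    have h2 : ∀ k, ∑ i, ∑ r, ρ' (ρ a i k) i r * ρ' (ρ b k j) r q = a * ρ' (ρ b k j) k q := by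
      intro k
      rw [Finset.sum_comm]
      simp only [← Finset.sum_mul]
      have h3 : ∀ r, ∑ i, ρ' (ρ a i k) i r = if k = r then a else 0 := ha k
      simp [h3]
    simp only [h2, ← Finset.mul_sum]
    rw [hb]
    split_ifs <;> simp
  have hclosed : IsClosed {a | P a} := by
    simp only [P, Set.ofPred_forall]
    refine isClosed_iInter fun j => isClosed_iInter fun q => isClosed_eq ?_ ?_
    · refine continuous_finsetSum _ fun i _ => ?_
      exact (CStarMatrix.entryCLM i q).continuous.comp (ρ'.continuous_of_cstar.comp
        ((CStarMatrix.entryCLM i j).continuous.comp ρ.continuous_of_cstar))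
    · split_ifs
      · exact continuous_id
      · exact continuous_const
  -- Imposing the property on `a` and on `star a` makes the set closed under adjoints.
  let S : NonUnitalStarSubalgebra ℂ A :=
    { carrier := {a | P a ∧ P (star a)}
      add_mem' := fun {a b} ha hb => ⟨hadd a b ha.1 hb.1, by
        rw [star_add]; exact hadd _ _ ha.2 hb.2⟩
      zero_mem' := ⟨hzero, by rw [star_zero]; exact hzero⟩
      mul_mem' := fun {a b} ha hb => ⟨hmul a b ha.1 hb.1, by
        rw [star_mul]; exact hmul _ _ hb.2 ha.2⟩
      smul_mem' := fun c a ha => ⟨hsmul c a ha.1, by rw [star_smul]; exact hsmul _ _ ha.2⟩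
      star_mem' := fun {a} ha => ⟨ha.2, by rw [star_star]; exact ha.1⟩ }
  have hS : IsClosed (S : Set A) := hclosed.inter (hclosed.preimage continuous_star)
  refine (hs S hS (fun x => ⟨h x, fun j q => ?_⟩) a).1 j q
  have h2 : ∀ i, ρ' (ρ (star (s x)) i j) i q = star (ρ' (ρ (s x) j i) q i) := fun i => by
    rw [map_star, CStarMatrix.star_apply, map_star, CStarMatrix.star_apply]
  simp only [h2, ← star_sum]
  rw [h']
  split_ifs <;> simp

/-! ## The Bell basis -/

/-- The matrix of matrices which is diagonal in the Bell basis with entries `T a b`. -/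
def bellMatrix (T : ZMod N → ZMod N → A) :
    CStarMatrix (ZMod N) (ZMod N) (CStarMatrix (ZMod N) (ZMod N) A) :=
  CStarMatrix.ofMatrix fun k l => CStarMatrix.ofMatrix fun p q =>
    if p - q = k - l then (N : ℂ)⁻¹ • ∑ c, (ZMod.stdAddChar (c * (k - l)) : ℂ) • T c (p - k) else 0

theorem bellMatrix_apply (T : ZMod N → ZMod N → A) (k l p q : ZMod N) :
    bellMatrix T k l p q = if p - q = k - l then
      (N : ℂ)⁻¹ • ∑ c, (ZMod.stdAddChar (c * (k - l)) : ℂ) • T c (p - k) else 0 := rfl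

/-- The Bell vectors `N^(-1/2) ∑ k, ω^(ck) e_k ⊗ e_(k+d)` are orthonormal and `bellMatrix T` is the
sum of their projections tensored with `T c d`, so multiplication is entrywise in `T`. -/
theorem bellMatrix_mul (T T' : ZMod N → ZMod N → A) :
    bellMatrix T * bellMatrix T' = bellMatrix fun a b => T a b * T' a b := by
  have hN : (N : ℂ) ≠ 0 := by exact_mod_cast NeZero.ne N
  ext k l p q
  rw [CStarMatrix.mul_apply, CStarMatrix.sum_apply]
  -- The second coordinate `d`, the difference of the inner and outer indices, is preserved, so a
  -- single intermediate inner index contributes.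
  have h1 : ∀ m, (bellMatrix T k m * bellMatrix T' m l) p q =
      if p - q = k - l then bellMatrix T k m p (p - k + m) * bellMatrix T' m l (p - k + m) q
        else 0 := by
    intro m
    rw [CStarMatrix.mul_apply, Finset.sum_eq_single (p - k + m)]
    · split_ifs with h
      · rfl
      · rw [bellMatrix_apply T' m l, if_neg, mul_zero]
        intro h'
        refine h ?_
        linear_combination h'
    · intro r _ hr
      rw [bellMatrix_apply T, if_neg, zero_mul]
      intro h'
      refine hr ?_
      linear_combination -h'
    · simp
  simp only [h1]
  rw [bellMatrix_apply]
  split_ifs with h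
  swap
  · simp
  have h2 : ∀ m, bellMatrix T k m p (p - k + m) * bellMatrix T' m l (p - k + m) q =
      ((N : ℂ)⁻¹ * (N : ℂ)⁻¹) • ∑ c, ∑ d, (ZMod.stdAddChar (c * k - d * l) : ℂ) •
        (ZMod.stdAddChar (m * (d - c)) : ℂ) • (T c (p - k) * T' d (p - k)) := by
    intro m
    rw [bellMatrix_apply, bellMatrix_apply, if_pos (by ring), if_pos (by linear_combination h),
      smul_mul_smul_comm, Finset.sum_mul_sum]
    congr 1
    refine Finset.sum_congr rfl fun c _ => Finset.sum_congr rfl fun d _ => ?_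
    rw [smul_mul_smul_comm, smul_smul, ← AddChar.map_add_eq_mul, ← AddChar.map_add_eq_mul,
      add_sub_cancel_right]
    ring_nf
  simp only [h2, ← Finset.smul_sum]
  rw [Finset.sum_comm]
  -- Summing over the intermediate outer index `m` kills the terms `d ≠ c`: this is orthogonality of
  -- the Bell vectors with different phases.
  have h3 : ∀ c, ∑ m : ZMod N, ∑ d, (ZMod.stdAddChar (c * k - d * l) : ℂ) •
      (ZMod.stdAddChar (m * (d - c)) : ℂ) • (T c (p - k) * T' d (p - k)) =
      (N : ℂ) • (ZMod.stdAddChar (c * (k - l)) : ℂ) • (T c (p - k) * T' c (p - k)) := by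
    intro c
    rw [Finset.sum_comm]
    simp only [← Finset.smul_sum, ← Finset.sum_smul, sum_stdAddChar_mul]
    rw [Finset.sum_eq_single c]
    · rw [sub_self, if_pos rfl, smul_comm, mul_sub]
    · intro d _ hd
      rw [if_neg (sub_ne_zero.2 hd), zero_smul, smul_zero]
    · simp
  rw [Finset.sum_congr rfl fun c _ => h3 c, ← Finset.smul_sum, smul_smul]
  congr 1
  field_simp

theorem star_bellMatrix (T : ZMod N → ZMod N → A) :
    star (bellMatrix T) = bellMatrix fun a b => star (T a b) := by
  ext k l p q
  rw [CStarMatrix.star_apply, CStarMatrix.star_apply, bellMatrix_apply, bellMatrix_apply]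
  have h : q - p = l - k ↔ p - q = k - l := by
    rw [← neg_inj, neg_sub, neg_sub]
  simp only [h]
  split_ifs with h'
  · rw [star_smul, star_sum, star_inv₀, Complex.star_def, Complex.conj_natCast]
    congr 1
    refine Finset.sum_congr rfl fun c _ => ?_
    rw [star_smul, star_stdAddChar, ← mul_neg, neg_sub,
      show q - l = p - k by linear_combination -h']
  · exact star_zero _

/-- The matrix with the entry `b` on the diagonal and zeroes elsewhere. -/
def diagMatrix (b : B) : CStarMatrix (ZMod N) (ZMod N) B :=
  CStarMatrix.ofMatrix fun i j => if i = j then b else 0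

theorem diagMatrix_apply (b : B) (i j : ZMod N) :
    diagMatrix b i j = if i = j then b else 0 := rfl

theorem diagMatrix_mul_apply (b : B) (m : CStarMatrix (ZMod N) (ZMod N) B) (i j : ZMod N) :
    (diagMatrix b * m : CStarMatrix (ZMod N) (ZMod N) B) i j = b * m i j := by
  simp [CStarMatrix.mul_apply, diagMatrix_apply]

/-- Completeness of the Bell basis: its projections add up to the identity. -/
theorem bellMatrix_const (e : A) : bellMatrix (N := N) (fun _ _ => e) = diagMatrix (diagMatrix e) := by
  have hN : (N : ℂ) ≠ 0 := by exact_mod_cast NeZero.ne N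
  ext k l p q
  rw [bellMatrix_apply, ← Finset.sum_smul, sum_stdAddChar_mul, diagMatrix_apply]
  by_cases h : k = l
  · subst h
    simp [diagMatrix_apply, sub_eq_zero, smul_smul, hN]
  · rw [if_neg (sub_ne_zero.2 h), if_neg h]
    simp

/-- Bell vectors are maximally entangled: the partial trace of each Bell projection over the outer
factor is `1/N`. -/
theorem sum_bellMatrix_diag (T : ZMod N → ZMod N → A) :
    (N : ℂ) • ∑ k, bellMatrix T k k = diagMatrix (∑ a, ∑ b, T a b) := by
  have hN : (N : ℂ) ≠ 0 := by exact_mod_cast NeZero.ne N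
  ext p q
  rw [CStarMatrix.smul_apply, CStarMatrix.sum_apply, diagMatrix_apply]
  simp only [bellMatrix_apply, sub_self, mul_zero, AddChar.map_zero_eq_one, one_smul, sub_eq_zero]
  split_ifs
  · rw [← Finset.smul_sum, smul_smul, mul_inv_cancel₀ hN, one_smul, Finset.sum_comm]
    exact Finset.sum_congr rfl fun c _ => Equiv.sum_comp (Equiv.subLeft p) (T c)
  · simp

/-! ## Conjugation by the generalized Pauli matrices -/

/-- Conjugation by the inverse of `X ^ a (Z^*) ^ b`. -/
def pauliConj (a b : ZMod N) :
    CStarMatrix (ZMod N) (ZMod N) B →⋆ₙₐ[ℂ] CStarMatrix (ZMod N) (ZMod N) B :=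
  ((phaseMultipliers N B).ad (Multiplicative.ofAdd (-a))).comp
    ((shiftMultipliers N B).ad (Multiplicative.ofAdd (-b)))

theorem pauliConj_apply (a b : ZMod N) (m : CStarMatrix (ZMod N) (ZMod N) B) (i j : ZMod N) :
    pauliConj a b m i j = (ZMod.stdAddChar (-(a * (i - j))) : ℂ) • m (i - b) (j - b) := by
  rw [pauliConj, NonUnitalStarAlgHom.comp_apply, phaseMultipliers_ad, shiftMultipliers_ad,
    toAdd_ofAdd, toAdd_ofAdd, neg_mul, ← sub_eq_add_neg, ← sub_eq_add_neg]

theorem pauliConj_diagMatrix (a b : ZMod N) (e : B) :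
    pauliConj a b (diagMatrix e) = diagMatrix e := by
  ext i j
  rw [pauliConj_apply, diagMatrix_apply, diagMatrix_apply]
  by_cases h : i = j
  · subst h; simp
  · simp [h]

/-- The sum over the phases kills the off-diagonal entries and multiplies the diagonal by `N`; the
sum over the shifts replaces each diagonal entry by the sum of all of them. -/
theorem sum_pauliConj (m : CStarMatrix (ZMod N) (ZMod N) B) :
    ∑ a, ∑ b, pauliConj a b m = diagMatrix ((N : ℂ) • ∑ k, m k k) := by
  ext i j
  simp only [CStarMatrix.sum_apply, pauliConj_apply]
  rw [Finset.sum_comm]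
  simp only [← mul_neg, ← Finset.sum_smul, sum_stdAddChar_mul, neg_eq_zero, sub_eq_zero,
    diagMatrix_apply]
  by_cases h : i = j
  · subst h
    simp only [if_true, ← Finset.smul_sum]
    congr 1
    exact Equiv.sum_comp (Equiv.subLeft i) fun k => m k k
  · simp [h]

/-! ## Twisted pairs -/

section twisted

variable {T : ZMod N → ZMod N → A} {S : CStarMatrix (ZMod N) (ZMod N) B}
  (hT : CStarGenerates fun x : ZMod N × ZMod N => T x.1 x.2)
  (hS : CStarGenerates fun x : ZMod N × ZMod N => S x.1 x.2)
  {ρ : A →⋆ₙₐ[ℂ] CStarMatrix (ZMod N) (ZMod N) B} {ρ' : B →⋆ₙₐ[ℂ] CStarMatrix (ZMod N) (ZMod N) A}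
  (hρ : ∀ a b, ρ (T a b) = pauliConj a b S) (hρ' : ∀ k l, ρ' (S k l) = bellMatrix T k l)

/-- The reindexing `t` accommodates both differences `i - j` and `j - i` occurring below. -/
theorem fourier_inversion (t : ZMod N ≃ ZMod N) (a : ZMod N)
    (f : ZMod N → A) :
    ∑ i, (ZMod.stdAddChar (-(a * t i)) : ℂ) • (N : ℂ)⁻¹ • ∑ c,
      (ZMod.stdAddChar (c * t i) : ℂ) • f c = f a := by
  have hN : (N : ℂ) ≠ 0 := by exact_mod_cast NeZero.ne N
  rw [Equiv.sum_comp t fun i => (ZMod.stdAddChar (-(a * i)) : ℂ) • (N : ℂ)⁻¹ • ∑ c,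
    (ZMod.stdAddChar (c * i) : ℂ) • f c]
  simp only [Finset.smul_sum]
  rw [Finset.sum_comm]
  have h : ∀ c, ∑ i : ZMod N, (ZMod.stdAddChar (-(a * i)) : ℂ) • (N : ℂ)⁻¹ •
      (ZMod.stdAddChar (c * i) : ℂ) • f c = if c = a then f a else 0 := by
    intro c
    have h1 : ∀ i : ZMod N, (ZMod.stdAddChar (-(a * i)) : ℂ) • (N : ℂ)⁻¹ •
        (ZMod.stdAddChar (c * i) : ℂ) • f c =
        (ZMod.stdAddChar (i * (c - a)) : ℂ) • (N : ℂ)⁻¹ • f c := fun i => by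
      rw [smul_comm (N : ℂ)⁻¹, smul_smul, ← AddChar.map_add_eq_mul]
      ring_nf
    simp only [h1, ← Finset.sum_smul, sum_stdAddChar_mul]
    by_cases hc : c = a
    · subst hc; simp [smul_smul, hN]
    · rw [if_neg (sub_ne_zero.2 hc), if_neg hc, zero_smul]
  simp [h]

-- The Pauli conjugation in `ρ (T a b)` carries `Ω` to the Bell vector with label `(a, b)`, on which
-- `bellMatrix T` acts as `T a b`. In coordinates, the sum over `i` is the Fourier inversion
-- isolating `c = a`.
include hρ hρ' in
theorem sum_entry_permuted (a b j q : ZMod N) :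
    ∑ i, ρ' (ρ (T a b) i j) i q = if j = q then T a b else 0 := by
  simp only [hρ, pauliConj_apply, map_smul, hρ', CStarMatrix.smul_apply, bellMatrix_apply,
    sub_sub_sub_cancel_right, sub_right_inj, sub_sub_cancel]
  by_cases h : j = q
  · subst h
    simp only [if_true]
    exact fourier_inversion (Equiv.subRight j) a fun c => T c b
  · simp [h, Ne.symm h]

include hρ hρ' in
theorem sum_entry_permuted' (a b j q : ZMod N) :
    ∑ i, ρ' (ρ (T a b) j i) q i = if j = q then T a b else 0 := by
  simp only [hρ, pauliConj_apply, map_smul, hρ', CStarMatrix.smul_apply, bellMatrix_apply,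
    sub_sub_sub_cancel_right, sub_left_inj]
  by_cases h : j = q
  · subst h
    simp only [if_true, sub_sub_cancel]
    exact fourier_inversion (Equiv.subLeft j) a fun c => T c b
  · simp [h, Ne.symm h]

-- In each Pauli conjugate of `S` the entry `(p, q)` carries the phase `ω^(-c(p-q))`; the weighted
-- average over `c` keeps only the diagonal `p - q = k - l`, where one shifted entry of `S` remains.
include hρ in
theorem entry_bellMatrix (k l i j p q : ZMod N) :
    ρ (bellMatrix T k l i j) p q =
      if i - j = k - l ∧ p - q = k - l then S (p - i + k) (p - i + l) else 0 := by
  have hN : (N : ℂ) ≠ 0 := by exact_mod_cast NeZero.ne N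
  rw [bellMatrix_apply]
  by_cases h : i - j = k - l
  · simp only [h, if_true, true_and, map_smul, map_sum, CStarMatrix.smul_apply,
      CStarMatrix.sum_apply, hρ, pauliConj_apply]
    simp only [smul_smul _ _ (S _ _), ← AddChar.map_add_eq_mul, ← sub_eq_add_neg, ← mul_sub]
    rw [← Finset.sum_smul, sum_stdAddChar_mul, smul_smul]
    by_cases h' : p - q = k - l
    · rw [if_pos (by rw [h', sub_self]), if_pos h', inv_mul_cancel₀ hN, one_smul,
        show p - (i - k) = p - i + k by ring,
        show q - (i - k) = p - i + l by linear_combination -h']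
    · rw [if_neg (fun h0 => h' (sub_eq_zero.1 h0).symm), if_neg h', mul_zero, zero_smul]
  · simp [h]

-- By `entry_bellMatrix` the row index is forced to be `i = j + (k - l)`, and the inner condition
-- then forces `j = q`; there the shift `p - i` is zero, so the remaining entry is `S k l` itself.
include hρ hρ' in
theorem sum_entry_symmetric (k l j q : ZMod N) :
    ∑ i, ρ (ρ' (S k l) i j) i q = if j = q then S k l else 0 := by
  simp only [hρ', entry_bellMatrix hρ, sub_self, zero_add]
  rw [Finset.sum_eq_single (j + (k - l))]
  · simp only [add_sub_cancel_left, true_and]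
    refine if_congr ⟨fun h => ?_, fun h => ?_⟩ rfl rfl
    · linear_combination h
    · rw [h, add_sub_cancel_left]
  · intro i _ hi
    rw [if_neg]
    rintro ⟨h, -⟩
    exact hi (by linear_combination h)
  · simp

include hρ hρ' in
theorem sum_entry_symmetric' (k l j q : ZMod N) :
    ∑ i, ρ (ρ' (S k l) j i) q i = if j = q then S k l else 0 := by
  simp only [hρ', entry_bellMatrix hρ]
  rw [Finset.sum_eq_single (j - (k - l))]
  · simp only [sub_sub_cancel, true_and]
    by_cases h : j = q
    · subst h; simp
    · rw [if_neg h, if_neg]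
      intro h'
      exact h (by linear_combination -h')
  · intro i _ hi
    rw [if_neg]
    rintro ⟨h, -⟩
    exact hi (by linear_combination -h)
  · simp

-- A further conjugation by `X^g` or `(Z^*)^g` lowers the first or second label of `pauliConj` by
-- `g`, matching the permutation of the generators. This gives covariance of `ρ`.
include hT hS hρ hρ' in
theorem nonempty_matrix_equiv_of_permuted
    {β₁ β₂ : Multiplicative (ZMod N) →* (A →⋆ₙₐ[ℂ] A)}
    (hβ : ∀ g h a, β₁ g (β₂ h a) = β₂ h (β₁ g a))
    (hβ₁ : ∀ g a b, β₁ g (T a b) = T (a - g.toAdd) b)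
    (hβ₂ : ∀ g a b, β₂ g (T a b) = T a (b - g.toAdd)) :
    Nonempty (CStarMatrix (ZMod N) (ZMod N) B ≃⋆ₐ[ℂ] DoubleCrossedProduct β₁ β₂ hβ) := by
  refine nonempty_matrix_equiv_doubleCrossedProduct hβ ρ (fun g a => ?_) (fun g a => ?_) ρ' ?_
    (fun U hU hmem b => hS U hU (fun x => ?_) b)
  · refine hT.hom_eq (φ := ((phaseMultipliers N B).ad g).comp ρ) (ψ := ρ.comp (β₁ g))
      (fun x => ?_) a
    rw [NonUnitalStarAlgHom.comp_apply, NonUnitalStarAlgHom.comp_apply, hβ₁, hρ, hρ]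
    ext i j
    rw [phaseMultipliers_ad, pauliConj_apply, pauliConj_apply, smul_smul, ← AddChar.map_add_eq_mul]
    ring_nf
  · refine hT.hom_eq (φ := ((shiftMultipliers N B).ad g).comp ρ) (ψ := ρ.comp (β₂ g))
      (fun x => ?_) a
    rw [NonUnitalStarAlgHom.comp_apply, NonUnitalStarAlgHom.comp_apply, hβ₂, hρ, hρ]
    ext i j
    rw [shiftMultipliers_ad, pauliConj_apply, pauliConj_apply]
    ring_nf
  · exact sum_entry_of_generates hT ρ ρ' (fun x => sum_entry_permuted hρ hρ' x.1 x.2)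
      (fun x => sum_entry_permuted' hρ hρ' x.1 x.2)
  -- Conjugation with label `(0, 0)` is trivial, so the entries of `ρ (T 0 0)` are the generators `S
  -- k l`.
  · have h := hmem (T 0 0) x.1 x.2
    rw [hρ, pauliConj_apply] at h
    simpa using h

-- A Bell-diagonal matrix of matrices has inner entries only where `p - q = k - l`, so conjugating
-- them by `X` multiplies by a phase in `k - l`; since it depends on `T` only through `p - k`,
-- shifting the inner indices amounts to shifting `k` and `l` backwards.
include hT hS hρ hρ' in
theorem nonempty_matrix_equiv_of_symmetric
    {α₁ α₂ : Multiplicative (ZMod N) →* (B →⋆ₙₐ[ℂ] B)}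
    (hα : ∀ g h a, α₁ g (α₂ h a) = α₂ h (α₁ g a))
    (hα₁ : ∀ g k l, α₁ g (S k l) = (ZMod.stdAddChar (g.toAdd * (k - l)) : ℂ) • S k l)
    (hα₂ : ∀ g k l, α₂ g (S k l) = S (k - g.toAdd) (l - g.toAdd)) :
    Nonempty (CStarMatrix (ZMod N) (ZMod N) A ≃⋆ₐ[ℂ] DoubleCrossedProduct α₁ α₂ hα) := by
  refine nonempty_matrix_equiv_doubleCrossedProduct hα ρ' (fun g a => ?_) (fun g a => ?_) ρ ?_
    (fun U hU hmem b => hT U hU (fun x => ?_) b)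
  · refine hS.hom_eq (φ := ((phaseMultipliers N A).ad g).comp ρ') (ψ := ρ'.comp (α₁ g))
      (fun x => ?_) a
    rw [NonUnitalStarAlgHom.comp_apply, NonUnitalStarAlgHom.comp_apply, hα₁, map_smul ρ', hρ']
    ext i j
    rw [phaseMultipliers_ad, CStarMatrix.smul_apply, bellMatrix_apply]
    split_ifs with h
    · rw [h]
    · simp
  · refine hS.hom_eq (φ := ((shiftMultipliers N A).ad g).comp ρ') (ψ := ρ'.comp (α₂ g))
      (fun x => ?_) a
    rw [NonUnitalStarAlgHom.comp_apply, NonUnitalStarAlgHom.comp_apply, hα₂, hρ', hρ']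
    ext i j
    rw [shiftMultipliers_ad, bellMatrix_apply, bellMatrix_apply, add_sub_add_right_eq_sub,
      sub_sub_sub_cancel_right]
    simp only [sub_sub_eq_add_sub]
  · exact sum_entry_of_generates hS ρ' ρ (fun x => sum_entry_symmetric hρ hρ' x.1 x.2)
      (fun x => sum_entry_symmetric' hρ hρ' x.1 x.2)
  -- The identity giving injectivity for `ρ` here exhibits each `T a b` as a sum of entries of `ρ'`,
  -- so these entries generate `A`.
  · have h := sum_entry_permuted hρ hρ' x.1 x.2 0 0
    rw [if_pos rfl] at h
    change T x.1 x.2 ∈ U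
    rw [← h]
    exact U.sum_mem fun i _ => hmem _ _ _

end twisted

end

noncomputable section

/-! ### Finite sums of `*`-polynomials -/

namespace StarPoly

/-- Finite sums of `*`-polynomials. -/
def fsum {X ι : Type} [Fintype ι] (f : ι → StarPoly X) : StarPoly X :=
  (Finset.univ.toList.map f).foldr .add .zero

theorem eval_fsum {X ι D : Type} [Fintype ι] [NonUnitalCStarAlgebra D] (f : ι → StarPoly X)
    (s : X → D) : (fsum f).eval s = ∑ i, (f i).eval s := by
  rw [← Finset.sum_map_toList Finset.univ fun i => (f i).eval s]
  unfold fsum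
  induction (Finset.univ : Finset ι).toList with
  | nil => rfl
  | cons x l ih => simp [StarPoly.eval, ih]

end StarPoly

open UniversalCStarAlgebra

/-! ## Positivity -/

theorem eq_zero_of_sum_mul_star_eq_zero {ι D : Type} [Fintype ι] [NonUnitalCStarAlgebra D]
    {y : ι → D} (h : ∑ i, y i * star (y i) = 0) (i : ι) : y i = 0 := by
  let _ := CStarAlgebra.spectralOrder D
  have _ := CStarAlgebra.spectralOrderedRing D
  have h1 := (Finset.sum_eq_zero_iff_of_nonneg
    (fun i _ => mul_star_self_nonneg (y i))).1 h i (Finset.mem_univ _)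
  exact CStarRing.mul_star_self_eq_zero_iff _ |>.1 h1

/-- Compressing `∑ x_i x_i^* = c⁻¹ e` by `1 - e` gives zero, so the positive elements `(x_i - e
x_i)(x_i - e x_i)^*` sum to zero and each of them vanishes. -/
theorem mul_eq_self_of_sum_mul_star {ι D : Type} [Fintype ι] [NonUnitalCStarAlgebra D]
    {x : ι → D} {e : D} {c : ℂ} (hc : c ≠ 0) (he : star e = e) (hee : e * e = e)
    (h : c • ∑ i, x i * star (x i) = e) (i : ι) : e * x i = x i := by
  have h0 : ∑ i, x i * star (x i) = c⁻¹ • e := by rw [← h, inv_smul_smul₀ hc]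
  have h1 : ∑ i, (x i - e * x i) * star (x i - e * x i) = 0 := by
    have h2 : ∀ i, (x i - e * x i) * star (x i - e * x i) =
        x i * star (x i) - e * (x i * star (x i)) - (x i * star (x i)) * e +
          e * (x i * star (x i)) * e := fun i => by
      rw [star_sub, star_mul, he]
      noncomm_ring
    simp only [h2, Finset.sum_add_distrib, Finset.sum_sub_distrib, ← Finset.mul_sum,
      ← Finset.sum_mul, h0, mul_smul_comm, smul_mul_assoc, hee]
    abel
  exact (sub_eq_zero.1 (eq_zero_of_sum_mul_star_eq_zero h1 i)).symm

/-! ## The Cuntz algebra -/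

/-- Only identities between `*`-polynomials pass to the universal family, so the unit `e`, merely
asserted to exist in the relation, is written as the polynomial `∑ s_i s_i^*`. -/
theorem cuntzRelation_gen (ι : Type) [Fintype ι] [Nonempty ι] :
    (cuntzRelation ι).Holds (gen (cuntzRelation ι)) := by
  let e : StarPoly ι := .fsum fun i => .mul (.gen i) (.adj (.gen i))
  have he : ∀ (D : Type) [NonUnitalCStarAlgebra D] (s : ι → D),
      e.eval s = ∑ i, s i * star (s i) := fun D _ s => by
    simp only [e, StarPoly.eval_fsum, StarPoly.eval]
  refine ⟨e.eval (gen _), fun i => ⟨?_, ?_, ?_⟩, (he _ _).symm⟩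
  · refine eval_gen_eq (p := .mul e (.gen i)) (q := .gen i) ?_
    rintro D _ s ⟨e', h, h'⟩
    simp only [StarPoly.eval, he, h', h i]
  · refine eval_gen_eq (p := .mul (.gen i) e) (q := .gen i) ?_
    rintro D _ s ⟨e', h, h'⟩
    simp only [StarPoly.eval, he, h', h i]
  · refine eval_gen_eq (p := .mul (.adj (.gen i)) (.gen i)) (q := e) ?_
    rintro D _ s ⟨e', h, h'⟩
    simp only [StarPoly.eval, he, h', h i]

/-! ## Free products of copies of `C(S¹)` -/

namespace FreeProduct

variable {ι : Type} (A : ι → Type) [∀ i, NonUnitalCStarAlgebra (A i)]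

/-- The canonical maps into a free product. -/
def incl (i : ι) : A i →⋆ₙₐ[ℂ] FreeProduct A where
  toFun a := gen (freeProductRelation A) ⟨i, a⟩
  map_smul' c a := eval_gen_eq (R := freeProductRelation A)
    (p := .gen ⟨i, c • a⟩) (q := .smul c (.gen ⟨i, a⟩)) (by
    rintro D _ s ⟨φ, hs⟩; simp [StarPoly.eval, hs])
  map_zero' := eval_gen_eq (R := freeProductRelation A)
    (p := .gen ⟨i, 0⟩) (q := .zero) (by
    rintro D _ s ⟨φ, hs⟩; simp [StarPoly.eval, hs])
  map_add' a b := eval_gen_eq (R := freeProductRelation A)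
    (p := .gen ⟨i, a + b⟩) (q := .add (.gen ⟨i, a⟩) (.gen ⟨i, b⟩)) (by
    rintro D _ s ⟨φ, hs⟩; simp [StarPoly.eval, hs])
  map_mul' a b := eval_gen_eq (R := freeProductRelation A)
    (p := .gen ⟨i, a * b⟩) (q := .mul (.gen ⟨i, a⟩) (.gen ⟨i, b⟩)) (by
    rintro D _ s ⟨φ, hs⟩; simp [StarPoly.eval, hs])
  map_star' a := eval_gen_eq (R := freeProductRelation A)
    (p := .gen ⟨i, star a⟩) (q := .adj (.gen ⟨i, a⟩)) (by
    rintro D _ s ⟨φ, hs⟩; simp [StarPoly.eval, hs, map_star])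

theorem gen_eq_incl (i : ι) (a : A i) : gen (freeProductRelation A) ⟨i, a⟩ = incl A i a := rfl

end FreeProduct

/-- The canonical unitary of `C(S¹)`. -/
def circleCoord : C(Circle, ℂ) := ⟨fun z => z, continuous_subtype_val⟩

theorem star_circleCoord_mul : star circleCoord * circleCoord = 1 := by
  ext z
  change star (z : ℂ) * z = 1
  rw [Complex.star_def, Complex.conj_mul', Circle.norm_coe]
  simp

/-- The coordinate is unitary, so `1` belongs to `S`; it separates points, so Stone-Weierstrass
applies. -/
theorem circleCoord_generates {S : NonUnitalStarSubalgebra ℂ C(Circle, ℂ)}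
    (hS : IsClosed (S : Set C(Circle, ℂ))) (h : circleCoord ∈ S) (f : C(Circle, ℂ)) : f ∈ S := by
  have h1 : (1 : C(Circle, ℂ)) ∈ S := by
    rw [← star_circleCoord_mul]; exact mul_mem (star_mem h) h
  let U : StarSubalgebra ℂ C(Circle, ℂ) :=
    { carrier := S
      add_mem' := S.add_mem
      zero_mem' := S.zero_mem
      mul_mem' := S.mul_mem
      one_mem' := h1
      algebraMap_mem' := fun c => by
        rw [Algebra.algebraMap_eq_smul_one]; exact S.smul_mem c h1
      star_mem' := S.star_mem' }
  have hsep : U.SeparatesPoints := fun x y hxy =>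
    ⟨circleCoord, ⟨circleCoord, h, rfl⟩, fun h => hxy (Circle.ext h)⟩
  have htop := ContinuousMap.starSubalgebra_topologicalClosure_eq_top_of_separatesPoints U hsep
  have h2 : f ∈ U.topologicalClosure := by rw [htop]; trivial
  have h3 : f ∈ closure (S : Set C(Circle, ℂ)) := h2
  rwa [hS.closure_eq] at h3

theorem freeCircle_generates (ι : Type) :
    CStarGenerates fun i : ι => FreeProduct.incl (fun _ : ι => C(Circle, ℂ)) i circleCoord := by
  intro S hS h
  refine generates_gen _ S hS fun ⟨i, f⟩ => ?_
  let φ := FreeProduct.incl (fun _ : ι => C(Circle, ℂ)) i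
  exact circleCoord_generates (S := S.comap φ) (hS.preimage φ.continuous_of_cstar) (h i) f

/-! ### Representations of `C(S¹)` given by normal partial isometries -/

section circleLift

variable {D : Type} [NonUnitalCStarAlgebra D] {v : D}

attribute [local instance] IsStarNormal.instNonUnitalContinuousFunctionalCalculus

/-- By functional calculus, `v v^* v = v` forces `z z̄ z = z` on the quasispectrum. -/
theorem norm_eq_one_of_mem_quasispectrum (h₁ : v * star v * v = v) (h₂ : star v * v = v * star v)
    {z : ℂ} (hz : z ∈ quasispectrum ℂ v) : z = 0 ∨ ‖z‖ = 1 := by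
  have hv : IsStarNormal v := ⟨h₂⟩
  have h3 : cfcₙ (fun z : ℂ => z * star z * z) v = cfcₙ (fun z : ℂ => z) v := by
    rw [cfcₙ_mul (fun z : ℂ => z * star z) (fun z => z) v, cfcₙ_mul (fun z : ℂ => z) star v,
      cfcₙ_star_id v, cfcₙ_id' ℂ v, h₁]
  have h4 : z * star z * z = z := eqOn_of_cfcₙ_eq_cfcₙ h3 hv (by fun_prop) (by simp)
    (by fun_prop) rfl hz
  by_cases h0 : z = 0
  · exact Or.inl h0
  · right
    have h5 : z * star z = 1 := mul_right_cancel₀ h0 (by rw [h4, one_mul])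
    rw [Complex.star_def, Complex.mul_conj'] at h5
    have h6 : ‖z‖ ^ 2 = 1 := by exact_mod_cast h5
    nlinarith [norm_nonneg z]

open scoped Classical in
/-- The extension by zero of a function on the circle. -/
def circleExtend (f : C(Circle, ℂ)) (z : ℂ) : ℂ :=
  if h : ‖z‖ = 1 then f ⟨z, mem_sphere_zero_iff_norm.2 h⟩ else 0

theorem circleExtend_zero (f : C(Circle, ℂ)) : circleExtend f 0 = 0 := by
  simp [circleExtend]

/-- The quasispectrum lies in the union of the closed sets `{0}` and the unit circle, and the
extension is continuous on each. -/
theorem continuousOn_circleExtend (h₁ : v * star v * v = v) (h₂ : star v * v = v * star v)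
    (f : C(Circle, ℂ)) : ContinuousOn (circleExtend f) (quasispectrum ℂ v) := by
  have h3 : ContinuousOn (circleExtend f) (Metric.sphere (0 : ℂ) 1) := by
    rw [continuousOn_iff_continuous_domRestrict]
    refine f.continuous.congr fun z => Eq.symm ?_
    have hz : ‖(z : ℂ)‖ = 1 := mem_sphere_zero_iff_norm.1 z.2
    change circleExtend f z = _
    rw [circleExtend, dif_pos hz]
    rfl
  have h4 : ContinuousOn (circleExtend f) {0} := continuousOn_singleton _ _
  refine (h4.union_of_isClosed h3 isClosed_singleton Metric.isClosed_sphere).mono fun z hz => ?_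
  rcases norm_eq_one_of_mem_quasispectrum h₁ h₂ hz with h | h
  · exact Or.inl h
  · exact Or.inr (mem_sphere_zero_iff_norm.2 h)

/-- The `*`-homomorphism on `C(S¹)` determined by a normal partial isometry. -/
def circleLift (v : D) (h₁ : v * star v * v = v) (h₂ : star v * v = v * star v) :
    C(Circle, ℂ) →⋆ₙₐ[ℂ] D where
  toFun f := cfcₙ (circleExtend f) v
  map_smul' c f := by
    rw [MonoidHom.id_apply, ← cfcₙ_smul c _ v (continuousOn_circleExtend h₁ h₂ f)
      (circleExtend_zero f)]
    congr 1
    ext z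
    by_cases h : ‖z‖ = 1
    · simp only [circleExtend, dif_pos h]
      rfl
    · simp [circleExtend, h]
  map_zero' := by
    convert cfcₙ_zero ℂ v using 2
    ext z
    by_cases h : ‖z‖ = 1
    · simp only [circleExtend, dif_pos h]
      rfl
    · simp [circleExtend, h]
  map_add' f g := by
    rw [← cfcₙ_add (circleExtend f) (circleExtend g) (a := v) (continuousOn_circleExtend h₁ h₂ f)
      (circleExtend_zero f) (continuousOn_circleExtend h₁ h₂ g) (circleExtend_zero g)]
    congr 1
    ext z
    by_cases h : ‖z‖ = 1
    · simp only [circleExtend, dif_pos h]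
      rfl
    · simp [circleExtend, h]
  map_mul' f g := by
    rw [← cfcₙ_mul _ _ v (continuousOn_circleExtend h₁ h₂ f)
      (circleExtend_zero f) (continuousOn_circleExtend h₁ h₂ g) (circleExtend_zero g)]
    congr 1
    ext z
    by_cases h : ‖z‖ = 1
    · simp only [circleExtend, dif_pos h]
      rfl
    · simp [circleExtend, h]
  map_star' f := by
    rw [← cfcₙ_star]
    congr 1
    ext z
    by_cases h : ‖z‖ = 1
    · simp only [circleExtend, dif_pos h]
      rfl
    · simp [circleExtend, h]

theorem circleLift_circleCoord (v : D) (h₁ : v * star v * v = v) (h₂ : star v * v = v * star v) :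
    circleLift v h₁ h₂ circleCoord = v := by
  have hv : IsStarNormal v := ⟨h₂⟩
  change cfcₙ (circleExtend circleCoord) v = v
  conv_rhs => rw [← cfcₙ_id' ℂ v]
  refine cfcₙ_congr fun z hz => ?_
  rcases norm_eq_one_of_mem_quasispectrum h₁ h₂ hz with rfl | h
  · exact circleExtend_zero _
  · rw [circleExtend, dif_pos h]
    rfl

end circleLift

end

noncomputable section

open UniversalCStarAlgebra

/-! ## Quantum Cuntz-Krieger families of the quantum graphs on a matrix algebra -/

variable {N : ℕ} [NeZero N] {D : Type} [NonUnitalCStarAlgebra D]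

/-- With the normalization `N e_ij` the comultiplication is dual to matrix multiplication without
scalar factors. -/
theorem matComul_smul_matUnit (i j : ZMod N) : matComul N ((N : ℂ) • matUnit N i j) =
    ∑ k, ((N : ℂ) • matUnit N i k) ⊗ₜ[ℂ] ((N : ℂ) • matUnit N k j) := by
  rw [map_smul, matComul_matUnit]
  simp only [TensorProduct.smul_tmul_smul, ← Finset.smul_sum, smul_smul]

theorem matN_hom_ext_smul {M : Type*} [AddCommGroup M] [Module ℂ M] {f g : MatN N →ₗ[ℂ] M}
    (h : ∀ i j, f ((N : ℂ) • matUnit N i j) = g ((N : ℂ) • matUnit N i j)) : f = g := by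
  have hN : (N : ℂ) ≠ 0 := by exact_mod_cast NeZero.ne N
  refine matN_hom_ext fun i j => ?_
  have h1 := h i j
  rw [map_smul, map_smul] at h1
  exact smul_right_injective M hN h1

/-- The matrix of a linear map on `M_N(ℂ)`, with entries its values at `N e_ij`. -/
def ckMatrix (s : MatN N →ₗ[ℂ] D) : CStarMatrix (ZMod N) (ZMod N) D :=
  CStarMatrix.ofMatrix fun i j => s ((N : ℂ) • matUnit N i j)

theorem ckMatrix_apply (s : MatN N →ₗ[ℂ] D) (i j : ZMod N) :
    ckMatrix s i j = s ((N : ℂ) • matUnit N i j) := rfl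

theorem starConj_smul_matUnit (s : MatN N →ₗ[ℂ] D) (i j : ZMod N) :
    s.starConj ((N : ℂ) • matUnit N i j) = star (ckMatrix s j i) := by
  change star (s (star _)) = _
  rw [star_smul, star_matUnit, Complex.star_def, Complex.conj_natCast]
  rfl

theorem star_ckMatrix_mul_apply (s : MatN N →ₗ[ℂ] D) (i j : ZMod N) :
    LinearMap.mul' ℂ D (TensorProduct.map s.starConj s (matComul N ((N : ℂ) • matUnit N i j))) =
      (star (ckMatrix s) * ckMatrix s : CStarMatrix (ZMod N) (ZMod N) D) i j := by
  rw [matComul_smul_matUnit, CStarMatrix.mul_apply]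
  simp only [map_sum, TensorProduct.map_tmul, LinearMap.mul'_apply, starConj_smul_matUnit,
    CStarMatrix.star_apply, ckMatrix_apply]

theorem ckMatrix_mul_star_apply (s : MatN N →ₗ[ℂ] D) (i j : ZMod N) :
    LinearMap.mul' ℂ D (TensorProduct.map s s.starConj (matComul N ((N : ℂ) • matUnit N i j))) =
      (ckMatrix s * star (ckMatrix s) : CStarMatrix (ZMod N) (ZMod N) D) i j := by
  rw [matComul_smul_matUnit, CStarMatrix.mul_apply]
  simp only [map_sum, TensorProduct.map_tmul, LinearMap.mul'_apply, starConj_smul_matUnit,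
    CStarMatrix.star_apply, ckMatrix_apply]

/-- Each application of `m^*` becomes a matrix product, and `s^*` corresponds to the adjoint matrix.
-/
theorem isometry_iff (s : MatN N →ₗ[ℂ] D) :
    LinearMap.mul' ℂ D ∘ₗ TensorProduct.map LinearMap.id (LinearMap.mul' ℂ D) ∘ₗ
      TensorProduct.map s (TensorProduct.map s.starConj s) ∘ₗ
      TensorProduct.map LinearMap.id (matSpace N).comul ∘ₗ (matSpace N).comul = s ↔
    ckMatrix s * (star (ckMatrix s) * ckMatrix s) = ckMatrix s := by
  have key : ∀ i j, (LinearMap.mul' ℂ D ∘ₗ TensorProduct.map LinearMap.id (LinearMap.mul' ℂ D) ∘ₗ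
      TensorProduct.map s (TensorProduct.map s.starConj s) ∘ₗ
      TensorProduct.map LinearMap.id (matSpace N).comul ∘ₗ (matSpace N).comul)
        ((N : ℂ) • matUnit N i j) = (ckMatrix s * (star (ckMatrix s) * ckMatrix s) :
          CStarMatrix (ZMod N) (ZMod N) D) i j := by
    intro i j
    change LinearMap.mul' ℂ D (TensorProduct.map LinearMap.id (LinearMap.mul' ℂ D)
      (TensorProduct.map s (TensorProduct.map s.starConj s)
      (TensorProduct.map LinearMap.id (matComul N) (matComul N ((N : ℂ) • matUnit N i j))))) = _
    rw [matComul_smul_matUnit, CStarMatrix.mul_apply]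
    simp only [map_sum, TensorProduct.map_tmul, LinearMap.mul'_apply, LinearMap.id_apply,
      star_ckMatrix_mul_apply, ckMatrix_apply]
  constructor
  · intro h
    ext i j
    rw [← key, h, ckMatrix_apply]
  · intro h
    refine matN_hom_ext_smul fun i j => ?_
    rw [key, h, ckMatrix_apply]

/-- The matrix `m` records the right-hand side, the only place where the graph enters; it is `V V^*`
for the trivial graph and a constant diagonal matrix for the complete one. -/
theorem adjacency_iff (𝒢 : QuantumGraph (matSpace N)) (s : MatN N →ₗ[ℂ] D)
    (m : CStarMatrix (ZMod N) (ZMod N) D)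
    (hm : ∀ i j, LinearMap.mul' ℂ D (TensorProduct.map s s.starConj
      (matComul N (𝒢.adj ((N : ℂ) • matUnit N i j)))) = m i j) :
    LinearMap.mul' ℂ D ∘ₗ TensorProduct.map s.starConj s ∘ₗ (matSpace N).comul =
      LinearMap.mul' ℂ D ∘ₗ TensorProduct.map s s.starConj ∘ₗ (matSpace N).comul ∘ₗ 𝒢.adj ↔
    star (ckMatrix s) * ckMatrix s = m := by
  constructor
  · intro h
    ext i j
    rw [← hm, ← star_ckMatrix_mul_apply]
    exact LinearMap.congr_fun h _
  · intro h
    refine matN_hom_ext_smul fun i j => ?_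
    refine (star_ckMatrix_mul_apply s i j).trans ?_
    rw [h, ← hm]
    rfl

theorem isCuntzKriegerFamily_trivial_iff (s : MatN N →ₗ[ℂ] D) :
    (QuantumGraph.trivial (matSpace N)).IsCuntzKriegerFamily s ↔
      ckMatrix s * (star (ckMatrix s) * ckMatrix s) = ckMatrix s ∧
      star (ckMatrix s) * ckMatrix s = ckMatrix s * star (ckMatrix s) := by
  rw [← isometry_iff, ← adjacency_iff (QuantumGraph.trivial (matSpace N)) s _
    (fun i j => ckMatrix_mul_star_apply s i j)]
  exact ⟨fun h => ⟨h.1, h.2⟩, fun h => ⟨h.1, h.2⟩⟩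

/-- Here `δ² tr(N e_ij) = N² δ_ij`; one factor `N` stays outside so that the sum consists of the
normalized units `N e_kk`. -/
theorem complete_adj_smul_matUnit (i j : ZMod N) :
    (QuantumGraph.complete (matSpace N)).adj ((N : ℂ) • matUnit N i j) =
      if i = j then (N : ℂ) • ∑ k, (N : ℂ) • matUnit N k k else 0 := by
  have hN : (N : ℂ) ≠ 0 := by exact_mod_cast NeZero.ne N
  have h1 : normTrace N ((N : ℂ) • matUnit N i j) = if i = j then 1 else 0 := by
    rw [map_smul]
    change (N : ℂ) • ((N : ℂ)⁻¹ * ∑ k, matUnit N i j k k) = _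
    rw [smul_eq_mul, mul_inv_cancel_left₀ hN]
    simp only [matUnit_apply]
    by_cases h : i = j
    · subst h; simp
    · rw [if_neg h]
      refine Finset.sum_eq_zero fun k _ => if_neg ?_
      rintro ⟨rfl, rfl⟩
      exact h rfl
  have h2 : (1 : MatN N) = ∑ k, matUnit N k k := by
    ext p q
    rw [CStarMatrix.sum_apply, CStarMatrix.one_apply]
    simp only [matUnit_apply]
    by_cases h : p = q
    · subst h; simp
    · rw [if_neg h, Finset.sum_eq_zero]
      intro k _
      refine if_neg ?_
      rintro ⟨rfl, rfl⟩
      exact h rfl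
  change ((N : ℝ) : ℂ) ^ 2 • normTrace N ((N : ℂ) • matUnit N i j) • (1 : MatN N) = _
  rw [h1, h2]
  split_ifs with h
  · rw [one_smul, ← Finset.smul_sum, smul_smul, sq, Complex.ofReal_natCast]
  · simp

/-- The element `N ∑ S_kl S_kl^*`. -/
def rangeSum (m : CStarMatrix (ZMod N) (ZMod N) D) : D :=
  (N : ℂ) • ∑ k, (m * star m : CStarMatrix (ZMod N) (ZMod N) D) k k

theorem isCuntzKriegerFamily_complete_iff (s : MatN N →ₗ[ℂ] D) :
    (QuantumGraph.complete (matSpace N)).IsCuntzKriegerFamily s ↔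
      ckMatrix s * (star (ckMatrix s) * ckMatrix s) = ckMatrix s ∧
      star (ckMatrix s) * ckMatrix s = diagMatrix (rangeSum (ckMatrix s)) := by
  rw [← isometry_iff, ← adjacency_iff (QuantumGraph.complete (matSpace N)) s _ (fun i j => ?_)]
  · exact ⟨fun h => ⟨h.1, h.2⟩, fun h => ⟨h.1, h.2⟩⟩
  · rw [complete_adj_smul_matUnit, diagMatrix_apply]
    split_ifs
    · simp only [map_smul _ (N : ℂ) (∑ k, _), map_sum, ckMatrix_mul_star_apply, rangeSum]
    · simp

/-- The linear map on `M_N(ℂ)` with a given matrix. -/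
def linearOfMatrix (m : CStarMatrix (ZMod N) (ZMod N) D) : MatN N →ₗ[ℂ] D where
  toFun b := (N : ℂ)⁻¹ • ∑ i, ∑ j, b i j • m i j
  map_add' a b := by
    simp only [CStarMatrix.add_apply, add_smul, Finset.sum_add_distrib, smul_add]
  map_smul' c a := by
    simp only [CStarMatrix.smul_apply, smul_eq_mul, mul_smul, ← Finset.smul_sum, RingHom.id_apply]
    rw [smul_comm]

theorem ckMatrix_linearOfMatrix (m : CStarMatrix (ZMod N) (ZMod N) D) :
    ckMatrix (linearOfMatrix m) = m := by
  have hN : (N : ℂ) ≠ 0 := by exact_mod_cast NeZero.ne N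
  ext i j
  rw [ckMatrix_apply, map_smul]
  change (N : ℂ) • (N : ℂ)⁻¹ • ∑ k, ∑ l, matUnit N i j k l • m k l = _
  rw [smul_inv_smul₀ hN, Finset.sum_eq_single i, Finset.sum_eq_single j]
  · simp [matUnit_apply]
  · intro k _ hk; simp [matUnit_apply, hk.symm]
  · simp
  · intro k _ hk; simp [matUnit_apply, hk.symm]
  · simp

/-! ### The matrix of generators of a quantum Cuntz-Krieger algebra and its relations -/

section FO

variable (𝒢 : QuantumGraph (matSpace N))

/-- The universal quantum Cuntz-Krieger family. -/
def foGen : MatN N →ₗ[ℂ] 𝒢.FO where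
  toFun b := gen 𝒢.relation b
  map_add' a b := eval_gen_eq (R := 𝒢.relation)
    (p := .gen (a + b)) (q := .add (.gen a) (.gen b)) (by
    rintro D _ s ⟨S, hs, -⟩; simp [StarPoly.eval, hs])
  map_smul' c a := eval_gen_eq (R := 𝒢.relation)
    (p := .gen (c • a)) (q := .smul c (.gen a)) (by
    rintro D _ s ⟨S, hs, -⟩; simp [StarPoly.eval, hs])

theorem foGen_apply (b : MatN N) : foGen 𝒢 b = gen 𝒢.relation b := rfl

/-- The matrix of standard generators `S_kl`. -/
def foMatrix : CStarMatrix (ZMod N) (ZMod N) 𝒢.FO := ckMatrix (foGen 𝒢)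

theorem foMatrix_apply (k l : ZMod N) :
    foMatrix 𝒢 k l = gen 𝒢.relation ((N : ℂ) • matUnit N k l) := rfl

theorem foMatrix_generates : CStarGenerates fun x : ZMod N × ZMod N => foMatrix 𝒢 x.1 x.2 := by
  have hN : (N : ℂ) ≠ 0 := by exact_mod_cast NeZero.ne N
  intro S hS h
  refine generates_gen _ S hS fun b => ?_
  rw [← foGen_apply, ← sum_matUnit b]
  simp only [map_sum]
  refine S.sum_mem fun i _ => S.sum_mem fun j _ => ?_
  rw [map_smul]
  refine S.smul_mem _ ?_
  have h1 := S.smul_mem (N : ℂ)⁻¹ (h (i, j))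
  have h2 : (N : ℂ)⁻¹ • foMatrix 𝒢 i j = foGen 𝒢 (matUnit N i j) := by
    rw [foMatrix, ckMatrix_apply, map_smul, inv_smul_smul₀ hN]
  rwa [h2] at h1

/-- The entries of `V V^*`, as `*`-polynomials. -/
def polyMulStar (i j : ZMod N) : StarPoly (MatN N) :=
  .fsum fun k => .mul (.gen ((N : ℂ) • matUnit N i k)) (.adj (.gen ((N : ℂ) • matUnit N j k)))

/-- The entries of `V^* V`, as `*`-polynomials. -/
def polyStarMul (i j : ZMod N) : StarPoly (MatN N) :=
  .fsum fun k => .mul (.adj (.gen ((N : ℂ) • matUnit N k i))) (.gen ((N : ℂ) • matUnit N k j))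

theorem eval_polyMulStar (s : MatN N → D) (S : MatN N →ₗ[ℂ] D) (hs : ∀ b, s b = S b)
    (i j : ZMod N) : (polyMulStar i j).eval s =
      (ckMatrix S * star (ckMatrix S) : CStarMatrix (ZMod N) (ZMod N) D) i j := by
  simp only [polyMulStar, StarPoly.eval_fsum, StarPoly.eval, hs, CStarMatrix.mul_apply,
    CStarMatrix.star_apply, ckMatrix_apply]

theorem eval_polyStarMul (s : MatN N → D) (S : MatN N →ₗ[ℂ] D) (hs : ∀ b, s b = S b)
    (i j : ZMod N) : (polyStarMul i j).eval s =
      (star (ckMatrix S) * ckMatrix S : CStarMatrix (ZMod N) (ZMod N) D) i j := by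
  simp only [polyStarMul, StarPoly.eval_fsum, StarPoly.eval, hs, CStarMatrix.mul_apply,
    CStarMatrix.star_apply, ckMatrix_apply]

/-- The matrix identity is transferred entry by entry, as each entry of either side is a
`*`-polynomial in the generators. -/
theorem foMatrix_isometry :
    foMatrix 𝒢 * (star (foMatrix 𝒢) * foMatrix 𝒢) = foMatrix 𝒢 := by
  have key : ∀ (D : Type) [NonUnitalCStarAlgebra D] (s : MatN N → D) (S : MatN N →ₗ[ℂ] D),
      (∀ b, s b = S b) → ∀ i j,
      (StarPoly.fsum fun k => .mul (.gen ((N : ℂ) • matUnit N i k)) (polyStarMul k j)).eval s =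
      (ckMatrix S * (star (ckMatrix S) * ckMatrix S) : CStarMatrix (ZMod N) (ZMod N) D) i j := by
    intro D _ s S hs i j
    rw [CStarMatrix.mul_apply]
    simp only [StarPoly.eval_fsum, StarPoly.eval, eval_polyStarMul s S hs, hs, ckMatrix_apply]
  ext i j
  refine (key _ _ (foGen 𝒢) (fun _ => rfl) i j).symm.trans ?_
  refine eval_gen_eq (R := 𝒢.relation) (q := .gen ((N : ℂ) • matUnit N i j)) ?_
  rintro D _ s ⟨S, hs, hS⟩
  rw [key D s S hs, (isometry_iff S).1 hS.isometry, StarPoly.eval, hs, ckMatrix_apply]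

end FO

theorem foMatrix_trivial :
    star (foMatrix (QuantumGraph.trivial (matSpace N))) *
        foMatrix (QuantumGraph.trivial (matSpace N)) =
      foMatrix (QuantumGraph.trivial (matSpace N)) *
        star (foMatrix (QuantumGraph.trivial (matSpace N))) := by
  ext i j
  refine (eval_polyStarMul _ (foGen _) (fun _ => rfl) i j).symm.trans ?_
  refine Eq.trans ?_ (eval_polyMulStar _ (foGen _) (fun _ => rfl) i j)
  refine eval_gen_eq ?_
  rintro D _ s ⟨S, hs, hS⟩
  rw [eval_polyStarMul s S hs, eval_polyMulStar s S hs,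
    ((isCuntzKriegerFamily_trivial_iff S).1 hS).2]

theorem foMatrix_complete :
    star (foMatrix (QuantumGraph.complete (matSpace N))) *
        foMatrix (QuantumGraph.complete (matSpace N)) =
      diagMatrix (rangeSum (foMatrix (QuantumGraph.complete (matSpace N)))) := by
  let r : StarPoly (MatN N) := .smul (N : ℂ) (.fsum fun k => polyMulStar k k)
  have hr : ∀ (D : Type) [NonUnitalCStarAlgebra D] (s : MatN N → D) (S : MatN N →ₗ[ℂ] D),
      (∀ b, s b = S b) → r.eval s = rangeSum (ckMatrix S) := by
    intro D _ s S hs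
    simp only [r, StarPoly.eval_fsum, StarPoly.eval, eval_polyMulStar s S hs, rangeSum]
  ext i j
  refine (eval_polyStarMul _ (foGen _) (fun _ => rfl) i j).symm.trans ?_
  rw [foMatrix, ← hr _ _ (foGen (QuantumGraph.complete (matSpace N))) (fun _ => rfl),
    diagMatrix_apply]
  -- The case distinction is moved inside the polynomial, so that both sides are evaluations of
  -- `*`-polynomials.
  have h : ∀ (D : Type) [NonUnitalCStarAlgebra D] (s : MatN N → D),
      (if i = j then r else .zero : StarPoly (MatN N)).eval s = if i = j then r.eval s else 0 := by
    intro D _ s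
    split_ifs <;> rfl
  refine Eq.trans ?_ (h _ _)
  refine eval_gen_eq ?_
  rintro D _ s ⟨S, hs, hS⟩
  rw [eval_polyStarMul s S hs, h, hr D s S hs,
    ((isCuntzKriegerFamily_complete_iff S).1 hS).2, diagMatrix_apply]

/-! ## The actions on the generators -/

theorem cuntzAction_gen {ι G : Type} [Fintype ι] [Group G] (σ : G →* Equiv.Perm ι) (g : G)
    (i : ι) : cuntzAction σ g (gen (cuntzRelation ι) i) = gen (cuntzRelation ι) (σ g i) := by
  rw [cuntzAction, action_gen]

theorem freeProductAction_incl {ι G A : Type} [Group G] [NonUnitalCStarAlgebra A]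
    (σ : G →* Equiv.Perm ι) (g : G) (i : ι) (a : A) :
    freeProductAction σ g (FreeProduct.incl (fun _ : ι => A) i a) =
      FreeProduct.incl (fun _ : ι => A) (σ g i) a := by
  rw [freeProductAction, ← FreeProduct.gen_eq_incl, action_gen]
  rfl

theorem action_foGen {G : Type} [Group G] (𝒢 : QuantumGraph (matSpace N)) (θ : G → MatN N →ₗ[ℂ] MatN N)
    (hθ : ∀ g, 𝒢.IsSymmetry (θ g)) (θ_one : ∀ b, θ 1 b = b)
    (θ_mul : ∀ g h b, θ (g * h) b = θ g (θ h b)) (g : G) (b : MatN N) :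
    𝒢.action θ hθ θ_one θ_mul g (foGen 𝒢 b) = foGen 𝒢 (θ g b) := by
  rw [QuantumGraph.action, foGen_apply, action_gen]
  rfl

theorem phase_action_foMatrix (𝒢 : QuantumGraph (matSpace N))
    (h : ∀ g : Multiplicative (ZMod N), 𝒢.IsSymmetry (phase N g)) (g : Multiplicative (ZMod N))
    (k l : ZMod N) : 𝒢.action (phase N) h phase_one phase_mul g (foMatrix 𝒢 k l) =
      (ZMod.stdAddChar (g.toAdd * (k - l)) : ℂ) • foMatrix 𝒢 k l := by
  rw [foMatrix, ckMatrix_apply, action_foGen, map_smul (phase N g), phase_matUnit, smul_comm,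
    map_smul]

theorem shift_action_foMatrix (𝒢 : QuantumGraph (matSpace N))
    (h : ∀ g : Multiplicative (ZMod N), 𝒢.IsSymmetry (shift N g)) (g : Multiplicative (ZMod N))
    (k l : ZMod N) : 𝒢.action (shift N) h shift_one shift_mul g (foMatrix 𝒢 k l) =
      foMatrix 𝒢 (k - g.toAdd) (l - g.toAdd) := by
  rw [foMatrix, ckMatrix_apply, action_foGen, map_smul (shift N g), shift_matUnit, ckMatrix_apply]

/-! ## The main theorem -/

section main

variable (N)

/-- The generators of the Cuntz algebra. -/
def cuntzGen (a b : ZMod N) : CuntzSq N := gen (cuntzRelation (ZMod N × ZMod N)) (a, b)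

/-- The canonical unitaries of the free product of copies of `C(S¹)`. -/
def freeCircleGen (a b : ZMod N) : FreeCircleSq N :=
  FreeProduct.incl (fun _ : ZMod N × ZMod N => C(Circle, ℂ)) (a, b) circleCoord

/-- The diagonal matrix with entry `e = N ∑ S_kl S_kl^*` is the unit of the Cuntz family: Pauli
conjugation fixes it, all conjugates of `V` share the initial projection `V^* V`, and their range
projections add up to it by `sum_pauliConj`. -/
theorem exists_cuntz_to_matrix : ∃ ρ : CuntzSq N →⋆ₙₐ[ℂ] CStarMatrix (ZMod N) (ZMod N) (FOComplete N),
    ∀ a b, ρ (cuntzGen N a b) = pauliConj a b (foMatrix _) := by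
  have hN : (N : ℂ) ≠ 0 := by exact_mod_cast NeZero.ne N
  set V := foMatrix (QuantumGraph.complete (matSpace N))
  set e := rangeSum V with he
  have h1 : V * (star V * V) = V := foMatrix_isometry _
  have h2 : star V * V = diagMatrix e := foMatrix_complete
  rw [h2] at h1
  have h3 : star (diagMatrix (N := N) e) = diagMatrix e := by rw [← h2, star_mul, star_star]
  have h4 : diagMatrix (N := N) e * diagMatrix e = diagMatrix e := by
    nth_rewrite 1 [← h2]
    rw [mul_assoc, h1, h2]
  have h5 : star e = e := by
    have h := congrArg (fun m => CStarMatrix.entryCLM (0 : ZMod N) 0 m) h3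
    simpa [CStarMatrix.entryCLM_apply, CStarMatrix.star_apply, diagMatrix_apply] using h
  have h6 : e * e = e := by
    have h := congrArg (fun m => CStarMatrix.entryCLM (0 : ZMod N) 0 m) h4
    simpa [CStarMatrix.entryCLM_apply, diagMatrix_mul_apply, diagMatrix_apply] using h
  -- That `e` is also a left unit is not among the relations; it follows by positivity, as `e` is a
  -- projection equal to `N ∑ S_kl S_kl^*`.
  have h7 : diagMatrix e * V = V := by
    ext k l
    rw [diagMatrix_mul_apply]
    refine mul_eq_self_of_sum_mul_star (x := fun x : ZMod N × ZMod N => V x.1 x.2) hN h5 h6 ?_ (k, l)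
    rw [Fintype.sum_prod_type, he, rangeSum]
    simp only [CStarMatrix.mul_apply, CStarMatrix.star_apply]
  refine ⟨lift (fun x => pauliConj x.1 x.2 V) ⟨diagMatrix e, fun x => ⟨?_, ?_, ?_⟩, ?_⟩,
    fun a b => lift_gen _ _ _⟩
  · conv_lhs => rw [← pauliConj_diagMatrix x.1 x.2 e]
    rw [← map_mul, h7]
  · conv_lhs => rw [← pauliConj_diagMatrix x.1 x.2 e]
    rw [← map_mul, h1]
  · rw [← map_star, ← map_mul, h2, pauliConj_diagMatrix]
  · simp only [← map_star, ← map_mul]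
    rw [Fintype.sum_prod_type, sum_pauliConj]
    rfl

/-- `V` is a normal partial isometry, hence so are its Pauli conjugates, and each determines a not
necessarily unital representation of one copy of `C(S¹)`. -/
theorem exists_freeCircle_to_matrix :
    ∃ ρ : FreeCircleSq N →⋆ₙₐ[ℂ] CStarMatrix (ZMod N) (ZMod N) (FOTrivial N),
    ∀ a b, ρ (freeCircleGen N a b) = pauliConj a b (foMatrix _) := by
  set V := foMatrix (QuantumGraph.trivial (matSpace N))
  have h1 : V * star V * V = V := by rw [mul_assoc]; exact foMatrix_isometry _
  have h2 : star V * V = V * star V := foMatrix_trivial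
  have h3 : ∀ a b, pauliConj a b V * star (pauliConj a b V) * pauliConj a b V = pauliConj a b V :=
    fun a b => by rw [← map_star, ← map_mul, ← map_mul, h1]
  have h4 : ∀ a b, star (pauliConj a b V) * pauliConj a b V =
      pauliConj a b V * star (pauliConj a b V) :=
    fun a b => by rw [← map_star, ← map_mul, ← map_mul, h2]
  refine ⟨lift (fun x => circleLift (pauliConj x.1.1 x.1.2 V) (h3 _ _) (h4 _ _) x.2)
    ⟨fun x => circleLift (pauliConj x.1 x.2 V) (h3 _ _) (h4 _ _), fun _ _ => rfl⟩, fun a b => ?_⟩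
  rw [freeCircleGen, ← FreeProduct.gen_eq_incl]
  refine (lift_gen _ _ _).trans ?_
  exact circleLift_circleCoord _ _ _

/-- Each canonical unitary is a normal partial isometry in the free product, and `bellMatrix`
respects products and adjoints entrywise. -/
theorem exists_foTrivial_to_matrix :
    ∃ ρ : FOTrivial N →⋆ₙₐ[ℂ] CStarMatrix (ZMod N) (ZMod N) (FreeCircleSq N),
    ∀ k l, ρ (foMatrix _ k l) = bellMatrix (freeCircleGen N) k l := by
  have h1 : ∀ a b, star (freeCircleGen N a b) * freeCircleGen N a b =
      freeCircleGen N a b * star (freeCircleGen N a b) := fun a b => by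
    rw [freeCircleGen, ← map_star, ← map_mul, ← map_mul, mul_comm]
  have h2 : ∀ a b, freeCircleGen N a b * (star (freeCircleGen N a b) * freeCircleGen N a b) =
      freeCircleGen N a b := fun a b => by
    rw [freeCircleGen, ← map_star, ← map_mul, ← map_mul, star_circleCoord_mul, mul_one]
  have hs : (QuantumGraph.trivial (matSpace N)).IsCuntzKriegerFamily
      (linearOfMatrix (bellMatrix (freeCircleGen N))) := by
    rw [isCuntzKriegerFamily_trivial_iff, ckMatrix_linearOfMatrix, star_bellMatrix]
    simp only [bellMatrix_mul, h1, and_true]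
    simp only [← h1, h2]
  refine ⟨lift (linearOfMatrix (bellMatrix (freeCircleGen N))) ⟨_, fun _ => rfl, hs⟩, fun k l => ?_⟩
  rw [foMatrix_apply]
  refine (lift_gen _ _ _).trans ?_
  rw [← ckMatrix_apply, ckMatrix_linearOfMatrix]

/-- As `T^* T = e` for every generator, completeness of the Bell basis makes `V^* V` constant
diagonal; the partial traces identify its entry with the sum of all range projections, which is
again `e`. -/
theorem exists_foComplete_to_matrix :
    ∃ ρ : FOComplete N →⋆ₙₐ[ℂ] CStarMatrix (ZMod N) (ZMod N) (CuntzSq N),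
    ∀ k l, ρ (foMatrix _ k l) = bellMatrix (cuntzGen N) k l := by
  obtain ⟨e, h, hsum⟩ := cuntzRelation_gen (ZMod N × ZMod N)
  have h1 : ∀ a b, star (cuntzGen N a b) * cuntzGen N a b = e := fun a b => (h (a, b)).2.2
  have h2 : ∀ a b, cuntzGen N a b * e = cuntzGen N a b := fun a b => (h (a, b)).2.1
  have hs : (QuantumGraph.complete (matSpace N)).IsCuntzKriegerFamily
      (linearOfMatrix (bellMatrix (cuntzGen N))) := by
    rw [isCuntzKriegerFamily_complete_iff, ckMatrix_linearOfMatrix, rangeSum, star_bellMatrix]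
    simp only [bellMatrix_mul, h1, h2, true_and]
    rw [sum_bellMatrix_diag, bellMatrix_const, ← hsum, Fintype.sum_prod_type]
    rfl
  refine ⟨lift (linearOfMatrix (bellMatrix (cuntzGen N))) ⟨_, fun _ => rfl, hs⟩, fun k l => ?_⟩
  rw [foMatrix_apply]
  refine (lift_gen _ _ _).trans ?_
  rw [← ckMatrix_apply, ckMatrix_linearOfMatrix]

end main

end

/-! ### The four isomorphisms -/

theorem mainTheorem5 (N : ℕ) [NeZero N] :
    Nonempty (CStarMatrix (ZMod N) (ZMod N) (FOComplete N) ≃⋆ₐ[ℂ]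
      DoubleCrossedProduct (betaOneCuntz N) (betaTwoCuntz N) (betaCuntz_comm N)) ∧
    Nonempty (CStarMatrix (ZMod N) (ZMod N) (CuntzSq N) ≃⋆ₐ[ℂ]
      DoubleCrossedProduct (alphaOneComplete N) (alphaTwoComplete N) (alphaComplete_comm N)) ∧
    Nonempty (CStarMatrix (ZMod N) (ZMod N) (FOTrivial N) ≃⋆ₐ[ℂ]
      DoubleCrossedProduct (betaOneFree N) (betaTwoFree N) (betaFree_comm N)) ∧
    Nonempty (CStarMatrix (ZMod N) (ZMod N) (FreeCircleSq N) ≃⋆ₐ[ℂ]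
      DoubleCrossedProduct (alphaOneTrivial N) (alphaTwoTrivial N) (alphaTrivial_comm N)) := by
  obtain ⟨ρ, hρ⟩ := exists_cuntz_to_matrix N
  obtain ⟨ρ', hρ'⟩ := exists_foComplete_to_matrix N
  obtain ⟨σ, hσ⟩ := exists_freeCircle_to_matrix N
  obtain ⟨σ', hσ'⟩ := exists_foTrivial_to_matrix N
  have hT : CStarGenerates fun x : ZMod N × ZMod N => cuntzGen N x.1 x.2 :=
    UniversalCStarAlgebra.generates_gen _
  have hU : CStarGenerates fun x : ZMod N × ZMod N => freeCircleGen N x.1 x.2 :=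
    freeCircle_generates _
  refine ⟨?_, ?_, ?_, ?_⟩
  · exact nonempty_matrix_equiv_of_permuted hT (foMatrix_generates _) hρ hρ' _
      (fun g a b => cuntzAction_gen _ g (a, b)) (fun g a b => cuntzAction_gen _ g (a, b))
  · exact nonempty_matrix_equiv_of_symmetric hT (foMatrix_generates _) hρ hρ' _
      (phase_action_foMatrix _ _) (shift_action_foMatrix _ _)
  · exact nonempty_matrix_equiv_of_permuted hU (foMatrix_generates _) hσ hσ' _
      (fun g a b => freeProductAction_incl _ g (a, b) _)
      (fun g a b => freeProductAction_incl _ g (a, b) _)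
  · exact nonempty_matrix_equiv_of_symmetric hU (foMatrix_generates _) hσ hσ' _
      (phase_action_foMatrix _ _) (shift_action_foMatrix _ _)
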